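/- Consider the word RAM with words of $W$ bits. The input is a connected undirected simple graph $G$ with $n$ vertices and maximum degree $\Delta$, given by adjacency lists (the length and each entry of a list can be read in constant time), with real edge weights stored alongside the list entries and accessible only through constant-time comparisons. A program can output edges one at a time, and nothing is assumed about the initial contents of the memory. The space complexity of a program (for given $G$ and $W$) is the number of memory cells it uses in the worst case over the weights and the initial memory contents; the read-only input and the output are not counted. "For word size in $\Omega(\log n)$" means: there is a constant $\kappa$ such that the claim holds for all $W \ge \kappa\,(\lfloor\log_2 n\rfloor+1)$. Let $\mathcal A$ be an MST algorithm, i.e. a program that, for word size in $\Omega(\log n)$, on every connected edge-weighted graph outputs each edge of some minimum spanning tree exactly once and halts. Let $\mathcal T$ be a natural number that depends on the unweighted graph $G$ (with its adjacency lists) only, such that the running time of $\mathcal A$ is in $O(\mathcal T)$, and let $\mathcal S$ be the space complexity of $\mathcal A$. Suppose that $\mathcal T$ can be computed, as a single machine word, in $O(\Delta n+1)$ steps and $O(n+\mathcal S)$ space, for word size in $\Omega(\log n)$. Then there is a program that, for word size in $\Omega(\log n)$, on every connected edge-weighted graph outputs each edge of some minimum spanning tree exactly once and halts, such that the number of steps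 until the first output (there is no preprocessing), between two consecutive outputs, and from the last output until halting is in $O\!\left(\max\left(\Delta, \frac{\mathcal T}{n}\right)\right)$, and whose space complexity is in $\Theta(n+\mathcal S)$. All constants depend only on $\mathcal A$, on the program that computes $\mathcal T$, and on the constants in the assumptions. -/

import Mathlib

namespace MSTEnum

/-- A finite simple graph on the vertices `0, …, n - 1`, given by adjacency lists: `adj v` lists the
neighbours of `v`, each exactly once, in an arbitrary order. -/
structure Input where
  n : ℕ
  graph : SimpleGraph (Fin n)
  adj : Fin n → List (Fin n)
  nodup_adj : ∀ v, (adj v).Nodup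
  mem_adj : ∀ u v, v ∈ adj u ↔ graph.Adj u v

namespace Input

/-- Edge weights; only the values on the edges of the graph are ever used. -/
abbrev Weight (I : Input) : Type := Sym2 (Fin I.n) → ℝ

open Classical in
/-- The maximum degree of the graph. -/
noncomputable def maxDeg (I : Input) : ℕ := I.graph.maxDegree

/-- Length of the adjacency list of `v` (and `0` if `v` is not a vertex). -/
def degree (I : Input) (v : ℕ) : ℕ :=
  if h : v < I.n then (I.adj ⟨v, h⟩).length else 0

/-- The `i`-th entry of the adjacency list of `v` (and `0` if there is no such entry). -/
def neighbor (I : Input) (v i : ℕ) : ℕ :=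
  if h : v < I.n then (((I.adj ⟨v, h⟩)[i]?).map Fin.val).getD 0 else 0

/-- The weight stored alongside the `i`-th entry of the adjacency list of `v`, if there is such
an entry. -/
def entryWeight (I : Input) (w : I.Weight) (v i : ℕ) : Option ℝ :=
  if h : v < I.n then ((I.adj ⟨v, h⟩)[i]?).map (fun u => w s(⟨v, h⟩, u)) else none

/-- Both adjacency list entries exist, and the first is strictly lighter than the second. -/
def EntryLt (I : Input) (w : I.Weight) (u i v j : ℕ) : Prop :=
  ∃ x ∈ I.entryWeight w u i, ∃ y ∈ I.entryWeight w v j, x < y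

end Input

open Classical in
/-- Total weight of the edges of a graph. -/
noncomputable def totalWeight {n : ℕ} (w : Sym2 (Fin n) → ℝ) (T : SimpleGraph (Fin n)) : ℝ :=
  ∑ e ∈ T.edgeFinset, w e

/-- `T` is a minimum spanning tree of `G` with respect to the edge weights `w`. -/
def IsMST {n : ℕ} (G : SimpleGraph (Fin n)) (w : Sym2 (Fin n) → ℝ) (T : SimpleGraph (Fin n)) :
    Prop :=
  (T ≤ G ∧ T.IsTree) ∧
    ∀ T' : SimpleGraph (Fin n), T' ≤ G → T'.IsTree → totalWeight w T ≤ totalWeight w T'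

/-! ### The machine: a word RAM with `W`-bit words -/

/-- Unit-cost binary operations on words. -/
inductive WordOp where
  | add | sub | mul | div | mod | and | or | xor | shl | shr

def WordOp.eval {W : ℕ} : WordOp → BitVec W → BitVec W → BitVec W
  | .add, x, y => x + y
  | .sub, x, y => x - y
  | .mul, x, y => x * y
  | .div, x, y => x / y
  | .mod, x, y => x % y
  | .and, x, y => x &&& y
  | .or, x, y => x ||| y
  | .xor, x, y => x ^^^ y
  | .shl, x, y => x <<< y
  | .shr, x, y => x >>> y

/-- Instructions. All arguments are literals of the program text: register names, array names, jump
targets, and (for `const`) a numeral. The input graph is read-only; weights are accessible only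
through comparisons of two adjacency list entries. -/
inductive Instr where
  /-- `d := k` -/
  | const (d k : ℕ)
  /-- `d := a o b` -/
  | op (o : WordOp) (d a b : ℕ)
  /-- `d := arr[a]` -/
  | load (d arr a : ℕ)
  /-- `arr[a] := b` -/
  | store (arr a b : ℕ)
  /-- `if a < b then goto l` -/
  | jumpLt (a b l : ℕ)
  /-- `if a = b then goto l` -/
  | jumpEq (a b l : ℕ)
  /-- `d :=` number of vertices -/
  | numVertices (d : ℕ)
  /-- `d :=` degree of vertex `v` -/
  | degree (d v : ℕ)
  /-- `d :=` entry number `i` of the adjacency list of vertex `v` -/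
  | neighbor (d v i : ℕ)
  /-- if entry number `i` of the list of `u` is strictly lighter than entry number `j` of the list
  of `v` then goto `l` -/
  | jumpWeightLt (u i v j l : ℕ)
  /-- output the edge `{u, v}` -/
  | emit (u v : ℕ)

/-- A program is a finite list of instructions; it halts when the program counter leaves it. -/
abbrev Program : Type := List Instr

/-- A configuration: program counter, registers, and arrays of words indexed by words. A program
mentions only finitely many registers and arrays. -/
structure Config (W : ℕ) where
  pc : ℕ
  reg : ℕ → BitVec W
  mem : ℕ → BitVec W → BitVec W

namespace Config

variable {W : ℕ}

def next (s : Config W) : Config W := { s with pc := s.pc + 1 }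

def setReg (s : Config W) (d : ℕ) (x : BitVec W) : Config W :=
  { s with pc := s.pc + 1, reg := Function.update s.reg d x }

def setMem (s : Config W) (arr : ℕ) (a x : BitVec W) : Config W :=
  { s with pc := s.pc + 1, mem := Function.update s.mem arr (Function.update (s.mem arr) a x) }

open Classical in
noncomputable def branch (s : Config W) (p : Prop) (l : ℕ) : Config W :=
  { s with pc := if p then l else s.pc + 1 }

end Config

/-- The effect of one instruction on the configuration. -/
noncomputable def exec (I : Input) (w : I.Weight) {W : ℕ} (s : Config W) : Instr → Config W
  | .const d k => s.setReg d (BitVec.ofNat W k)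
  | .op o d a b => s.setReg d (o.eval (s.reg a) (s.reg b))
  | .load d arr a => s.setReg d (s.mem arr (s.reg a))
  | .store arr a b => s.setMem arr (s.reg a) (s.reg b)
  | .jumpLt a b l => s.branch ((s.reg a).toNat < (s.reg b).toNat) l
  | .jumpEq a b l => s.branch (s.reg a = s.reg b) l
  | .numVertices d => s.setReg d (BitVec.ofNat W I.n)
  | .degree d v => s.setReg d (BitVec.ofNat W (I.degree (s.reg v).toNat))
  | .neighbor d v i =>
      s.setReg d (BitVec.ofNat W (I.neighbor (s.reg v).toNat (s.reg i).toNat))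
  | .jumpWeightLt u i v j l =>
      s.branch (I.EntryLt w (s.reg u).toNat (s.reg i).toNat (s.reg v).toNat (s.reg j).toNat) l
  | .emit _ _ => s.next

/-- One step; a halted configuration does not change. -/
noncomputable def step (P : Program) (I : Input) (w : I.Weight) {W : ℕ} (s : Config W) :
    Config W :=
  match P[s.pc]? with
  | none => s
  | some ins => exec I w s ins

/-- The configuration after `t` steps from `s`. -/
noncomputable def run (P : Program) (I : Input) (w : I.Weight) {W : ℕ} (s : Config W) (t : ℕ) :
    Config W :=
  (step P I w)^[t] s

def Halted (P : Program) {W : ℕ} (s : Config W) : Prop := P.length ≤ s.pc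

/-- The edge that the next step outputs, if it outputs one. -/
def emission (P : Program) {W : ℕ} (s : Config W) : Option (Sym2 ℕ) :=
  match P[s.pc]? with
  | some (.emit u v) => some s((s.reg u).toNat, (s.reg v).toNat)
  | _ => none

/-- The memory cell (array name and address) that the next step accesses, if it accesses one. -/
def accessed (P : Program) {W : ℕ} (s : Config W) : Option (ℕ × BitVec W) :=
  match P[s.pc]? with
  | some (.load _ arr a) => some (arr, s.reg a)
  | some (.store arr a _) => some (arr, s.reg a)
  | _ => none

/-- The edges output during the first `t` steps, in order. -/
noncomputable def outputs (P : Program) (I : Input) (w : I.Weight) {W : ℕ} (s : Config W) (t : ℕ) :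
    List (Sym2 ℕ) :=
  (List.range t).filterMap (fun i => emission P (run P I w s i))

/-- The run from `s` has halted after at most `t` steps, and has output every edge of some minimum
spanning tree exactly once, and nothing else. -/
def OutputsMST (P : Program) (I : Input) (w : I.Weight) {W : ℕ} (s : Config W) (t : ℕ) : Prop :=
  Halted P (run P I w s t) ∧
    ∃ (T : SimpleGraph (Fin I.n)) (es : List (Sym2 (Fin I.n))),
      IsMST I.graph w T ∧ es.Nodup ∧ (∀ e, e ∈ es ↔ e ∈ T.edgeSet) ∧
        outputs P I w s t = es.map (Sym2.map Fin.val)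

/-- From the start of the run, and from each output on, at most `d` steps pass until the next edge
has been output or the program has halted. As the wait for the first output is included, a run of
this kind has no preprocessing. -/
def DelayAtMost (P : Program) (I : Input) (w : I.Weight) {W : ℕ} (s : Config W) (d : ℝ) : Prop :=
  ∀ a : ℕ, (a = 0 ∨ ∃ i, a = i + 1 ∧ emission P (run P I w s i) ≠ none) →
    ∃ j, a ≤ j ∧ (emission P (run P I w s j) ≠ none ∨ Halted P (run P I w s j)) ∧
      (j : ℝ) + 1 - a ≤ d

/-- The set of memory cells used by the run from `s`. -/
def usedCells (P : Program) (I : Input) (w : I.Weight) {W : ℕ} (s : Config W) :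
    Set (ℕ × BitVec W) :=
  {x | ∃ t, accessed P (run P I w s t) = some x}

/-- Space complexity on the graph `I` with word size `W`: the largest number of memory cells used, in
the worst case over the weights and the initial contents of registers and memory. The read-only
input, the outputs and the constantly many registers are not counted. -/
noncomputable def space (P : Program) (I : Input) (W : ℕ) : ℕ∞ :=
  ⨆ (w : I.Weight) (s : Config W) (_ : s.pc = 0), (usedCells P I w s).encard

/-- The word size `W` is at least `κ` times `⌊log₂ n⌋ + 1`. -/
def WordSizeOK (κ : ℕ) (I : Input) (W : ℕ) : Prop := κ * (Nat.log 2 I.n + 1) ≤ W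

/-- `P` is an MST algorithm with running time at most `τ` on words of size at least
`κ * (⌊log₂ n⌋ + 1)`. Nothing is assumed about the initial contents of registers and memory. -/
def IsMSTAlgorithm (P : Program) (κ : ℕ) (τ : Input → ℕ) : Prop :=
  ∀ I : Input, I.graph.Connected → ∀ (w : I.Weight) (W : ℕ), WordSizeOK κ I W →
    ∀ s : Config W, s.pc = 0 → OutputsMST P I w s (τ I)

/-- `P` computes the number `f I` in at most `τ I` steps: it halts with `f I` in register `0`. -/
def ComputesInTime (P : Program) (κ : ℕ) (f τ : Input → ℕ) : Prop :=
  ∀ I : Input, I.graph.Connected → ∀ (w : I.Weight) (W : ℕ), WordSizeOK κ I W →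
    ∀ s : Config W, s.pc = 0 →
      Halted P (run P I w s (τ I)) ∧ ((run P I w s (τ I)).reg 0).toNat = f I

/-- `P` enumerates the edges of a minimum spanning tree without preprocessing and with delay at
most `d`. -/
def EnumeratesMST (P : Program) (κ : ℕ) (d : Input → ℝ) : Prop :=
  ∀ I : Input, I.graph.Connected → ∀ (w : I.Weight) (W : ℕ), WordSizeOK κ I W →
    ∀ s : Config W, s.pc = 0 →
      (∃ t, OutputsMST P I w s t) ∧ DelayAtMost P I w s (d I)

end MSTEnum

/-!
The enumerator interleaves slow and fast work. A *round* of slow work is a bounded number of steps of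
some computation; after a fixed number of rounds, one tree edge that is already known is output. So
the delay is bounded as soon as the supply of known edges never runs dry.

*Supply.* Ties between weights are broken by an injective key of the edge (`edgeKey`). By
`exists_tieBreak`, the resulting order comes from weights `w'` that differ infinitesimally from the
given weights `w`, and a minimum spanning tree for `w'` is one for `w`. For distinct weights, the
lightest edge at a vertex lies in every minimum spanning tree (`IsMST.adj_of_lightest`, an exchange
argument); its other end is called the *mate* of the vertex. These are the edges of the first round
of Borůvka's algorithm. An edge is counted at one of its ends only, its source; at least half of the
vertices are sources (`le_two_mul_length_sources`), also among the first `v` vertices for any `v`.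
Hence one edge per four vertices can be output already while the mates are determined, which takes
`O(Δ)` steps per vertex, and about `n / 4` sources, or more, remain in a buffer.

*Consumption.* The remaining phases simulate the given programs instruction by instruction
(`Env.wp_simulate`): the program `B` that computes `T`, in at most `c * (Δ * n + 1)` steps, then the
MST algorithm `A`, twice, in at most `c * T` steps each. With one output every `12 * (c + 1) * (Δ + 1)`
and `12 * (c + 1) * (T / n + 1)` simulated steps, respectively, each of the three simulations uses up
at most `n / 12` sources. The decisive run of `A` sees the weights `w'`, which is possible because
weights are accessible through comparisons only (`Input.entryLt_tieBreak`). The edges that `A` outputs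
are recorded unless they join a vertex to its mate, so that they are exactly the tree edges that do
not come out of the buffer (`exists_list_of_mateEdges`). They are output last.

*Space.* The enumerator itself uses four arrays of length `n`; the simulations use the space of `B`
and `A`. For the lower bound, note that the memory of the simulated programs is uninitialized, so that
any initial configuration of `A` can be arranged. The first run of `A`, on the weights `w` and
otherwise ignored, therefore uses the full space complexity of `A` in the worst case, which need not
be attained on weights without ties.

The enumerator is written in a small structured language. Its compilation to machine code is proved
correct with respect to a semantics that records outputs, waiting times and accessed cells
(`Exec.reaches`), and programs are verified by weakest-precondition rules (`Wp`).
-/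

namespace MSTEnum

set_option linter.unusedSimpArgs false

/-! ### A structured language and its compilation -/

/-- The condition of a branch or loop of a structured program. -/
inductive Test where
  /-- register `a` holds a smaller word than register `b` -/
  | lt (a b : ℕ)
  /-- registers `a` and `b` hold the same word -/
  | eq (a b : ℕ)
  /-- the adjacency list entry given by registers `u`, `i` is strictly lighter than the one given
  by registers `v`, `j` -/
  | weightLt (u i v j : ℕ)

/-- Structured programs over the instructions of the machine. The argument of `basic` is meant to
be an instruction that does not jump. -/
inductive Cmd where
  | skip
  | basic (i : Instr)
  | seq (a b : Cmd)
  | ite (t : Test) (a b : Cmd)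
  | loop (t : Test) (a : Cmd)

/-- Sequential composition. -/
infixr:65 " ⨾ " => Cmd.seq

/-- The conditional jump that implements a test. -/
def Test.jump : Test → ℕ → Instr
  | .lt a b, l => .jumpLt a b l
  | .eq a b, l => .jumpEq a b l
  | .weightLt u i v j, l => .jumpWeightLt u i v j l

/-- The number of instructions in the compiled code. -/
def Cmd.size : Cmd → ℕ
  | .skip => 0
  | .basic _ => 1
  | .seq a b => a.size + b.size
  | .ite _ a b => b.size + a.size + 2
  | .loop _ a => a.size + 3

/-- The machine code of a structured program that starts at address `p`. An unconditional jump is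
a comparison of a register with itself. -/
def Cmd.code : Cmd → ℕ → Program
  | .skip, _ => []
  | .basic i, _ => [i]
  | .seq a b, p => a.code p ++ b.code (p + a.size)
  | .ite t a b, p => t.jump (p + b.size + 2) ::
      (b.code (p + 1) ++ .jumpEq 0 0 (p + b.size + 2 + a.size) :: a.code (p + b.size + 2))
  | .loop t a, p => t.jump (p + 2) :: .jumpEq 0 0 (p + a.size + 3) ::
      (a.code (p + 2) ++ [.jumpEq 0 0 p])

theorem Cmd.length_code (c : Cmd) (p : ℕ) : (c.code p).length = c.size := by
  induction c generalizing p <;> simp_all [Cmd.code, Cmd.size]; omega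

/-- Instructions that always continue with the next instruction. -/
def Instr.Straight : Instr → Prop
  | .jumpLt .. | .jumpEq .. | .jumpWeightLt .. => False
  | _ => True

/-- The edge that an instruction outputs. -/
def Instr.emits {W : ℕ} (reg : ℕ → BitVec W) : Instr → Option (Sym2 ℕ)
  | .emit u v => some s((reg u).toNat, (reg v).toNat)
  | _ => none

/-- The memory cell that an instruction accesses. -/
def Instr.accesses {W : ℕ} (reg : ℕ → BitVec W) : Instr → Option (ℕ × BitVec W)
  | .load _ arr a => some (arr, reg a)
  | .store arr a _ => some (arr, reg a)
  | _ => none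

/-- Registers and memory together with a record of the run so far: the edges output, each with the
number of steps that it took since the output before it, the number of steps since the last output,
and the memory cells accessed. -/
structure State (W : ℕ) where
  reg : ℕ → BitVec W
  mem : ℕ → BitVec W → BitVec W
  out : List (Sym2 ℕ × ℕ)
  gap : ℕ
  used : Set (ℕ × BitVec W)

variable {W : ℕ}

/-- The condition expressed by a test. -/
def Test.Holds (I : Input) (w : I.Weight) (reg : ℕ → BitVec W) : Test → Prop
  | .lt a b => (reg a).toNat < (reg b).toNat
  | .eq a b => reg a = reg b
  | .weightLt u i v j =>
      I.EntryLt w (reg u).toNat (reg i).toNat (reg v).toNat (reg j).toNat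

namespace State

/-- A step that changes neither registers nor memory. -/
def tick (s : State W) : State W := { s with gap := s.gap + 1 }

@[simp] theorem tick_reg (s : State W) : s.tick.reg = s.reg := rfl
@[simp] theorem tick_mem (s : State W) : s.tick.mem = s.mem := rfl
@[simp] theorem tick_out (s : State W) : s.tick.out = s.out := rfl
@[simp] theorem tick_gap (s : State W) : s.tick.gap = s.gap + 1 := rfl
@[simp] theorem tick_used (s : State W) : s.tick.used = s.used := rfl

/-- The state after an instruction. -/
noncomputable def after (I : Input) (w : I.Weight) (s : State W) (i : Instr) : State W where
  reg := (exec I w ⟨0, s.reg, s.mem⟩ i).reg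
  mem := (exec I w ⟨0, s.reg, s.mem⟩ i).mem
  out := s.out ++ ((i.emits s.reg).map fun e => (e, s.gap + 1)).toList
  gap := if (i.emits s.reg).isSome then 0 else s.gap + 1
  used := {x | i.accesses s.reg = some x} ∪ s.used

end State

/-- Big-step semantics: the structured program `c` leads from one state to another. A `tick` stands
for a jump of the compiled code; of the two branches of `ite`, only the one for a failed test, which
the code places first, needs a jump to its end. -/
inductive Exec (I : Input) (w : I.Weight) : Cmd → State W → State W → Prop
  | skip (s) : Exec I w .skip s s
  | basic (i : Instr) (s) (h : i.Straight) : Exec I w (.basic i) s (s.after I w i)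
  | seq {a b s s' s''} (ha : Exec I w a s s') (hb : Exec I w b s' s'') :
      Exec I w (.seq a b) s s''
  | iteTrue {t a b s s'} (ht : t.Holds I w s.reg) (h : Exec I w a s.tick s') :
      Exec I w (.ite t a b) s s'
  | iteFalse {t a b s s'} (ht : ¬ t.Holds I w s.reg) (h : Exec I w b s.tick s') :
      Exec I w (.ite t a b) s s'.tick
  | loopTrue {t a s s' s''} (ht : t.Holds I w s.reg) (h : Exec I w a s.tick s')
      (h' : Exec I w (.loop t a) s'.tick s'') : Exec I w (.loop t a) s s''
  | loopFalse {t a s} (ht : ¬ t.Holds I w s.reg) : Exec I w (.loop t a) s s.tick.tick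

/-- One machine step on a program counter and a state. -/
noncomputable def recStep (P : Program) (I : Input) (w : I.Weight) (x : ℕ × State W) :
    ℕ × State W :=
  match P[x.1]? with
  | none => x
  | some i => ((exec I w ⟨x.1, x.2.reg, x.2.mem⟩ i).pc, x.2.after I w i)

/-- The code `q` stands at address `p` of the program `P`. -/
def CodeAt (P : Program) (p : ℕ) (q : Program) : Prop := ∀ i, i < q.length → P[p + i]? = q[i]?

theorem CodeAt.left {P q d : Program} {p : ℕ} (h : CodeAt P p (q ++ d)) : CodeAt P p q := by
  intro i hi
  rw [h i (by simp; omega), List.getElem?_append_left hi]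

theorem CodeAt.right {P q d : Program} {p : ℕ} (h : CodeAt P p (q ++ d)) :
    CodeAt P (p + q.length) d := by
  intro i hi
  have := h (q.length + i) (by simp; omega)
  rw [List.getElem?_append_right (by omega)] at this
  simpa [add_assoc] using this

theorem CodeAt.head {P q : Program} {p : ℕ} {i : Instr} (h : CodeAt P p (i :: q)) :
    P[p]? = some i := by
  simpa using h 0 (by simp)

theorem CodeAt.tail {P q : Program} {p : ℕ} {i : Instr} (h : CodeAt P p (i :: q)) :
    CodeAt P (p + 1) q :=
  CodeAt.right (q := [i]) h

/-- Some number of machine steps leads from `x` to `y`. -/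
def Reaches (P : Program) (I : Input) (w : I.Weight) (x y : ℕ × State W) : Prop :=
  ∃ t, (recStep P I w)^[t] x = y

theorem Reaches.refl {P : Program} {I : Input} {w : I.Weight} (x : ℕ × State W) :
    Reaches P I w x x := ⟨0, rfl⟩

theorem Reaches.trans {P : Program} {I : Input} {w : I.Weight} {x y z : ℕ × State W}
    (h : Reaches P I w x y) (h' : Reaches P I w y z) : Reaches P I w x z := by
  obtain ⟨t, rfl⟩ := h
  obtain ⟨t', rfl⟩ := h'
  exact ⟨t' + t, Function.iterate_add_apply _ _ _ _⟩

theorem Reaches.of_step {P : Program} {I : Input} {w : I.Weight} {x y : ℕ × State W}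
    (h : recStep P I w x = y) : Reaches P I w x y := ⟨1, h⟩

open Classical in
theorem recStep_jump {P : Program} {I : Input} {w : I.Weight} {p l : ℕ} {t : Test} {s : State W}
    (h : P[p]? = some (t.jump l)) :
    recStep P I w (p, s) = (if t.Holds I w s.reg then l else p + 1, s.tick) := by
  cases t <;> simp [recStep, h, Test.jump, exec, Config.branch, Test.Holds, State.after,
    Instr.emits, Instr.accesses, State.tick] <;> congr

theorem recStep_goto {P : Program} {I : Input} {w : I.Weight} {p l : ℕ} {s : State W}
    (h : P[p]? = some (.jumpEq 0 0 l)) : recStep P I w (p, s) = (l, s.tick) := by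
  simpa [Test.Holds] using recStep_jump (I := I) (w := w) (t := .eq 0 0) h (s := s)

theorem exec_pc_of_straight {I : Input} {w : I.Weight} {i : Instr} (h : i.Straight)
    (s : Config W) : (exec I w s i).pc = s.pc + 1 := by
  cases i <;> simp_all [Instr.Straight, exec, Config.setReg, Config.setMem, Config.next]

/-- The compiled code does what the structured program does. -/
theorem Exec.reaches {I : Input} {w : I.Weight} {c : Cmd} {s s' : State W} (h : Exec I w c s s')
    {P : Program} {p : ℕ} (hP : CodeAt P p (c.code p)) :
    Reaches P I w (p, s) (p + c.size, s') := by
  induction h generalizing p with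
  | skip s => exact .refl _
  | basic i s h =>
    refine .of_step ?_
    have := hP.head
    simp [recStep, this, exec_pc_of_straight h, Cmd.size]
  | @seq a b _ _ _ _ _ iha ihb =>
    have h2 := hP.right
    rw [Cmd.length_code] at h2
    have := (iha hP.left).trans (ihb h2)
    simpa [Cmd.size, add_assoc] using this
  | @iteTrue t a b s s' ht _ ih =>
    have h2 := hP.tail.right.tail
    rw [Cmd.length_code] at h2
    refine (Reaches.of_step (recStep_jump hP.head)).trans ?_
    rw [if_pos ht]
    have h3 := ih (p := p + b.size + 2) (by convert h2 using 1; omega)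
    convert h3 using 2
    simp only [Cmd.size]; omega
  | @iteFalse t a b s s' ht _ ih =>
    refine (Reaches.of_step (recStep_jump hP.head)).trans ?_
    rw [if_neg ht]
    refine (ih hP.tail.left).trans ?_
    have h2 := hP.tail.right.head
    rw [Cmd.length_code] at h2
    have h3 := Reaches.of_step (recStep_goto (I := I) (w := w) (s := s') h2)
    convert h3 using 2
    simp only [Cmd.size]; omega
  | @loopTrue t a s s' s'' ht _ _ ih ih' =>
    refine (Reaches.of_step (recStep_jump hP.head)).trans ?_
    rw [if_pos ht]
    refine (ih hP.tail.tail.left).trans ?_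
    have h2 := hP.tail.tail.right.head
    rw [Cmd.length_code] at h2
    exact (Reaches.of_step (recStep_goto (I := I) (w := w) (s := s') h2)).trans (ih' hP)
  | @loopFalse t a s ht =>
    refine (Reaches.of_step (recStep_jump hP.head)).trans ?_
    rw [if_neg ht]
    exact Reaches.of_step (recStep_goto hP.tail.head)

/-! ### Reading off the behaviour of a run -/

theorem emission_eq (P : Program) (s : Config W) :
    emission P s = P[s.pc]?.bind (Instr.emits s.reg) := by
  unfold emission
  cases h : P[s.pc]? with
  | none => rfl
  | some i => cases i <;> rfl

theorem accessed_eq (P : Program) (s : Config W) :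
    accessed P s = P[s.pc]?.bind (Instr.accesses s.reg) := by
  unfold accessed
  cases h : P[s.pc]? with
  | none => rfl
  | some i => cases i <;> rfl

theorem emission_eq_none_of_halted {P : Program} {s : Config W} (h : Halted P s) :
    emission P s = none := by
  rw [emission_eq, List.getElem?_eq_none h]; rfl

theorem accessed_eq_none_of_halted {P : Program} {s : Config W} (h : Halted P s) :
    accessed P s = none := by
  rw [accessed_eq, List.getElem?_eq_none h]; rfl

theorem run_succ (P : Program) (I : Input) (w : I.Weight) (s : Config W) (t : ℕ) :
    run P I w s (t + 1) = step P I w (run P I w s t) :=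
  Function.iterate_succ_apply' _ _ _

theorem outputs_succ (P : Program) (I : Input) (w : I.Weight) (s : Config W) (t : ℕ) :
    outputs P I w s (t + 1) = outputs P I w s t ++ (emission P (run P I w s t)).toList := by
  simp only [outputs, List.range_succ, List.filterMap_append]
  cases h : emission P (run P I w s t) <;> simp [h]

theorem run_eq_of_halted {P : Program} {I : Input} {w : I.Weight} {s : Config W} {t t' : ℕ}
    (h : Halted P (run P I w s t)) (ht : t ≤ t') : run P I w s t' = run P I w s t := by
  induction t', ht using Nat.le_induction with
  | base => rfl
  | succ k _ ih =>
    rw [run_succ, ih, step, List.getElem?_eq_none h]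

theorem outputs_eq_of_halted {P : Program} {I : Input} {w : I.Weight} {s : Config W} {t t' : ℕ}
    (h : Halted P (run P I w s t)) (ht : t ≤ t') : outputs P I w s t' = outputs P I w s t := by
  induction t', ht using Nat.le_induction with
  | base => rfl
  | succ k hk ih =>
    rw [outputs_succ, ih, run_eq_of_halted h hk, emission_eq_none_of_halted h]; simp

theorem usedCells_eq_of_halted {P : Program} {I : Input} {w : I.Weight} {s : Config W} {t : ℕ}
    (h : Halted P (run P I w s t)) :
    usedCells P I w s = {x | ∃ i < t, accessed P (run P I w s i) = some x} := by
  ext x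
  constructor
  · rintro ⟨i, hi⟩
    refine ⟨i, ?_, hi⟩
    by_contra hlt
    rw [run_eq_of_halted h (by omega), accessed_eq_none_of_halted h] at hi
    simp at hi
  · rintro ⟨i, _, hi⟩
    exact ⟨i, hi⟩

/-- The configuration underlying a program counter and a state. -/
def toConfig (x : ℕ × State W) : Config W := ⟨x.1, x.2.reg, x.2.mem⟩

/-- The start of a run, with nothing recorded yet. -/
def initState (s : Config W) : State W := ⟨s.reg, s.mem, [], 0, ∅⟩

/-- The recorded run after `t` steps. -/
noncomputable def recRun (P : Program) (I : Input) (w : I.Weight) (s : Config W) (t : ℕ) :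
    ℕ × State W :=
  (recStep P I w)^[t] (0, initState s)

theorem recRun_succ (P : Program) (I : Input) (w : I.Weight) (s : Config W) (t : ℕ) :
    recRun P I w s (t + 1) = recStep P I w (recRun P I w s t) :=
  Function.iterate_succ_apply' _ _ _

theorem exec_reg_pc (I : Input) (w : I.Weight) (p q : ℕ) (r : ℕ → BitVec W)
    (m : ℕ → BitVec W → BitVec W) (i : Instr) :
    (exec I w ⟨p, r, m⟩ i).reg = (exec I w ⟨q, r, m⟩ i).reg ∧
    (exec I w ⟨p, r, m⟩ i).mem = (exec I w ⟨q, r, m⟩ i).mem := by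
  cases i <;> simp [exec, Config.setReg, Config.setMem, Config.next, Config.branch]

theorem toConfig_recRun {P : Program} {I : Input} {w : I.Weight} {s : Config W} (hs : s.pc = 0)
    (t : ℕ) : toConfig (recRun P I w s t) = run P I w s t := by
  induction t with
  | zero => cases s; simp_all [recRun, run, toConfig, initState]
  | succ t ih =>
    rw [recRun_succ, run_succ, ← ih]
    generalize recRun P I w s t = x
    unfold recStep step
    simp only [toConfig]
    cases h : P[x.1]? with
    | none => rfl
    | some i =>
      have := exec_reg_pc I w x.1 0 x.2.reg x.2.mem i
      simp [State.after, ← this.1, ← this.2]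

theorem recStep_out (P : Program) (I : Input) (w : I.Weight) (x : ℕ × State W) :
    (recStep P I w x).2.out =
      x.2.out ++ ((emission P (toConfig x)).map fun e => (e, x.2.gap + 1)).toList := by
  unfold recStep
  rw [emission_eq]
  simp only [toConfig]
  cases h : P[x.1]? with
  | none => simp
  | some i => simp [State.after]

theorem recStep_used (P : Program) (I : Input) (w : I.Weight) (x : ℕ × State W) :
    (recStep P I w x).2.used = {y | accessed P (toConfig x) = some y} ∪ x.2.used := by
  unfold recStep
  rw [accessed_eq]
  simp only [toConfig]
  cases h : P[x.1]? with
  | none => simp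
  | some i => simp [State.after]

theorem recStep_gap_of_none {P : Program} {I : Input} {w : I.Weight} {x : ℕ × State W}
    (h : ¬ Halted P (toConfig x)) (he : emission P (toConfig x) = none) :
    (recStep P I w x).2.gap = x.2.gap + 1 := by
  rw [emission_eq] at he
  simp only [Halted, toConfig, not_le] at h he
  rw [List.getElem?_eq_getElem h, Option.bind_some] at he
  simp [recStep, List.getElem?_eq_getElem h, State.after, he]

theorem recStep_gap_of_ne_none {P : Program} {I : Input} {w : I.Weight} {x : ℕ × State W}
    (he : emission P (toConfig x) ≠ none) : (recStep P I w x).2.gap = 0 := by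
  have h : ¬ Halted P (toConfig x) := fun h => he (emission_eq_none_of_halted h)
  rw [emission_eq] at he
  simp only [Halted, toConfig, not_le] at h he
  rw [List.getElem?_eq_getElem h, Option.bind_some, ← Option.isSome_iff_ne_none] at he
  simp [recStep, List.getElem?_eq_getElem h, State.after, he]

theorem outputs_eq_recRun {P : Program} {I : Input} {w : I.Weight} {s : Config W} (hs : s.pc = 0)
    (t : ℕ) : outputs P I w s t = (recRun P I w s t).2.out.map Prod.fst := by
  induction t with
  | zero => rfl
  | succ t ih =>
    rw [outputs_succ, recRun_succ, recStep_out, toConfig_recRun hs, ih, List.map_append]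
    cases emission P (run P I w s t) <;> simp

theorem used_recRun {P : Program} {I : Input} {w : I.Weight} {s : Config W} (hs : s.pc = 0)
    (t : ℕ) :
    (recRun P I w s t).2.used = {x | ∃ i < t, accessed P (run P I w s i) = some x} := by
  induction t with
  | zero => simp [recRun, initState]
  | succ t ih =>
    rw [recRun_succ, recStep_used, toConfig_recRun hs, ih]
    ext x
    simp only [Set.mem_union, Set.mem_ofPred_eq, Nat.lt_succ_iff_lt_or_eq]
    constructor
    · rintro (h | ⟨i, hi, h⟩)
      exacts [⟨t, .inr rfl, h⟩, ⟨i, .inl hi, h⟩]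
    · rintro ⟨i, hi | rfl, h⟩
      exacts [.inr ⟨i, hi, h⟩, .inl h]

theorem out_subset_recRun {P : Program} {I : Input} {w : I.Weight} {s : Config W} {t t' : ℕ}
    (h : t ≤ t') : (recRun P I w s t).2.out ⊆ (recRun P I w s t').2.out := by
  induction t', h using Nat.le_induction with
  | base => exact fun _ h => h
  | succ k _ ih =>
    rw [recRun_succ, recStep_out]
    exact fun x hx => List.mem_append_left _ (ih hx)

/-- The recorded waiting times bound the delay. -/
theorem delayAtMost_of_recRun {P : Program} {I : Input} {w : I.Weight} {s : Config W}
    (hs : s.pc = 0) {t D : ℕ} {d : ℝ} (hD : (D : ℝ) ≤ d) (ht : Halted P (run P I w s t))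
    (hout : ∀ x ∈ (recRun P I w s t).2.out, x.2 ≤ D) (hgap : (recRun P I w s t).2.gap + 1 ≤ D) :
    DelayAtMost P I w s d := by
  intro a ha
  have hgap0 : (recRun P I w s a).2.gap = 0 := by
    rcases ha with rfl | ⟨i, rfl, hi⟩
    · rfl
    · rw [recRun_succ, recStep_gap_of_ne_none (by rwa [toConfig_recRun hs])]
  have hat : a ≤ t := by
    rcases ha with rfl | ⟨i, rfl, hi⟩
    · exact Nat.zero_le _
    · by_contra hlt
      refine hi (emission_eq_none_of_halted ?_)
      rw [run_eq_of_halted ht (by omega)]; exact ht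
  have hex : ∃ j, a ≤ j ∧ (emission P (run P I w s j) ≠ none ∨ Halted P (run P I w s j)) :=
    ⟨t, hat, .inr ht⟩
  classical
  obtain ⟨j, ⟨haj, hj⟩, hmin⟩ : ∃ j, (a ≤ j ∧ (emission P (run P I w s j) ≠ none ∨
      Halted P (run P I w s j))) ∧ ∀ i < j, a ≤ i →
      emission P (run P I w s i) = none ∧ ¬ Halted P (run P I w s i) := by
    refine ⟨Nat.find hex, Nat.find_spec hex, fun i hi hai => ?_⟩
    have := Nat.find_min hex hi
    tauto
  have hgapj : ∀ k, a + k ≤ j → (recRun P I w s (a + k)).2.gap = k := by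
    intro k
    induction k with
    | zero => intro; exact hgap0
    | succ k ih =>
      intro hk
      have h := hmin (a + k) (by omega) (by omega)
      rw [← add_assoc, recRun_succ, recStep_gap_of_none (by rw [toConfig_recRun hs]; exact h.2)
        (by rw [toConfig_recRun hs]; exact h.1), ih (by omega)]
  have hg := hgapj (j - a) (by omega)
  rw [Nat.add_sub_cancel' haj] at hg
  refine ⟨j, haj, hj, ?_⟩
  have key : j - a + 1 ≤ D := by
    by_cases hh : Halted P (run P I w s j)
    · have : recRun P I w s (max j t) = recRun P I w s j ∧
          recRun P I w s (max j t) = recRun P I w s t := by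
        have aux : ∀ t₀ t₁, Halted P (run P I w s t₀) → t₀ ≤ t₁ →
            recRun P I w s t₁ = recRun P I w s t₀ := by
          intro t₀ t₁ h0 h1
          induction t₁, h1 using Nat.le_induction with
          | base => rfl
          | succ k _ ih =>
            rw [recRun_succ, ih]
            rw [← toConfig_recRun hs] at h0
            simp [recStep, List.getElem?_eq_none (show P.length ≤ (recRun P I w s t₀).1 from h0)]
        exact ⟨aux _ _ hh (le_max_left _ _), aux _ _ ht (le_max_right _ _)⟩
      rw [← hg, ← this.1, this.2]
      exact hgap
    · have he := hj.resolve_right hh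
      have hjt : j < t := by
        by_contra hlt
        exact hh (by rw [run_eq_of_halted ht (by omega)]; exact ht)
      obtain ⟨e, he⟩ := Option.ne_none_iff_exists'.1 he
      have hmem : (e, j - a + 1) ∈ (recRun P I w s (j + 1)).2.out := by
        rw [recRun_succ, recStep_out, toConfig_recRun hs, he, hg]
        simp
      exact hout _ (out_subset_recRun hjt hmem)
  have : ((j - a + 1 : ℕ) : ℝ) ≤ d := le_trans (by exact_mod_cast key) hD
  rw [Nat.cast_add, Nat.cast_sub haj] at this
  push_cast at this
  linarith

/-! ### Total correctness -/

/-- `c` terminates when started in `s`, in a state that satisfies `Q`. -/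
def Wp (I : Input) (w : I.Weight) (c : Cmd) (Q : State W → Prop) (s : State W) : Prop :=
  ∃ s', Exec I w c s s' ∧ Q s'

section Wp

variable {I : Input} {w : I.Weight} {Q : State W → Prop} {s : State W}

theorem Wp.skip (h : Q s) : Wp I w .skip Q s := ⟨s, .skip s, h⟩

theorem Wp.seq {a b : Cmd} (h : Wp I w a (Wp I w b Q) s) : Wp I w (a ⨾ b) Q s :=
  let ⟨_, h1, s', h2, h3⟩ := h
  ⟨s', .seq h1 h2, h3⟩

theorem Wp.ite {t : Test} {a b : Cmd} (ha : t.Holds I w s.reg → Wp I w a Q s.tick)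
    (hb : ¬ t.Holds I w s.reg → Wp I w b (fun s' => Q s'.tick) s.tick) :
    Wp I w (.ite t a b) Q s := by
  by_cases ht : t.Holds I w s.reg
  · obtain ⟨s', h1, h2⟩ := ha ht
    exact ⟨s', .iteTrue ht h1, h2⟩
  · obtain ⟨s', h1, h2⟩ := hb ht
    exact ⟨_, .iteFalse ht h1, h2⟩

/-- A loop that runs exactly `N` times. -/
theorem Wp.loop {t : Test} {a : Cmd} (Inv : ℕ → State W → Prop) (N : ℕ) (h0 : Inv 0 s)
    (hstep : ∀ j < N, ∀ s, Inv j s →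
      t.Holds I w s.reg ∧ Wp I w a (fun s' => Inv (j + 1) s'.tick) s.tick)
    (hend : ∀ s, Inv N s → ¬ t.Holds I w s.reg ∧ Q s.tick.tick) : Wp I w (.loop t a) Q s := by
  have : ∀ k j s, j + k = N → Inv j s → Wp I w (.loop t a) Q s := by
    intro k
    induction k with
    | zero =>
      rintro j s rfl hj
      obtain ⟨h1, h2⟩ := hend s hj
      exact ⟨_, .loopFalse h1, h2⟩
    | succ k ih =>
      intro j s hk hj
      obtain ⟨h1, s', h2, h3⟩ := hstep j (by omega) s hj
      obtain ⟨s'', h4, h5⟩ := ih (j + 1) _ (by omega) h3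
      exact ⟨s'', .loopTrue h1 h2 h4, h5⟩
  exact this N 0 s (by simp) h0

theorem Wp.basic {i : Instr} (hi : i.Straight) (h : Q (s.after I w i)) : Wp I w (.basic i) Q s :=
  ⟨_, .basic i s hi, h⟩

theorem Wp.const {d k : ℕ}
    (h : Q { s with reg := Function.update s.reg d (BitVec.ofNat W k), gap := s.gap + 1 }) :
    Wp I w (.basic (.const d k)) Q s :=
  .basic trivial (by simpa [State.after, exec, Config.setReg, Instr.emits, Instr.accesses] using h)

theorem Wp.op {o : WordOp} {d a b : ℕ}
    (h : Q { s with reg := Function.update s.reg d (o.eval (s.reg a) (s.reg b))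
                    gap := s.gap + 1 }) : Wp I w (.basic (.op o d a b)) Q s :=
  .basic trivial (by simpa [State.after, exec, Config.setReg, Instr.emits, Instr.accesses] using h)

theorem Wp.load {d arr a : ℕ}
    (h : Q { s with reg := Function.update s.reg d (s.mem arr (s.reg a)), gap := s.gap + 1
                    used := insert (arr, s.reg a) s.used }) :
    Wp I w (.basic (.load d arr a)) Q s :=
  .basic trivial (by
    simpa [State.after, exec, Config.setReg, Instr.emits, Instr.accesses, Set.insert_def, eq_comm,
      Set.union_def] using h)

theorem Wp.store {arr a b : ℕ}
    (h : Q { s with mem := Function.update s.mem arr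
                        (Function.update (s.mem arr) (s.reg a) (s.reg b))
                    gap := s.gap + 1
                    used := insert (arr, s.reg a) s.used }) :
    Wp I w (.basic (.store arr a b)) Q s :=
  .basic trivial (by
    simpa [State.after, exec, Config.setMem, Instr.emits, Instr.accesses, Set.insert_def, eq_comm,
      Set.union_def] using h)

theorem Wp.numVertices {d : ℕ}
    (h : Q { s with reg := Function.update s.reg d (BitVec.ofNat W I.n), gap := s.gap + 1 }) :
    Wp I w (.basic (.numVertices d)) Q s :=
  .basic trivial (by simpa [State.after, exec, Config.setReg, Instr.emits, Instr.accesses] using h)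

theorem Wp.degree {d v : ℕ}
    (h : Q { s with
      reg := Function.update s.reg d (BitVec.ofNat W (I.degree (s.reg v).toNat))
      gap := s.gap + 1 }) :
    Wp I w (.basic (.degree d v)) Q s :=
  .basic trivial (by simpa [State.after, exec, Config.setReg, Instr.emits, Instr.accesses] using h)

theorem Wp.neighbor {d v i : ℕ}
    (h : Q { s with
      reg := Function.update s.reg d
        (BitVec.ofNat W (I.neighbor (s.reg v).toNat (s.reg i).toNat))
      gap := s.gap + 1 }) :
    Wp I w (.basic (.neighbor d v i)) Q s :=
  .basic trivial (by simpa [State.after, exec, Config.setReg, Instr.emits, Instr.accesses] using h)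

theorem Wp.emit {u v : ℕ}
    (h : Q { s with out := s.out ++ [(s((s.reg u).toNat, (s.reg v).toNat), s.gap + 1)]
                    gap := 0 }) :
    Wp I w (.basic (.emit u v)) Q s :=
  .basic trivial (by simpa [State.after, exec, Config.next, Instr.emits, Instr.accesses] using h)

end Wp

/-! ### Breaking ties between weights -/

/-- A number that determines the edge `{a, b}`; ties between weights are broken by comparing these
numbers. It is a polynomial in the symmetric functions `a + b` and `a * b`, so that a program can
compute it without branching. -/
def edgeKey (a b : ℕ) : ℕ := (a + b) * (a + b) * (a + b) + a * b

theorem edgeKey_comm (a b : ℕ) : edgeKey a b = edgeKey b a := by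
  unfold edgeKey; ring

theorem edgeKey_inj {a b c d : ℕ} (h : edgeKey a b = edgeKey c d) : s(a, b) = s(c, d) := by
  unfold edgeKey at h
  -- `a * b < 3 * (a + b) ^ 2 + 3 * (a + b) + 1`, so the key determines the sum
  have aux : ∀ a b c d : ℕ, (a + b) * (a + b) * (a + b) + a * b =
      (c + d) * (c + d) * (c + d) + c * d → ¬ a + b < c + d := by
    intro a b c d h hlt
    have h1 : (a + b + 1) * (a + b + 1) * (a + b + 1) ≤ (c + d) * (c + d) * (c + d) := by
      have h2 : a + b + 1 ≤ c + d := hlt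
      exact Nat.mul_le_mul (Nat.mul_le_mul h2 h2) h2
    nlinarith [Nat.zero_le (a * a), Nat.zero_le (b * b), Nat.zero_le (a * b), Nat.zero_le (c * d)]
  have hs : a + b = c + d :=
    le_antisymm (not_lt.1 (aux c d a b h.symm)) (not_lt.1 (aux a b c d h))
  rw [hs] at h
  have hp : a * b = c * d := by omega
  have : ((a : ℤ) - c) * (a - d) = 0 := by
    have h1 : (a : ℤ) + b = c + d := by exact_mod_cast hs
    have h2 : (a : ℤ) * b = c * d := by exact_mod_cast hp
    have h3 : (b : ℤ) = c + d - a := by linarith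
    rw [h3] at h2
    linarith
  rcases mul_eq_zero.1 this with h1 | h1
  · have : a = c := by omega
    rw [Sym2.eq_iff]; omega
  · have : a = d := by omega
    rw [Sym2.eq_iff]; omega

/-- The key of an edge of a graph on `Fin n`. -/
def symKey {n : ℕ} : Sym2 (Fin n) → ℕ :=
  Sym2.lift ⟨fun a b => edgeKey a b, fun a b => edgeKey_comm a b⟩

theorem symKey_injective {n : ℕ} : Function.Injective (symKey (n := n)) := by
  intro e f
  induction e with | _ a b
  induction f with | _ c d
  intro h
  have := edgeKey_inj (show edgeKey a b = edgeKey c d from h)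
  rw [Sym2.eq_iff] at this ⊢
  simpa [Fin.ext_iff] using this

open Filter Topology in
theorem eventually_perturb_lt {x y : ℝ} (h : x < y) (a b : ℝ) :
    ∀ᶠ ε in 𝓝[>] (0 : ℝ), x + ε * a < y + ε * b := by
  have h1 : Tendsto (fun ε : ℝ => x + ε * a) (𝓝[>] 0) (𝓝 (x + 0 * a)) :=
    (Continuous.tendsto (by fun_prop) 0).mono_left nhdsWithin_le_nhds
  have h2 : Tendsto (fun ε : ℝ => y + ε * b) (𝓝[>] 0) (𝓝 (y + 0 * b)) :=
    (Continuous.tendsto (by fun_prop) 0).mono_left nhdsWithin_le_nhds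
  exact h1.eventually_lt h2 (by simpa using h)

theorem totalWeight_perturb {n : ℕ} (w k : Sym2 (Fin n) → ℝ) (ε : ℝ) (T : SimpleGraph (Fin n)) :
    totalWeight (fun e => w e + ε * k e) T = totalWeight w T + ε * totalWeight k T := by
  simp only [totalWeight, Finset.sum_add_distrib, Finset.mul_sum]

/-- Adding a sufficiently small multiple of the edge keys makes the weights distinct, without
reversing any strict comparison and without making any other spanning tree minimal. -/
theorem exists_tieBreak {n : ℕ} (G : SimpleGraph (Fin n)) (w : Sym2 (Fin n) → ℝ) :
    ∃ w' : Sym2 (Fin n) → ℝ,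
      (∀ e f, w' e < w' f ↔ w e < w f ∨ (¬ w f < w e ∧ symKey e < symKey f)) ∧
      ∀ T, IsMST G w' T → IsMST G w T := by
  let k : Sym2 (Fin n) → ℝ := fun e => symKey e
  have h1 : ∀ᶠ ε in nhdsWithin (0 : ℝ) (Set.Ioi 0),
      ∀ e f, w e < w f → w e + ε * k e < w f + ε * k f := by
    simp only [Filter.eventually_all]
    exact fun e f h => eventually_perturb_lt h _ _
  have h2 : ∀ᶠ ε in nhdsWithin (0 : ℝ) (Set.Ioi 0), ∀ T T' : SimpleGraph (Fin n),
      totalWeight w T < totalWeight w T' →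
      totalWeight w T + ε * totalWeight k T < totalWeight w T' + ε * totalWeight k T' := by
    simp only [Filter.eventually_all]
    exact fun T T' h => eventually_perturb_lt h _ _
  obtain ⟨ε, ⟨h1, h2⟩, hε⟩ := ((h1.and h2).and self_mem_nhdsWithin).exists
  have hε : 0 < ε := hε
  refine ⟨fun e => w e + ε * k e, fun e f => ?_, fun T hT => ⟨hT.1, fun T' hT' hT'' => ?_⟩⟩
  · rcases lt_trichotomy (w e) (w f) with h | h | h
    · simp [h, h1 e f h]
    · simp [h, k, hε]
    · have := h1 f e h
      simp only [h, not_true_eq_false, false_and, or_false]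
      exact iff_of_false this.le.not_gt h.le.not_gt
  · by_contra hlt
    have := hT.2 T' hT' hT''
    rw [totalWeight_perturb, totalWeight_perturb] at this
    exact absurd (h2 _ _ (not_le.1 hlt)) this.not_gt

/-! ### Lightest edges at a vertex -/

open Classical in
/-- An edge that is strictly lighter than all other edges at one of its ends lies in every minimum
spanning tree. -/
theorem IsMST.adj_of_lightest {n : ℕ} {G T : SimpleGraph (Fin n)} {w : Sym2 (Fin n) → ℝ}
    (hT : IsMST G w T) {v u : Fin n} (hvu : G.Adj v u)
    (hmin : ∀ x, G.Adj v x → x ≠ u → w s(v, u) < w s(v, x)) : T.Adj v u := by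
  by_contra hn
  obtain ⟨⟨hTG, htree⟩, hopt⟩ := hT
  -- `x` is the first vertex after `v` on the path from `v` to `u` in `T`
  obtain ⟨x, hvx, hxu⟩ : ∃ x, T.Adj v x ∧ ∃ p : T.Walk x u, v ∉ p.support := by
    obtain ⟨p, hp⟩ := (htree.connected v u).exists_isPath
    cases p with
    | nil => exact (hvu.ne rfl).elim
    | cons h q =>
      rw [SimpleGraph.Walk.cons_isPath_iff] at hp
      exact ⟨_, h, q, hp.2⟩
  obtain ⟨p, hp⟩ := hxu
  have hxu : x ≠ u := fun h => hn (h ▸ hvx)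
  have hlt := hmin x (hTG hvx) hxu
  let T' : SimpleGraph (Fin n) := T.deleteEdges {s(v, x)} ⊔ SimpleGraph.edge v u
  have hT'G : T' ≤ G := by
    refine sup_le ((SimpleGraph.deleteEdges_le _).trans hTG) ?_
    rw [SimpleGraph.edge_le_iff]; exact .inr hvu
  have hE : T'.edgeFinset = insert s(v, u) (T.edgeFinset.erase s(v, x)) := by
    ext e
    simp only [T', SimpleGraph.mem_edgeFinset, SimpleGraph.edgeSet_sup,
      SimpleGraph.edgeSet_deleteEdges, SimpleGraph.edgeSet_edge_of_ne hvu.ne, Set.mem_union,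
      Set.mem_sdiff, Set.mem_singleton_iff, Finset.mem_insert, Finset.mem_erase]
    tauto
  have hne : s(v, u) ∉ T.edgeFinset.erase s(v, x) := by simp [hn]
  have hmem : s(v, x) ∈ T.edgeFinset := by simpa using hvx
  have hvu' : T'.Adj v u := by
    have : s(v, u) ∈ T'.edgeFinset := by rw [hE]; simp
    simpa using this
  -- the rest of the path is still there, so `v` reaches `x` through `u`
  have hvx' : T'.Reachable v x := by
    refine hvu'.reachable.trans (SimpleGraph.Reachable.symm ⟨p.transfer T' fun e he => ?_⟩)
    have h1 := p.edges_subset_edgeSet he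
    have h2 : e ≠ s(v, x) := by
      rintro rfl
      exact hp (p.fst_mem_support_of_mem_edges he)
    have : e ∈ T'.edgeFinset := by rw [hE]; simp [h2, h1]
    simpa using this
  have hconn : T'.Connected := by
    have := htree.connected.nonempty
    refine ⟨fun a b => ?_⟩
    obtain ⟨q⟩ := htree.connected a b
    induction q with
    | nil => exact .refl _
    | @cons a c b h q ih =>
      refine SimpleGraph.Reachable.trans ?_ ih
      by_cases hac : s(a, c) = s(v, x)
      · rw [Sym2.eq_iff] at hac
        rcases hac with ⟨rfl, rfl⟩ | ⟨rfl, rfl⟩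
        exacts [hvx', hvx'.symm]
      · have : s(a, c) ∈ T'.edgeFinset := by rw [hE]; simp_all
        exact SimpleGraph.Adj.reachable (by simpa using this)
  have hT' : T'.IsTree := by
    rw [SimpleGraph.isTree_iff_connected_and_card] at htree ⊢
    refine ⟨hconn, ?_⟩
    rw [← htree.2, Nat.card_eq_fintype_card, Nat.card_eq_fintype_card,
      ← SimpleGraph.edgeFinset_card, ← SimpleGraph.edgeFinset_card, hE,
      Finset.card_insert_of_notMem hne, Finset.card_erase_add_one hmem]
  have := hopt T' hT'G hT'
  have hw' : totalWeight w T' = ∑ e ∈ insert s(v, u) (T.edgeFinset.erase s(v, x)), w e := by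
    rw [← hE]; unfold totalWeight; congr!
  have hw : totalWeight w T = ∑ e ∈ T.edgeFinset, w e := by unfold totalWeight; congr!
  rw [hw', hw, Finset.sum_insert hne, ← Finset.add_sum_erase _ _ hmem] at this
  linarith

/-! ### Adjacency lists -/

namespace Input

variable (I : Input)

theorem degree_eq (v : Fin I.n) : I.degree v = (I.adj v).length := by simp [degree]

theorem neighbor_eq {v : Fin I.n} {i : ℕ} (h : i < (I.adj v).length) :
    I.neighbor v i = (I.adj v)[i] := by simp [neighbor, h]

theorem neighbor_lt (hn : 0 < I.n) (v i : ℕ) : I.neighbor v i < I.n := by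
  unfold neighbor
  split
  · rename_i h
    cases (I.adj ⟨v, h⟩)[i]? <;> simp [hn]
  · exact hn

theorem lt_degree_iff {v i : ℕ} :
    i < I.degree v ↔ ∃ h : v < I.n, i < (I.adj ⟨v, h⟩).length := by
  unfold degree
  split <;> simp_all

theorem length_adj (v : Fin I.n) [Fintype (I.graph.neighborSet v)] :
    (I.adj v).length = I.graph.degree v := by
  rw [← List.toFinset_card_of_nodup (I.nodup_adj v), SimpleGraph.degree]
  congr 1
  ext u
  simp [I.mem_adj]

theorem degree_le_maxDeg (v : ℕ) : I.degree v ≤ I.maxDeg := by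
  classical
  unfold degree
  split
  · rw [I.length_adj]
    exact (SimpleGraph.degree_le_maxDegree _ _).trans_eq (by unfold maxDeg; congr!)
  · exact Nat.zero_le _

theorem sup_degree (hn : 0 < I.n) : (Finset.range I.n).sup I.degree = I.maxDeg := by
  classical
  refine le_antisymm (Finset.sup_le fun v _ => I.degree_le_maxDeg v) ?_
  have : Nonempty (Fin I.n) := ⟨⟨0, hn⟩⟩
  obtain ⟨v, hv⟩ := I.graph.exists_maximal_degree_vertex
  have h : I.maxDeg = I.degree v := by
    rw [I.degree_eq, I.length_adj, ← hv]
    unfold maxDeg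
    congr!
  rw [h]
  exact Finset.le_sup (f := I.degree) (by simp)

theorem maxDeg_lt (hn : 0 < I.n) : I.maxDeg < I.n := by
  classical
  have : Nonempty (Fin I.n) := ⟨⟨0, hn⟩⟩
  have := I.graph.maxDegree_lt_card_verts
  unfold maxDeg
  rw [Fintype.card_fin] at this
  convert this

theorem degree_pos (hI : I.graph.Connected) (h2 : 2 ≤ I.n) {v : ℕ} (hv : v < I.n) :
    0 < I.degree v := by
  have : Nontrivial (Fin I.n) := Fin.nontrivial_iff_two_le.2 h2
  obtain ⟨u, hu⟩ := hI.preconnected.exists_adj_of_nontrivial ⟨v, hv⟩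
  rw [lt_degree_iff]
  exact ⟨hv, List.length_pos_of_mem ((I.mem_adj _ u).2 hu)⟩

variable {I}

theorem entryLt_iff {w : I.Weight} {u i v j : ℕ} :
    I.EntryLt w u i v j ↔ ∃ (hu : u < I.n) (hv : v < I.n) (hi : i < (I.adj ⟨u, hu⟩).length)
      (hj : j < (I.adj ⟨v, hv⟩).length),
      w s(⟨u, hu⟩, (I.adj ⟨u, hu⟩)[i]) < w s(⟨v, hv⟩, (I.adj ⟨v, hv⟩)[j]) := by
  unfold EntryLt entryWeight
  by_cases hu : u < I.n <;> by_cases hv : v < I.n <;>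
    simp only [hu, hv, dif_pos, dif_neg, not_false_eq_true, Option.mem_def, reduceCtorEq, false_and,
      exists_false, and_false, exists_true_left, IsEmpty.exists_iff, Option.map_eq_some_iff,
      List.getElem?_eq_some_iff]
  constructor
  · rintro ⟨x, ⟨a, ⟨ha, rfl⟩, rfl⟩, y, ⟨b, ⟨hb, rfl⟩, rfl⟩, h⟩
    exact ⟨ha, hb, h⟩
  · rintro ⟨ha, hb, h⟩
    exact ⟨_, ⟨_, ⟨ha, rfl⟩, rfl⟩, _, ⟨_, ⟨hb, rfl⟩, rfl⟩, h⟩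

/-- How a program compares adjacency list entries with respect to the modified weights. -/
theorem entryLt_tieBreak {w w' : I.Weight}
    (hw : ∀ e f, w' e < w' f ↔ w e < w f ∨ (¬ w f < w e ∧ symKey e < symKey f)) (u i v j : ℕ) :
    I.EntryLt w' u i v j ↔ I.EntryLt w u i v j ∨ (¬ I.EntryLt w v j u i ∧ i < I.degree u ∧
      j < I.degree v ∧ edgeKey u (I.neighbor u i) < edgeKey v (I.neighbor v j)) := by
  by_cases hi : i < I.degree u
  · by_cases hj : j < I.degree v
    · obtain ⟨hu, hi'⟩ := I.lt_degree_iff.1 hi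
      obtain ⟨hv, hj'⟩ := I.lt_degree_iff.1 hj
      rw [entryLt_iff, entryLt_iff, entryLt_iff]
      have h1 := I.neighbor_eq hi'
      have h2 := I.neighbor_eq hj'
      simp only at h1 h2
      simp only [hu, hv, hi', hj', exists_true_left, hw, hi, hj, true_and, h1, h2]
      rfl
    · simp only [hj, false_and, and_false, or_false]
      rw [lt_degree_iff] at hj
      rw [entryLt_iff, entryLt_iff]
      constructor <;> rintro ⟨hu, hv, hi, hj', _⟩ <;> exact (hj ⟨hv, hj'⟩).elim
  · simp only [hi, false_and, and_false, or_false]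
    rw [lt_degree_iff] at hi
    rw [entryLt_iff, entryLt_iff]
    constructor <;> rintro ⟨hu, hv, hi', hj', _⟩ <;> exact (hi ⟨hu, hi'⟩).elim

/-- The graph with two vertices and one edge. -/
def edgeInput : Input where
  n := 2
  graph := ⊤
  adj v := [v + 1]
  nodup_adj v := List.nodup_singleton _
  mem_adj u v := by
    fin_cases u <;> fin_cases v <;> simp

end Input

/-! ### The edge list of the first Borůvka round -/

open Classical in
/-- The position of the lightest among the entries `0, …, k` of the adjacency list of `v`, as found
by a linear scan. -/
noncomputable def lightest (I : Input) (w : I.Weight) (v : ℕ) : ℕ → ℕ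
  | 0 => 0
  | k + 1 => if I.EntryLt w v (k + 1) v (lightest I w v k) then k + 1 else lightest I w v k

/-- The neighbour of `v` along its lightest edge (and `0` if `v` has no edge). -/
noncomputable def mate (I : Input) (w : I.Weight) (v : ℕ) : ℕ :=
  I.neighbor v (lightest I w v (I.degree v - 1))

theorem lightest_le (I : Input) (w : I.Weight) (v k : ℕ) : lightest I w v k ≤ k := by
  induction k with
  | zero => rfl
  | succ k ih =>
    rw [lightest]
    split <;> omega

theorem not_entryLt_lightest {I : Input} {w : I.Weight} {v k i : ℕ} (hi : i ≤ k)
    (hk : k < I.degree v) : ¬ I.EntryLt w v i v (lightest I w v k) := by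
  induction k generalizing i with
  | zero =>
    obtain rfl : i = 0 := by omega
    rintro ⟨x, hx, y, hy, hxy⟩
    rw [lightest] at hy
    simp_all
  | succ k ih =>
    rw [lightest]
    rintro ⟨x, hx, y, hy, hxy⟩
    split at hy
    · rename_i h
      obtain ⟨a, ha, b, hb, hab⟩ := h
      have : a = y := by simp_all
      subst this
      rcases Nat.lt_succ_iff_lt_or_eq.1 (Nat.lt_succ_of_le hi) with h' | rfl
      · exact ih (by omega) (by omega) ⟨x, hx, b, hb, hxy.trans hab⟩
      · simp_all
    · rename_i h
      rcases Nat.lt_succ_iff_lt_or_eq.1 (Nat.lt_succ_of_le hi) with h' | rfl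
      · exact ih (by omega) (by omega) ⟨x, hx, y, hy, hxy⟩
      · exact h ⟨x, hx, y, hy, hxy⟩

theorem mate_lt (I : Input) (w : I.Weight) (hn : 0 < I.n) (v : ℕ) : mate I w v < I.n :=
  I.neighbor_lt hn _ _

theorem adj_mate {I : Input} (w : I.Weight) {v : ℕ} (hd : 0 < I.degree v) :
    ∃ (hv : v < I.n) (hm : mate I w v < I.n), I.graph.Adj ⟨v, hv⟩ ⟨mate I w v, hm⟩ := by
  obtain ⟨hv, hd'⟩ := I.lt_degree_iff.1 hd
  have hl : lightest I w v (I.degree v - 1) < (I.adj ⟨v, hv⟩).length := by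
    rw [← I.degree_eq]
    have := lightest_le I w v (I.degree v - 1)
    simp only
    omega
  have := I.neighbor_eq hl
  refine ⟨hv, mate_lt I w (by omega) v, ?_⟩
  rw [← I.mem_adj]
  convert List.getElem_mem hl using 1
  exact Fin.ext this

/-- The edge from a vertex to its mate lies in every minimum spanning tree, if weights are
distinct. -/
theorem adj_mate_of_isMST {I : Input} {w : I.Weight} (hw : Function.Injective w) {v : ℕ}
    (hd : 0 < I.degree v) {T : SimpleGraph (Fin I.n)} (hT : IsMST I.graph w T) :
    ∃ (hv : v < I.n) (hm : mate I w v < I.n), T.Adj ⟨v, hv⟩ ⟨mate I w v, hm⟩ := by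
  obtain ⟨hv, hm, hadj⟩ := adj_mate w hd
  refine ⟨hv, hm, hT.adj_of_lightest hadj fun x hx hne => ?_⟩
  have hl : lightest I w v (I.degree v - 1) < (I.adj ⟨v, hv⟩).length := by
    rw [← I.degree_eq]
    have := lightest_le I w v (I.degree v - 1)
    simp only
    omega
  obtain ⟨i, hi, rfl⟩ := List.getElem_of_mem ((I.mem_adj _ _).2 hx)
  have h := not_entryLt_lightest (w := w) (v := v) (i := i) (k := I.degree v - 1)
    (by have := I.degree_eq ⟨v, hv⟩; simp only at this; omega) (by omega)
  rw [Input.entryLt_iff] at h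
  push Not at h
  have h := h hv hv hi hl
  have hmate : (⟨mate I w v, hm⟩ : Fin I.n) = (I.adj ⟨v, hv⟩)[lightest I w v (I.degree v - 1)] :=
    Fin.ext (I.neighbor_eq hl)
  rw [hmate] at hne ⊢
  refine lt_of_le_of_ne h fun heq => hne ?_
  have := hw heq
  rw [Sym2.congr_right] at this
  exact this.symm

/-- The vertices below `v` whose edge to their mate is not also the edge of a smaller vertex to
its mate. -/
def sources (m : ℕ → ℕ) (v : ℕ) : List ℕ :=
  (List.range v).filter fun x => x < m x ∨ m (m x) ≠ x

theorem sources_succ (m : ℕ → ℕ) (v : ℕ) :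
    sources m (v + 1) = sources m v ++ if v < m v ∨ m (m v) ≠ v then [v] else [] := by
  simp [sources, List.range_succ, List.filter_append, List.filter_cons]

theorem mem_sources {m : ℕ → ℕ} {v x : ℕ} :
    x ∈ sources m v ↔ x < v ∧ (x < m x ∨ m (m x) ≠ x) := by
  simp [sources]

theorem length_sources_le (m : ℕ → ℕ) (v : ℕ) : (sources m v).length ≤ v :=
  (List.length_filter_le _ _).trans_eq (by simp)

/-- At least half of the vertices contribute a new edge: a vertex that does not is the mate of its
mate, which is smaller and does. -/
theorem le_two_mul_length_sources {m : ℕ → ℕ} {v : ℕ} (hm : ∀ x < v, m x ≠ x) :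
    v ≤ 2 * (sources m v).length := by
  have h1 : (sources m v).toFinset.card = (sources m v).length :=
    List.toFinset_card_of_nodup (List.nodup_range.filter _)
  have h2 : (Finset.range v \ (sources m v).toFinset).card ≤ (sources m v).toFinset.card := by
    have key : ∀ x ∈ Finset.range v \ (sources m v).toFinset, x < v ∧ m x < x ∧ m (m x) = x := by
      intro x hx
      simp only [Finset.mem_sdiff, Finset.mem_range, List.mem_toFinset, mem_sources] at hx
      have := hm x hx.1
      push Not at hx
      have := hx.2 hx.1
      omega
    refine Finset.card_le_card_of_injOn m (fun x hx => ?_) fun x hx y hy hxy => ?_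
    · have := key x hx
      simp only [List.coe_toFinset, Set.mem_ofPred_eq, mem_sources]
      rw [this.2.2]
      omega
    · rw [← (key x hx).2.2, ← (key y hy).2.2, hxy]
  have h3 : (Finset.range v).card ≤
      (Finset.range v \ (sources m v).toFinset).card + (sources m v).toFinset.card := by
    rw [← Finset.card_sdiff_add_card_inter _ (sources m v).toFinset]
    gcongr
    exact Finset.inter_subset_right
  rw [Finset.card_range] at h3
  omega

/-- The edge from `x` to its mate. -/
def mateEdge (m : ℕ → ℕ) (x : ℕ) : Sym2 ℕ := s(x, m x)

theorem nodup_map_mateEdge (m : ℕ → ℕ) (v : ℕ) : ((sources m v).map (mateEdge m)).Nodup := by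
  refine List.Nodup.map_on (fun x hx y hy hxy => ?_) (List.nodup_range.filter _)
  rw [mem_sources] at hx hy
  simp only [mateEdge, Sym2.eq_iff] at hxy
  rcases hxy with h | ⟨h1, h2⟩
  · exact h.1
  · rw [h2, ← h1] at hx
    rw [← h1, h2] at hy
    omega

theorem exists_source {m : ℕ → ℕ} {v x : ℕ} (hx : x < v) (hm : m x ≠ x) :
    ∃ y ∈ sources m v, mateEdge m y = mateEdge m x := by
  by_cases h : x < m x ∨ m (m x) ≠ x
  · exact ⟨x, mem_sources.2 ⟨hx, h⟩, rfl⟩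
  · push Not at h
    refine ⟨m x, mem_sources.2 ⟨by omega, .inl (by omega)⟩, ?_⟩
    rw [mateEdge, mateEdge, h.2, Sym2.eq_swap]

theorem map_val_sym2_injective (n : ℕ) : Function.Injective (Sym2.map (Fin.val (n := n))) :=
  Sym2.map.injective Fin.val_injective

theorem length_of_tree {n : ℕ} {T : SimpleGraph (Fin n)} (hT : T.IsTree)
    {es : List (Sym2 (Fin n))} (hes : es.Nodup) (hmem : ∀ e, e ∈ es ↔ e ∈ T.edgeSet) :
    es.length < n := by
  classical
  have h := hT.card_edgeFinset
  have : es.toFinset = T.edgeFinset := by ext e; simp [hmem]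
  rw [← this, List.toFinset_card_of_nodup hes, Fintype.card_fin] at h
  omega

theorem emission_nil {W : ℕ} (s : Config W) : emission [] s = none :=
  emission_eq_none_of_halted (Nat.zero_le _)

/-- An MST algorithm needs at least one step on every graph: the empty program outputs nothing. -/
theorem IsMSTAlgorithm.pos {A : Program} {κ : ℕ} {τ : Input → ℕ} (hA : IsMSTAlgorithm A κ τ)
    (I : Input) (hI : I.graph.Connected) : 0 < τ I := by
  by_contra h0
  have hA0 : A = [] := by
    have := (hA I hI (fun _ => 0) _ le_rfl ⟨0, fun _ => 0, fun _ _ => 0⟩ rfl).1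
    rw [Nat.eq_zero_of_not_pos h0] at this
    exact List.eq_nil_of_length_eq_zero (Nat.le_zero.1 this)
  subst hA0
  have : Nontrivial (Fin Input.edgeInput.n) := inferInstanceAs (Nontrivial (Fin 2))
  have hc : Input.edgeInput.graph.Connected := SimpleGraph.connected_top
  obtain ⟨-, T, es, hT, -, hmem, hout⟩ :=
    hA Input.edgeInput hc (fun _ => 0) _ le_rfl ⟨0, fun _ => 0, fun _ _ => 0⟩ rfl
  have hes : es = [] := by
    rw [← List.map_eq_nil_iff, ← hout]
    simp [outputs, emission_nil]
  subst hes
  obtain ⟨u, hu⟩ := hT.1.2.connected.preconnected.exists_adj_of_nontrivial ⟨0, Nat.two_pos⟩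
  exact List.not_mem_nil ((hmem s(⟨0, Nat.two_pos⟩, u)).2 hu)

/-! ### Registers, arrays and words -/

/-!
Registers and arrays of the enumerator. Registers `10, …, 39` are scratch space, except for `regLen`;
registers from `100` on and arrays from `10` on belong to simulated programs.

* `regN`, `regOne`, `regDelta`: the number of vertices, the number one, the maximum degree so far
* `regV`: the vertex that is being processed
* `regCnt`, `regEm`: the length of the buffer, and the number of its entries that have been output
* `regCtr`, `regBud`: the number of rounds since the last output, and the number of rounds to wait
* `regPc`, `regLen`: program counter and length of the simulated program
* `regCntT`: the number of recorded tree edges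
* `regFlag`: the result of a comparison of two edges
* `arrMate`: the mate of each vertex
* `arrBuf`: the sources in increasing order
* `arrU`, `arrV`: the ends of the recorded tree edges

They are notation for numerals, so that arithmetic on register names is within the reach of `omega`.
-/

notation "regN" => 0
notation "regOne" => 1
notation "regV" => 2
notation "regCnt" => 3
notation "regEm" => 4
notation "regDelta" => 5
notation "regCtr" => 6
notation "regBud" => 7
notation "regPc" => 8
notation "regCntT" => 9
notation "regLen" => 18
notation "regFlag" => 20
notation "arrMate" => 0
notation "arrBuf" => 1
notation "arrU" => 2
notation "arrV" => 3

theorem toNat_ofNat_of_lt {x : ℕ} (h : x < 2 ^ W) : (BitVec.ofNat W x).toNat = x := by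
  simp [Nat.mod_eq_of_lt h]

theorem ofNat_inj_of_lt {x y : ℕ} (hx : x < 2 ^ W) (hy : y < 2 ^ W) :
    BitVec.ofNat W x = BitVec.ofNat W y ↔ x = y := by
  refine ⟨fun h => ?_, fun h => h ▸ rfl⟩
  rw [← toNat_ofNat_of_lt hx, h, toNat_ofNat_of_lt hy]

theorem eq_ofNat_iff {x : BitVec W} {y : ℕ} (hy : y < 2 ^ W) :
    x = BitVec.ofNat W y ↔ x.toNat = y := by
  rw [← ofNat_inj_of_lt x.isLt hy, BitVec.ofNat_toNat, BitVec.setWidth_eq]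

/-- `w'` refines `w` by breaking ties, and words are long enough to hold edge keys. -/
structure Env (I : Input) (w w' : I.Weight) (W : ℕ) : Prop where
  connected : I.graph.Connected
  tieBreak : ∀ e f, w' e < w' f ↔ w e < w f ∨ (¬ w f < w e ∧ symKey e < symKey f)
  bound : 9 * (I.n * I.n * I.n) < 2 ^ W

variable {I : Input} {w w' : I.Weight}

theorem Env.pos (h : Env I w w' W) : 0 < I.n := Fin.pos_iff_nonempty.2 h.connected.nonempty

theorem Env.n_lt (h : Env I w w' W) : 9 * I.n < 2 ^ W := by
  have h1 := h.bound
  have h2 : I.n * 1 * 1 ≤ I.n * I.n * I.n := by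
    gcongr <;> exact h.pos
  omega

theorem Env.key_lt (h : Env I w w' W) {a b : ℕ} (ha : a < I.n) (hb : b < I.n) :
    edgeKey a b < 2 ^ W := by
  refine lt_of_le_of_lt ?_ h.bound
  have h1 : (a + b) * (a + b) * (a + b) ≤ (2 * I.n) * (2 * I.n) * (2 * I.n) := by
    have : a + b ≤ 2 * I.n := by omega
    exact Nat.mul_le_mul (Nat.mul_le_mul this this) this
  have h2 : a * b * 1 ≤ I.n * I.n * I.n := by
    gcongr; exact h.pos
  unfold edgeKey
  nlinarith

/-- The two states differ at most in the registers `20, …, 39` and in the waiting time. -/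
structure SameData (s s' : State W) : Prop where
  reg : ∀ r, r < 20 ∨ 40 ≤ r → s'.reg r = s.reg r
  mem : s'.mem = s.mem
  out : s'.out = s.out
  used : s'.used = s.used

/-! ### Comparing weights -/

/-- Computes the key of the edge given by entry `i` of the list of `u`. -/
def computeKey (d u i : ℕ) : Cmd :=
  .basic (.neighbor 25 u i) ⨾ .basic (.op .add 26 u 25) ⨾ .basic (.op .mul 27 26 26) ⨾
  .basic (.op .mul 27 27 26) ⨾ .basic (.op .mul 26 u 25) ⨾ .basic (.op .add d 27 26)

/-- Sets `regFlag` to `1` if entry `i` of the list of `u` precedes entry `j` of the list of `v`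
after tie-breaking, and to `0` otherwise. -/
def compareEntries (u i v j : ℕ) : Cmd :=
  .basic (.const regFlag 0) ⨾
  .ite (.weightLt u i v j) (.basic (.const regFlag 1))
    (.ite (.weightLt v j u i) .skip
      (.basic (.degree 21 u) ⨾ .basic (.degree 22 v) ⨾
      .ite (.lt i 21)
        (.ite (.lt j 22)
          (computeKey 23 u i ⨾ computeKey 24 v j ⨾
            .ite (.lt 23 24) (.basic (.const regFlag 1)) .skip)
          .skip)
        .skip))

theorem Env.wp_computeKey (he : Env I w w' W) {Q : State W → Prop} {s : State W} {d u i : ℕ}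
    (hd : 20 ≤ d ∧ d < 25) (hu : u < 20 ∨ 40 ≤ u) (hi : i < 20 ∨ 40 ≤ i)
    (hu' : (s.reg u).toNat < I.n)
    (h : ∀ s', SameData s s' → s'.gap = s.gap + 6 →
      (∀ r, 20 ≤ r → r < 25 → r ≠ d → s'.reg r = s.reg r) →
      (s'.reg d).toNat = edgeKey (s.reg u).toNat
        (I.neighbor (s.reg u).toNat (s.reg i).toNat) → Q s') :
    Wp I w (computeKey d u i) Q s := by
  refine .seq (.neighbor (.seq (.op (.seq (.op (.seq (.op (.seq (.op (.op ?_))))))))))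
  have e1 : u ≠ 25 := by omega
  have e2 : u ≠ 26 := by omega
  have e3 : u ≠ 27 := by omega
  refine h _ ⟨fun r hr => ?_, rfl, rfl, rfl⟩ rfl (fun r h1 h2 h3 => ?_) ?_
  · have : r ≠ d := by omega
    have : r ≠ 25 := by omega
    have : r ≠ 26 := by omega
    have : r ≠ 27 := by omega
    simp [*]
  · have : r ≠ 25 := by omega
    have : r ≠ 26 := by omega
    have : r ≠ 27 := by omega
    simp [*]
  · simp only [Function.update_self, WordOp.eval, ne_eq, e1, e2, e3, not_false_eq_true,
      Function.update_of_ne, Nat.reduceEqDiff]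
    generalize hb : I.neighbor (s.reg u).toNat (s.reg i).toNat = b
    have hb' : b < I.n := hb ▸ I.neighbor_lt he.pos _ _
    have hx : s.reg u = BitVec.ofNat W (s.reg u).toNat := by simp
    have key := he.key_lt hu' hb'
    generalize (s.reg u).toNat = a at *
    rw [hx]
    simp only [← BitVec.ofNat_add, ← BitVec.ofNat_mul]
    exact toNat_ofNat_of_lt key

theorem Env.wp_compareEntries (he : Env I w w' W) {Q : State W → Prop} {s : State W}
    {u i v j : ℕ} (hu : u < 20 ∨ 40 ≤ u) (hi : i < 20 ∨ 40 ≤ i) (hv : v < 20 ∨ 40 ≤ v)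
    (hj : j < 20 ∨ 40 ≤ j)
    (h : ∀ s', SameData s s' → s'.gap ≤ s.gap + 30 →
      (s'.reg regFlag = BitVec.ofNat W 1 ↔ I.EntryLt w' (s.reg u).toNat (s.reg i).toNat
        (s.reg v).toNat (s.reg j).toNat) → Q s') :
    Wp I w (compareEntries u i v j) Q s := by
  have hW : 1 < 2 ^ W := by have := he.n_lt; have := he.pos; omega
  have h01 : BitVec.ofNat W 0 ≠ BitVec.ofNat W 1 := by
    rw [ne_eq, ofNat_inj_of_lt (by omega) hW]; omega
  have hlt := Input.entryLt_tieBreak he.tieBreak (s.reg u).toNat (s.reg i).toNat (s.reg v).toNat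
    (s.reg j).toNat
  have ne : ∀ {r}, r < 20 ∨ 40 ≤ r → r ≠ 20 ∧ r ≠ 21 ∧ r ≠ 22 := by omega
  have nu := ne hu
  have ni := ne hi
  have nv := ne hv
  have nj := ne hj
  have degu : ∀ v, (BitVec.ofNat W (I.degree v)).toNat = I.degree v := fun v =>
    toNat_ofNat_of_lt (by
      have := I.degree_le_maxDeg v; have := I.maxDeg_lt he.pos; have := he.n_lt; omega)
  refine .seq (.const (.ite (fun h1 => ?_) fun h1 => .ite (fun h2 => ?_) fun h2 => ?_))
  · simp only [Test.Holds, ne_eq, nu, ni, nv, nj, not_false_eq_true, Function.update_of_ne,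
      Function.update_self, State.tick_reg, degu, Nat.reduceEqDiff] at h1
    refine .const (h _ ⟨fun r hr => by simp [ne hr], rfl, rfl, rfl⟩ (by simp) ?_)
    simp [h01, hlt, h1]
  · simp only [Test.Holds, ne_eq, nu, ni, nv, nj, not_false_eq_true, Function.update_of_ne,
      Function.update_self, State.tick_reg, degu, Nat.reduceEqDiff] at h1 h2
    refine .skip (h _ ⟨fun r hr => by simp [ne hr], rfl, rfl, rfl⟩ (by simp) ?_)
    simp [h01, hlt, h1, h2]
  · simp only [Test.Holds, ne_eq, nu, ni, nv, nj, not_false_eq_true, Function.update_of_ne,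
      Function.update_self, State.tick_reg, degu, Nat.reduceEqDiff] at h1 h2
    refine .seq (.degree (.seq (.degree (.ite (fun h3 => .ite (fun h4 => ?_) fun h4 => ?_)
      fun h3 => ?_))))
    · simp only [Test.Holds, ne_eq, nu, ni, nv, nj, not_false_eq_true, Function.update_of_ne,
      Function.update_self, State.tick_reg, degu, Nat.reduceEqDiff] at h3 h4
      have hun := (I.lt_degree_iff.1 h3).1
      have hvn := (I.lt_degree_iff.1 h4).1
      refine .seq (he.wp_computeKey (by omega) hu hi ?_ fun s1 hs1 hg1 hr1 hk1 =>
        .seq (he.wp_computeKey (by omega) hv hj ?_ fun s2 hs2 hg2 hr2 hk2 => ?_))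
      · simpa [nu] using hun
      · rw [hs1.reg v hv]
        simpa [nv] using hvn
      · rw [hs1.reg v hv, hs1.reg j hj] at hk2
        simp only [ne_eq, nu, ni, nv, nj, not_false_eq_true, Function.update_of_ne,
          State.tick_reg] at hk1 hk2
        have h23 := hr2 23 (by omega) (by omega) (by omega)
        have hf : s2.reg 20 = BitVec.ofNat W 0 := by
          rw [hr2 20 (by omega) (by omega) (by omega), hr1 20 (by omega) (by omega) (by omega)]
          simp
        have hS : SameData s s2 :=
          ⟨fun r hr => by
            rw [hs2.reg r hr, hs1.reg r hr]; simp [ne hr],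
            by rw [hs2.mem, hs1.mem]; rfl, by rw [hs2.out, hs1.out]; rfl,
            by rw [hs2.used, hs1.used]; rfl⟩
        simp only [State.tick_gap] at hg1
        refine .ite (fun h5 => ?_) fun h5 => ?_
        · simp only [Test.Holds, h23, hk1, hk2] at h5
          refine .const (h _ ⟨fun r hr => ?_, hS.mem, hS.out, hS.used⟩ ?_ ?_)
          · simp [ne hr, hS.reg r hr]
          · simp; omega
          · simp [h01, hlt, h1, h2, h3, h4, h5]
        · simp only [Test.Holds, h23, hk1, hk2] at h5
          refine .skip (h _ ⟨hS.reg, hS.mem, hS.out, hS.used⟩ ?_ ?_)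
          · simp; omega
          · simp [h01, hlt, h1, h2, h3, h4, h5, hf]
    · simp only [Test.Holds, ne_eq, nu, ni, nv, nj, not_false_eq_true, Function.update_of_ne,
      Function.update_self, State.tick_reg, degu, Nat.reduceEqDiff] at h4
      refine .skip (h _ ⟨fun r hr => by simp [ne hr], rfl, rfl, rfl⟩
        (by simp) ?_)
      simp [h01, hlt, h1, h4]
    · simp only [Test.Holds, ne_eq, nu, ni, nv, nj, not_false_eq_true, Function.update_of_ne,
      Function.update_self, State.tick_reg, degu, Nat.reduceEqDiff] at h3
      refine .skip (h _ ⟨fun r hr => by simp [ne hr], rfl, rfl, rfl⟩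
        (by simp) ?_)
      simp [h01, hlt, h1, h3]

/-! ### Paced output -/

/-- The memory cells with the names and addresses that the enumeration itself may use, as opposed
to the programs that it simulates. -/
def ownCells (I : Input) (W : ℕ) : Set (ℕ × BitVec W) := {x | x.1 < 4 ∧ x.2.toNat < I.n}

theorem ownCells_union_insert {a : ℕ} {x : BitVec W} (ha : a < 4) (hx : x.toNat < I.n)
    (S : Set (ℕ × BitVec W)) : ownCells I W ∪ insert (a, x) S = ownCells I W ∪ S := by
  have : (a, x) ∈ ownCells I W := ⟨ha, hx⟩
  ext y
  simp only [Set.mem_union, Set.mem_insert_iff]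
  constructor
  · rintro (h | rfl | h)
    exacts [.inl h, .inl this, .inr h]
  · rintro (h | h)
    exacts [.inl h, .inr (.inr h)]

/-- The mates of the vertices below `v` have been found, the sources among these vertices stand in
a buffer, and the edges from the first `em` of them have been output, with waiting times of at most
`D`. -/
structure Core (I : Input) (m : ℕ → ℕ) (D v em : ℕ) (s : State W) : Prop where
  n : s.reg regN = BitVec.ofNat W I.n
  one : s.reg regOne = BitVec.ofNat W 1
  vertex : s.reg regV = BitVec.ofNat W v
  count : s.reg regCnt = BitVec.ofNat W (sources m v).length
  emitted : s.reg regEm = BitVec.ofNat W em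
  mate : ∀ x < v, s.mem arrMate (BitVec.ofNat W x) = BitVec.ofNat W (m x)
  buf : ∀ k (h : k < (sources m v).length),
    s.mem arrBuf (BitVec.ofNat W k) = BitVec.ofNat W (sources m v)[k]
  out : s.out.map Prod.fst = ((sources m v).take em).map (mateEdge m)
  gaps : ∀ x ∈ s.out, x.2 ≤ D
  used : ∀ x < v, (arrMate, BitVec.ofNat W x) ∈ s.used

theorem Core.congr {m : ℕ → ℕ} {D v em : ℕ} {s s' : State W} (h : Core I m D v em s)
    (hr : ∀ r < 5, s'.reg r = s.reg r) (h0 : s'.mem arrMate = s.mem arrMate)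
    (h1 : s'.mem arrBuf = s.mem arrBuf) (ho : s'.out = s.out) (hu : s.used ⊆ s'.used) :
    Core I m D v em s' where
  n := by rw [hr _ (by omega), h.n]
  one := by rw [hr _ (by omega), h.one]
  vertex := by rw [hr _ (by omega), h.vertex]
  count := by rw [hr _ (by omega), h.count]
  emitted := by rw [hr _ (by omega), h.emitted]
  mate := by rw [h0]; exact h.mate
  buf := by rw [h1]; exact h.buf
  out := by rw [ho]; exact h.out
  gaps := by rw [ho]; exact h.gaps
  used := fun x hx => hu (h.used x hx)

/-- Outputs the next edge of the buffer. -/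
def emitNext : Cmd :=
  .basic (.load 20 arrBuf regEm) ⨾ .basic (.load 21 arrMate 20) ⨾ .basic (.emit 20 21) ⨾
  .basic (.op .add regEm regEm regOne)

theorem Env.wp_emitNext (he : Env I w w' W) {Q : State W → Prop} {s : State W} {m : ℕ → ℕ}
    {D v em : ℕ} (hc : Core I m D v em s) (hv : v ≤ I.n) (hm : ∀ x < v, m x < I.n)
    (hem : em < (sources m v).length) (hgap : s.gap + 3 ≤ D)
    (h : ∀ s', Core I m D v (em + 1) s' →
      (∀ r, r ≠ regEm → r < 20 ∨ 40 ≤ r → s'.reg r = s.reg r) → s'.mem = s.mem →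
      ownCells I W ∪ s'.used = ownCells I W ∪ s.used → s.used ⊆ s'.used → s'.gap = 1 → Q s') :
    Wp I w emitNext Q s := by
  have hx := List.getElem_mem hem
  have hb := hc.buf em hem
  have hln := length_sources_le m v
  obtain ⟨hxv, -⟩ := mem_sources.1 hx
  have htake : (sources m v).take (em + 1) = (sources m v).take em ++ [(sources m v)[em]] := by
    simp [List.take_append_getElem]
  generalize (sources m v)[em] = x at *
  have hn := he.n_lt
  have hmx := hm x hxv
  have htx : (BitVec.ofNat W x).toNat = x := toNat_ofNat_of_lt (by omega)
  have htm : (BitVec.ofNat W (m x)).toNat = m x := toNat_ofNat_of_lt (by omega)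
  have hte : (BitVec.ofNat W em).toNat = em := toNat_ofNat_of_lt (by omega)
  have hmate := hc.mate x hxv
  refine .seq (.load (.seq (.load (.seq (.emit (.op (h _ ⟨?_, ?_, ?_, ?_, ?_, ?_, ?_, ?_, ?_, ?_⟩
    ?_ rfl ?_ ?_ rfl)))))))
  · simpa using hc.n
  · simpa using hc.one
  · simpa using hc.vertex
  · simpa using hc.count
  · simp [WordOp.eval, hc.emitted, hc.one, BitVec.ofNat_add]
  · exact hc.mate
  · exact hc.buf
  · simp only [List.map_append, hc.out, htake]
    simp [hc.emitted, hb, hmate, mateEdge, htx, htm, -BitVec.toNat_ofNat]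
  · intro y hy
    rcases List.mem_append.1 hy with hy | hy
    · exact hc.gaps y hy
    · obtain rfl := List.mem_singleton.1 hy
      exact hgap
  · exact fun x hx => Set.mem_insert_of_mem _ (Set.mem_insert_of_mem _ (hc.used x hx))
  · intro r h1 h2
    have : r ≠ 20 := by omega
    have : r ≠ 21 := by omega
    simp [*]
  · simp only [Function.update_self, hc.emitted, hb]
    rw [ownCells_union_insert (by omega) (by omega), ownCells_union_insert (by omega) (by omega)]
  · exact fun y hy => Set.mem_insert_of_mem _ (Set.mem_insert_of_mem _ hy)

/-- Counts a round of the current loop, and outputs an edge of the buffer in every round whose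
number is divisible by the content of `regBud`. -/
def pulse : Cmd :=
  .basic (.op .add regCtr regCtr regOne) ⨾
  .ite (.eq regCtr regBud) (emitNext ⨾ .basic (.const regCtr 0)) .skip

/-- The situation after `j` rounds of a loop that ends every round with a `pulse`: each round takes
at most `cst` steps, one edge is output every `bud` rounds, and `em` edges had been output before
the loop. -/
structure Paced (I : Input) (m : ℕ → ℕ) (D v em bud g cst j : ℕ) (s : State W) : Prop where
  core : Core I m D v (em + j / bud) s
  ctr_eq : s.reg regCtr = BitVec.ofNat W (j % bud)
  bud_eq : s.reg regBud = BitVec.ofNat W bud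
  gap : s.gap ≤ g + (j % bud) * cst

theorem div_mod_succ {j b : ℕ} (hb : 0 < b) :
    (j % b + 1 = b ∧ (j + 1) / b = j / b + 1 ∧ (j + 1) % b = 0) ∨
    (j % b + 1 < b ∧ (j + 1) / b = j / b ∧ (j + 1) % b = j % b + 1) := by
  have h1 := Nat.mod_lt j hb
  have h2 := Nat.div_add_mod j b
  rcases Nat.lt_or_ge (j % b + 1) b with h | h
  · right
    refine ⟨h, ?_⟩
    rw [Nat.div_mod_unique hb]
    exact ⟨by omega, h⟩
  · left
    refine ⟨by omega, ?_⟩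
    rw [Nat.div_mod_unique hb]
    refine ⟨?_, hb⟩
    rw [mul_add]
    omega

theorem Env.wp_pulse (he : Env I w w' W) {Q : State W → Prop} {s : State W} {m : ℕ → ℕ}
    {D v em bud g cst j : ℕ} (hc : Core I m D v (em + j / bud) s)
    (hctr : s.reg regCtr = BitVec.ofNat W (j % bud)) (hbud : s.reg regBud = BitVec.ofNat W bud)
    (hgap : s.gap + 5 ≤ g + (j % bud + 1) * cst)
    (hv : v ≤ I.n) (hm : ∀ x < v, m x < I.n)
    (hem : em + (j + 1) / bud ≤ (sources m v).length) (hg : 10 ≤ g) (hD : g + bud * cst ≤ D)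
    (hb0 : 0 < bud) (hbW : bud < 2 ^ W)
    (h : ∀ s', Paced I m D v em bud g cst (j + 1) s'.tick →
      (∀ r, r ≠ regEm → r ≠ regCtr → r < 20 ∨ 40 ≤ r → s'.reg r = s.reg r) → s'.mem = s.mem →
      ownCells I W ∪ s'.used = ownCells I W ∪ s.used → s.used ⊆ s'.used → Q s') :
    Wp I w pulse Q s := by
  refine .seq (.op ?_)
  have hctr' : s.reg regCtr + s.reg regOne = BitVec.ofNat W (j % bud + 1) := by
    rw [hctr, hc.one, BitVec.ofNat_add]
  have hlt := Nat.mod_lt j hb0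
  rcases div_mod_succ (j := j) hb0 with ⟨h1, h2, h3⟩ | ⟨h1, h2, h3⟩
  · refine .ite (fun _ => .seq ?_) fun hn => (hn ?_).elim
    · rw [h1] at hgap
      refine he.wp_emitNext (m := m) (D := D) (v := v) (em := em + j / bud)
        (hc.congr ?_ rfl rfl rfl (by rfl)) hv hm (by omega) ?_ fun s1 hc1 hr1 hm1 hu1 hu1' hg1 => ?_
      · intro r hr
        have : r ≠ 6 := by omega
        simp [*]
      · simp only [State.tick_gap]; omega
      · refine .const (h _ ⟨?_, ?_, ?_, ?_⟩ ?_ ?_ ?_ ?_)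
        · rw [h2, ← add_assoc]
          refine hc1.congr (fun r hr => ?_) rfl rfl rfl (by rfl)
          have : r ≠ 6 := by omega
          simp [*]
        · simp [h3]
        · simp [hr1, hbud]
        · simp [hg1]; omega
        · intro r h1 h2 h3
          simp [*]
        · exact hm1
        · exact hu1
        · exact hu1'
    · simp [Test.Holds, WordOp.eval, hctr', hbud, h1]
  · refine .ite (fun hn => ?_) fun hn => .skip (h _ ⟨?_, ?_, ?_, ?_⟩ ?_ rfl rfl le_rfl)
    · simp only [Test.Holds, WordOp.eval, hctr', hbud, Function.update_self, ne_eq,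
        Nat.reduceEqDiff, not_false_eq_true, Function.update_of_ne] at hn
      rw [ofNat_inj_of_lt (by omega) hbW] at hn
      omega
    · rw [h2]
      refine hc.congr (fun r hr => ?_) rfl rfl rfl (by rfl)
      have : r ≠ 6 := by omega
      simp [*]
    · simp [WordOp.eval, hctr', h3]
    · simp [hbud]
    · simp [h3]; omega
    · intro r h1 h2 h3
      simp [*]

/-! ### Finding the lightest edge at a vertex -/

/-- Scans the adjacency list of the current vertex; leaves its length in register `10` and the
position of the lightest entry in register `11`. -/
def scanList : Cmd :=
  .basic (.degree 10 regV) ⨾ .basic (.const 11 0) ⨾ .basic (.const 12 1) ⨾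
  .loop (.lt 12 10)
    (compareEntries regV 12 regV 11 ⨾
      .ite (.eq regFlag regOne) (.basic (.op .or 11 12 12)) .skip ⨾
      .basic (.op .add 12 12 regOne))

theorem Env.degree_lt (he : Env I w w' W) (v : ℕ) : I.degree v < I.n :=
  (I.degree_le_maxDeg v).trans_lt (I.maxDeg_lt he.pos)

theorem Env.wp_scanList (he : Env I w w' W) {Q : State W → Prop} {s : State W} {v : ℕ}
    (hv : v < I.n) (hV : s.reg regV = BitVec.ofNat W v) (hone : s.reg regOne = BitVec.ofNat W 1)
    (h : ∀ s', (∀ r, r < 10 ∨ 13 ≤ r ∧ r < 20 ∨ 40 ≤ r → s'.reg r = s.reg r) →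
      s'.mem = s.mem → s'.out = s.out → s'.used = s.used →
      s'.reg 10 = BitVec.ofNat W (I.degree v) →
      s'.reg 11 = BitVec.ofNat W (lightest I w' v (I.degree v - 1)) →
      s'.gap ≤ s.gap + 5 + 50 * I.degree v → Q s') :
    Wp I w scanList Q s := by
  have hn := he.n_lt
  have hd := he.degree_lt v
  have hW : 1 < 2 ^ W := by omega
  have hv' : (BitVec.ofNat W v).toNat = v := toNat_ofNat_of_lt (by omega)
  refine .seq (.degree (.seq (.const (.seq (.const (.loop
    (fun j s' => (∀ r, r < 10 ∨ 13 ≤ r ∧ r < 20 ∨ 40 ≤ r → s'.reg r = s.reg r) ∧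
      s'.mem = s.mem ∧ s'.out = s.out ∧ s'.used = s.used ∧
      s'.reg 10 = BitVec.ofNat W (I.degree v) ∧
      s'.reg 11 = BitVec.ofNat W (lightest I w' v j) ∧
      s'.reg 12 = BitVec.ofNat W (j + 1) ∧ s'.gap ≤ s.gap + 3 + 50 * j)
    (I.degree v - 1) ?_ ?_ ?_))))))
  · refine ⟨fun r hr => ?_, rfl, rfl, rfl, ?_, ?_, ?_, ?_⟩
    · have : r ≠ 10 := by omega
      have : r ≠ 11 := by omega
      have : r ≠ 12 := by omega
      simp [*]
    · simp [hV, hv', -BitVec.toNat_ofNat]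
    · simp [lightest]
    · simp
    · simp
  · rintro j hj s1 ⟨hr, hm, ho, hu, h10, h11, h12, hg⟩
    refine ⟨?_, .seq ?_⟩
    · simp only [Test.Holds, h10, h12]
      rw [toNat_ofNat_of_lt (by omega), toNat_ofNat_of_lt (by omega)]
      omega
    · have hl := lightest_le I w' v j
      refine he.wp_compareEntries (by omega) (by omega) (by omega) (by omega)
        fun s2 hs2 hg2 hf => .seq ?_
      rw [State.tick_reg, hr 2 (by omega), hV, h11, h12, hv', toNat_ofNat_of_lt (by omega),
        toNat_ofNat_of_lt (by omega)] at hf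
      rw [State.tick_gap] at hg2
      have h1 : s2.reg 1 = BitVec.ofNat W 1 := by
        rw [hs2.reg _ (by omega), State.tick_reg, hr _ (by omega), hone]
      have hj1 : BitVec.ofNat W (j + 1) + BitVec.ofNat W 1 = BitVec.ofNat W (j + 1 + 1) := by
        simp only [BitVec.ofNat_add]
      have h11' := hs2.reg 11 (by omega)
      have h12' := hs2.reg 12 (by omega)
      have h10' := hs2.reg 10 (by omega)
      simp only [State.tick_reg, h10, h11, h12] at h10' h11' h12'
      refine .ite (fun ht => .op (.op ?_)) fun ht => .skip (.op ?_)
      · have hlt : I.EntryLt w' v (j + 1) v (lightest I w' v j) := hf.1 (ht.trans h1)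
        refine ⟨fun r h => ?_, ?_, ?_, ?_, ?_, ?_, ?_, ?_⟩
        · have : r ≠ 11 := by omega
          have : r ≠ 12 := by omega
          have := hs2.reg r (by omega)
          simp [*]
        · simp [hs2.mem, hm]
        · simp [hs2.out, ho]
        · simp [hs2.used, hu]
        · simp [h10']
        · simp [WordOp.eval, h12', lightest, hlt]
        · simp only [WordOp.eval, State.tick_reg, ne_eq, Nat.reduceEqDiff, not_false_eq_true,
            Function.update_of_ne, Function.update_self, h12', h1, hj1]
        · simp; omega
      · have hlt : ¬ I.EntryLt w' v (j + 1) v (lightest I w' v j) := fun hlt =>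
          ht ((hf.2 hlt).trans h1.symm)
        refine ⟨fun r h => ?_, ?_, ?_, ?_, ?_, ?_, ?_, ?_⟩
        · have : r ≠ 12 := by omega
          have := hs2.reg r (by omega)
          simp [*]
        · simp [hs2.mem, hm]
        · simp [hs2.out, ho]
        · simp [hs2.used, hu]
        · simp [h10']
        · simp [WordOp.eval, h11', lightest, hlt]
        · simp only [WordOp.eval, State.tick_reg, ne_eq, Nat.reduceEqDiff, not_false_eq_true,
            Function.update_of_ne, Function.update_self, h12', h1, hj1]
        · simp; omega
  · rintro s1 ⟨hr, hm, ho, hu, h10, h11, h12, hg⟩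
    refine ⟨?_, h _ (by simpa using hr) (by simpa using hm) (by simpa using ho) (by simpa using hu)
      (by simpa using h10) (by simpa using h11) ?_⟩
    · simp only [Test.Holds, h10, h12]
      rw [toNat_ofNat_of_lt (by omega), toNat_ofNat_of_lt (by omega)]
      omega
    · simp; omega

/-- Appends the current vertex to the buffer. -/
def push : Cmd := .basic (.store arrBuf regCnt regV) ⨾ .basic (.op .add regCnt regCnt regOne)

/-- Stores the mate of the current vertex, and appends the vertex to the buffer if it is a source. If
the mate is not greater, its own mate is already known. -/
def fileVertex : Cmd :=
  .basic (.neighbor 13 regV 11) ⨾ .basic (.store arrMate regV 13) ⨾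
  .ite (.lt regV 13) push (.basic (.load 14 arrMate 13) ⨾ .ite (.eq 14 regV) .skip push)

/-- The effect of `fileVertex`. -/
structure Filed (I : Input) (m : ℕ → ℕ) (v : ℕ) (s s' : State W) : Prop where
  count : s'.reg regCnt = BitVec.ofNat W (sources m (v + 1)).length
  mate : ∀ x < v + 1, s'.mem arrMate (BitVec.ofNat W x) = BitVec.ofNat W (m x)
  buf : ∀ k (h : k < (sources m (v + 1)).length),
    s'.mem arrBuf (BitVec.ofNat W k) = BitVec.ofNat W (sources m (v + 1))[k]
  used : ∀ x < v + 1, (arrMate, BitVec.ofNat W x) ∈ s'.used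
  reg : ∀ r, r ≠ regCnt → r ≠ 13 → r ≠ 14 → s'.reg r = s.reg r
  mem : ∀ a, 2 ≤ a → s'.mem a = s.mem a
  out : s'.out = s.out
  cells : ownCells I W ∪ s'.used = ownCells I W ∪ s.used
  sub : s.used ⊆ s'.used
  gap : s'.gap ≤ s.gap + 10

theorem Env.wp_fileVertex (he : Env I w w' W) {Q : State W → Prop} {s : State W} {D v em : ℕ}
    (hc : Core I (mate I w') D v em s) (hv : v < I.n)
    (h11 : s.reg 11 = BitVec.ofNat W (lightest I w' v (I.degree v - 1)))
    (h : ∀ s', Filed I (mate I w') v s s' → Q s') : Wp I w fileVertex Q s := by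
  have hn := he.n_lt
  have hd := he.degree_lt v
  have hm : mate I w' v < I.n := mate_lt I w' he.pos v
  have hl := lightest_le I w' v (I.degree v - 1)
  have hln := length_sources_le (mate I w') v
  have hV := hc.vertex
  have hnb : BitVec.ofNat W (I.neighbor (s.reg 2).toNat (s.reg 11).toNat) =
      BitVec.ofNat W (mate I w' v) := by
    rw [hV, h11, toNat_ofNat_of_lt (by omega), toNat_ofNat_of_lt (by omega), mate]
  have htm : (BitVec.ofNat W (mate I w' v)).toNat = mate I w' v := toNat_ofNat_of_lt (by omega)
  have htv : (BitVec.ofNat W v).toNat = v := toNat_ofNat_of_lt (by omega)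
  -- the contents of the mate array after the store
  have hmate : ∀ x < v + 1, Function.update (s.mem 0) (BitVec.ofNat W v)
      (BitVec.ofNat W (mate I w' v)) (BitVec.ofNat W x) = BitVec.ofNat W (mate I w' x) := by
    intro x hx
    rcases Nat.lt_succ_iff_lt_or_eq.1 hx with hx | rfl
    · rw [Function.update_of_ne, hc.mate x hx]
      rw [ne_eq, ofNat_inj_of_lt (by omega) (by omega)]
      omega
    · simp
  have hbuf : ∀ k, ∀ h : k < (sources (mate I w') v ++ [v]).length,
      Function.update (s.mem 1) (BitVec.ofNat W (sources (mate I w') v).length) (BitVec.ofNat W v)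
        (BitVec.ofNat W k) = BitVec.ofNat W ((sources (mate I w') v ++ [v])[k]) := by
    intro k hk
    simp only [List.length_append, List.length_singleton] at hk
    rcases Nat.lt_succ_iff_lt_or_eq.1 hk with hk | rfl
    · rw [Function.update_of_ne, hc.buf k hk, List.getElem_append_left hk]
      rw [ne_eq, ofNat_inj_of_lt (by omega) (by omega)]
      omega
    · simp
  refine .seq (.neighbor (.seq (.store ?_)))
  rw [hnb]
  refine .ite (fun h1 => ?_) fun h1 => .seq (.load (.ite (fun h2 => .skip ?_) fun h2 => ?_))
  · simp only [Test.Holds, ne_eq, Nat.reduceEqDiff, not_false_eq_true, Function.update_of_ne,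
      Function.update_self, hV, htm, htv] at h1
    have hs := sources_succ (mate I w') v
    rw [if_pos (.inl h1)] at hs
    refine .seq (.store (.op (h _ ⟨?_, ?_, ?_, ?_, ?_, ?_, rfl, ?_, ?_, ?_⟩)))
    · simp [WordOp.eval, hc.one, hc.count, hs, BitVec.ofNat_add]
    · simpa [hV] using hmate
    · rw [hs]; simpa [hV, hc.count] using hbuf
    · intro x hx
      rcases Nat.lt_succ_iff_lt_or_eq.1 hx with hx | rfl
      · exact .inr (.inr (hc.used x hx))
      · exact .inr (.inl (by simp [hV]))
    · intro r h1 h2 h3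
      simp [*]
    · intro a ha
      have : a ≠ 0 := by omega
      have : a ≠ 1 := by omega
      simp [*]
    · simp only [State.tick_reg, State.tick_used, ne_eq, Nat.reduceEqDiff, not_false_eq_true,
        Function.update_of_ne, hV, hc.count]
      rw [ownCells_union_insert (by omega) (by rw [toNat_ofNat_of_lt (by omega)]; omega),
        ownCells_union_insert (by omega) (by omega)]
    · exact fun y hy => .inr (.inr hy)
    · simp
  all_goals
    simp only [Test.Holds, ne_eq, Nat.reduceEqDiff, not_false_eq_true, Function.update_of_ne,
      Function.update_self, hV, htm, htv, State.tick_reg, State.tick_mem] at h1 h2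
  · have hload := hmate (mate I w' v) (by omega)
    have hmm := mate_lt I w' he.pos (mate I w' v)
    rw [hload, ofNat_inj_of_lt (by omega) (by omega)] at h2
    have hs := sources_succ (mate I w') v
    rw [if_neg (by simp [h1, h2]), List.append_nil] at hs
    refine h _ ⟨?_, ?_, ?_, ?_, ?_, ?_, rfl, ?_, ?_, ?_⟩
    · simp [hc.count, hs]
    · simpa [hV] using hmate
    · rw [hs]; simpa using hc.buf
    · intro x hx
      rcases Nat.lt_succ_iff_lt_or_eq.1 hx with hx | rfl
      · exact .inr (.inr (hc.used x hx))
      · exact .inr (.inl (by simp [hV]))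
    · intro r h1 h2 h3
      simp [*]
    · intro a ha
      have : a ≠ 0 := by omega
      simp [*]
    · simp only [State.tick_reg, State.tick_used, ne_eq, Nat.reduceEqDiff, not_false_eq_true,
        Function.update_of_ne, hV, hc.count, Function.update_self]
      rw [ownCells_union_insert (by omega) (by omega),
        ownCells_union_insert (by omega) (by omega)]
    · exact fun y hy => .inr (.inr hy)
    · simp
  · have hload := hmate (mate I w' v) (by omega)
    have hmm := mate_lt I w' he.pos (mate I w' v)
    rw [hload, ofNat_inj_of_lt (by omega) (by omega)] at h2
    have hs := sources_succ (mate I w') v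
    rw [if_pos (.inr h2)] at hs
    refine .seq (.store (.op (h _ ⟨?_, ?_, ?_, ?_, ?_, ?_, rfl, ?_, ?_, ?_⟩)))
    · simp [WordOp.eval, hc.one, hc.count, hs, BitVec.ofNat_add]
    · simpa [hV] using hmate
    · rw [hs]; simpa [hV, hc.count] using hbuf
    · intro x hx
      rcases Nat.lt_succ_iff_lt_or_eq.1 hx with hx | rfl
      · exact .inr (.inr (.inr (hc.used x hx)))
      · exact .inr (.inr (.inl (by simp [hV])))
    · intro r h1 h2 h3
      simp [*]
    · intro a ha
      have : a ≠ 0 := by omega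
      have : a ≠ 1 := by omega
      simp [*]
    · simp only [State.tick_reg, State.tick_used, ne_eq, Nat.reduceEqDiff, not_false_eq_true,
        Function.update_of_ne, hV, hc.count, Function.update_self]
      rw [ownCells_union_insert (by omega) (by rw [toNat_ofNat_of_lt (by omega)]; omega),
        ownCells_union_insert (by omega) (by omega), ownCells_union_insert (by omega) (by omega)]
    · exact fun y hy => .inr (.inr (.inr hy))
    · simp

/-- Finds and stores the mate of the current vertex, updates the maximum degree, and goes on to the
next vertex. -/
def processVertex : Cmd :=
  scanList ⨾ fileVertex ⨾
  .ite (.lt regDelta 10) (.basic (.op .or regDelta 10 10)) .skip ⨾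
  .basic (.op .add regV regV regOne)

theorem Env.wp_processVertex (he : Env I w w' W) {Q : State W → Prop} {s : State W} {D v em : ℕ}
    (hc : Core I (mate I w') D v em s) (hv : v < I.n)
    (hdel : s.reg regDelta = BitVec.ofNat W ((Finset.range v).sup I.degree))
    (h : ∀ s', Core I (mate I w') D (v + 1) em s' →
      s'.reg regDelta = BitVec.ofNat W ((Finset.range (v + 1)).sup I.degree) →
      (∀ r, r = regCtr ∨ r = regBud ∨ 40 ≤ r → s'.reg r = s.reg r) →
      (∀ a, 2 ≤ a → s'.mem a = s.mem a) → ownCells I W ∪ s'.used = ownCells I W ∪ s.used →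
      s.used ⊆ s'.used → s'.gap ≤ s.gap + 20 + 50 * I.degree v → Q s')
    (hem : em ≤ (sources (mate I w') v).length) :
    Wp I w processVertex Q s := by
  have hn := he.n_lt
  have hd := he.degree_lt v
  refine .seq (he.wp_scanList hv hc.vertex hc.one fun s1 hr1 hm1 ho1 hu1 h10 h11 hg1 => .seq ?_)
  have hc1 : Core I (mate I w') D v em s1 :=
    hc.congr (fun r hr => hr1 r (by omega)) (by rw [hm1]) (by rw [hm1]) ho1 (by rw [hu1])
  refine he.wp_fileVertex hc1 hv h11 fun s2 hs2 => .seq ?_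
  have h10' : s2.reg 10 = BitVec.ofNat W (I.degree v) := by
    rw [hs2.reg _ (by omega) (by omega) (by omega), h10]
  have hdel' : s2.reg 5 = BitVec.ofNat W ((Finset.range v).sup I.degree) := by
    rw [hs2.reg _ (by omega) (by omega) (by omega), hr1 _ (by omega), hdel]
  have hsup : (Finset.range (v + 1)).sup I.degree =
      max (I.degree v) ((Finset.range v).sup I.degree) := by
    rw [Finset.range_add_one, Finset.sup_insert]
  have hsupn : (Finset.range v).sup I.degree < I.n := by
    rw [Finset.sup_lt_iff (by simpa using he.pos)]
    exact fun x _ => he.degree_lt x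
  have hreg : ∀ {x} r, r < 5 → r ≠ 2 → r ≠ 3 → Function.update s2.reg 2 x r = s.reg r := by
    intro x r h1 h2 h3
    rw [Function.update_of_ne h2, hs2.reg _ (by omega) (by omega) (by omega), hr1 _ (by omega)]
  have htake : (sources (mate I w') (v + 1)).take em = (sources (mate I w') v).take em := by
    rw [sources_succ, List.take_append_of_le_length hem]
  have hV : s2.reg 2 = BitVec.ofNat W v := by
    rw [hs2.reg _ (by omega) (by omega) (by omega), hr1 _ (by omega), hc.vertex]
  have h1 : s2.reg 1 = BitVec.ofNat W 1 := by
    rw [hs2.reg _ (by omega) (by omega) (by omega), hr1 _ (by omega), hc.one]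
  have hcore : ∀ s3 : State W, (∀ r < 5, r ≠ 2 → s3.reg r = s2.reg r) →
      s3.reg 2 = BitVec.ofNat W (v + 1) → s3.mem = s2.mem → s3.out = s2.out →
      s3.used = s2.used → Core I (mate I w') D (v + 1) em s3 := by
    intro s3 hr3 hv3 hm3 ho3 hu3
    have hreg : ∀ r, r < 5 → r ≠ 2 → r ≠ 3 → s3.reg r = s.reg r := by
      intro r h1 h2 h3
      rw [hr3 r h1 h2, hs2.reg _ (by omega) (by omega) (by omega), hr1 _ (by omega)]
    constructor
    · rw [hreg _ (by omega) (by omega) (by omega), hc.n]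
    · rw [hreg _ (by omega) (by omega) (by omega), hc.one]
    · exact hv3
    · rw [hr3 _ (by omega) (by omega), hs2.count]
    · rw [hreg _ (by omega) (by omega) (by omega), hc.emitted]
    · rw [hm3]; exact hs2.mate
    · rw [hm3]; exact hs2.buf
    · rw [ho3, hs2.out, ho1, hc.out, htake]
    · rw [ho3, hs2.out, ho1]; exact hc.gaps
    · rw [hu3]; exact hs2.used
  have hfr : ∀ r, r = 6 ∨ r = 7 ∨ 40 ≤ r → s2.reg r = s.reg r := by
    intro r hr
    rw [hs2.reg _ (by omega) (by omega) (by omega), hr1 _ (by omega)]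
  have hmem : ∀ a, 2 ≤ a → s2.mem a = s.mem a := by
    intro a ha
    rw [hs2.mem a ha, hm1]
  have hcells : ownCells I W ∪ s2.used = ownCells I W ∪ s.used := by rw [hs2.cells, hu1]
  have hsub : s.used ⊆ s2.used := by rw [← hu1]; exact hs2.sub
  have hg2 := hs2.gap
  refine .ite (fun h2 => .op (.op (h _ (hcore _ ?_ ?_ rfl rfl rfl) ?_ ?_ hmem hcells hsub ?_)))
    fun h2 => .skip (.op (h _ (hcore _ ?_ ?_ rfl rfl rfl) ?_ ?_ hmem hcells hsub ?_))
  all_goals try simp only [Test.Holds, h10', hdel'] at h2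
  all_goals try rw [toNat_ofNat_of_lt (by omega), toNat_ofNat_of_lt (by omega)] at h2
  · intro r hr h
    have : r ≠ 5 := by omega
    simp [*]
  · simp [WordOp.eval, hV, h1, BitVec.ofNat_add]
  · simp [WordOp.eval, h10', hsup, max_eq_left h2.le]
  · intro r hr
    have h1 : r ≠ 5 := by omega
    have h2 : r ≠ 2 := by omega
    simp [hfr r hr, h1, h2]
  · simp; omega
  · intro r hr h
    simp [*]
  · simp [WordOp.eval, hV, h1, BitVec.ofNat_add]
  · simp [hdel', hsup, max_eq_right (not_lt.1 h2)]
  · intro r hr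
    have h2 : r ≠ 2 := by omega
    simp [hfr r hr, h2]
  · simp; omega

theorem div_le_length_sources {m : ℕ → ℕ} {n v k : ℕ} (hm : 2 ≤ n → ∀ x < n, m x ≠ x)
    (hv : v ≤ n) (hk : 2 ≤ k) : v / k ≤ (sources m v).length := by
  have h2 : v / k ≤ v / 2 := Nat.div_le_div_left hk (by omega)
  rcases Nat.lt_or_ge n 2 with h | h
  · omega
  · have := le_two_mul_length_sources fun x hx => hm h x (hx.trans_le hv)
    omega

/-- Processes all vertices, and outputs one edge for every four of them. -/
def firstPhase : Cmd :=
  .basic (.numVertices regN) ⨾ .basic (.const regOne 1) ⨾ .basic (.const regV 0) ⨾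
  .basic (.const regCnt 0) ⨾ .basic (.const regEm 0) ⨾ .basic (.const regDelta 0) ⨾
  .basic (.const regCtr 0) ⨾ .basic (.const regBud 4) ⨾
  .loop (.lt regV regN) (processVertex ⨾ pulse)

theorem Env.mate_ne (he : Env I w w' W) (h2 : 2 ≤ I.n) {x : ℕ} (hx : x < I.n) :
    mate I w' x ≠ x := by
  obtain ⟨hv, hm, hadj⟩ := adj_mate w' (I.degree_pos he.connected h2 hx)
  exact fun h => hadj.ne (Fin.ext h.symm)

theorem Env.wp_firstPhase (he : Env I w w' W) {Q : State W → Prop} {s : State W} {D : ℕ}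
    (hout : s.out = []) (hgap : s.gap = 0) (hused : s.used = ∅)
    (hD : 10 + 4 * (30 + 50 * I.maxDeg) ≤ D)
    (h : ∀ s', Core I (mate I w') D I.n (I.n / 4) s' →
      s'.reg regDelta = BitVec.ofNat W I.maxDeg →
      (∀ r, 40 ≤ r → s'.reg r = s.reg r) → (∀ a, 2 ≤ a → s'.mem a = s.mem a) →
      ownCells I W ∪ s'.used = ownCells I W →
      s'.gap ≤ 12 + 4 * (30 + 50 * I.maxDeg) → Q s') :
    Wp I w firstPhase Q s := by
  have hn := he.n_lt
  have hpos := he.pos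
  refine .seq (.numVertices (.seq (.const (.seq (.const (.seq (.const (.seq (.const (.seq
    (.const (.seq (.const (.seq (.const (.loop (fun j s' =>
      Paced I (mate I w') D j 0 4 10 (30 + 50 * I.maxDeg) j s' ∧
      s'.reg regDelta = BitVec.ofNat W ((Finset.range j).sup I.degree) ∧
      (∀ r, 40 ≤ r → s'.reg r = s.reg r) ∧ (∀ a, 2 ≤ a → s'.mem a = s.mem a) ∧
      ownCells I W ∪ s'.used = ownCells I W) I.n ?_ ?_ ?_))))))))))))))))
  · refine ⟨⟨⟨?_, ?_, ?_, ?_, ?_, ?_, ?_, ?_, ?_, ?_⟩, ?_, ?_, ?_⟩, ?_, ?_, ?_, ?_⟩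
    · simp
    · simp
    · simp
    · simp [sources]
    · simp
    · simp
    · simp [sources]
    · simp [hout]
    · simp [hout]
    · simp
    · simp
    · simp
    · simp [hgap]
    · simp
    · intro r hr
      have : r ≠ 0 := by omega
      have : r ≠ 1 := by omega
      have : r ≠ 2 := by omega
      have : r ≠ 3 := by omega
      have : r ≠ 4 := by omega
      have : r ≠ 5 := by omega
      have : r ≠ 6 := by omega
      have : r ≠ 7 := by omega
      simp [*]
    · simp
    · simp [hused]
  · rintro j hj s1 ⟨⟨hc, hctr, hbud, hg⟩, hdel, hr, hm, hu⟩
    have hjs := div_le_length_sources (k := 4) (fun h x => he.mate_ne (w := w) h (x := x)) hj.le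
      (by omega)
    have hjs' := div_le_length_sources (k := 4) (v := j + 1)
      (fun h x => he.mate_ne (w := w) h (x := x)) (by omega) (by omega)
    refine ⟨?_, .seq (he.wp_processVertex (D := D) (v := j) (em := 0 + j / 4)
      (hc.congr (by simp) rfl rfl rfl (by rfl)) hj (by simpa using hdel)
      (fun s2 hc2 hdel2 hr2 hm2 hu2 hu2' hg2 => ?_) (by omega))⟩
    · simp only [Test.Holds, hc.vertex, hc.n]
      rw [toNat_ofNat_of_lt (by omega), toNat_ofNat_of_lt (by omega)]
      exact hj
    · have hdm := I.degree_le_maxDeg j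
      refine he.wp_pulse (m := mate I w') (D := D) (em := 0) (j := j) (bud := 4) (v := j + 1)
        (g := 10) (cst := 30 + 50 * I.maxDeg) hc2 ?_ ?_ ?_ (by omega) (fun x _ => ?_) ?_ (by omega)
        hD (by omega) (by omega) fun s3 hp3 hr3 hm3 hu3 hu3' => ⟨hp3, ?_, ?_, ?_, ?_⟩
      · rw [hr2 _ (by omega), State.tick_reg, hctr]
      · rw [hr2 _ (by omega), State.tick_reg, hbud]
      · rw [State.tick_gap] at hg2
        rw [add_mul]
        omega
      · exact mate_lt I w' hpos x
      · omega
      · rw [State.tick_reg, hr3 _ (by omega) (by omega) (by omega), hdel2]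
      · intro r h40
        rw [State.tick_reg, hr3 _ (by omega) (by omega) (by omega), hr2 _ (by omega),
          State.tick_reg, hr r h40]
      · intro a ha
        rw [State.tick_mem, hm3, hm2 a ha, State.tick_mem, hm a ha]
      · rw [State.tick_used, hu3, hu2, State.tick_used, hu]
  · rintro s1 ⟨⟨hc, hctr, hbud, hg⟩, hdel, hr, hm, hu⟩
    refine ⟨?_, h _ ((zero_add (I.n / 4) ▸ hc).congr (by simp) rfl rfl rfl (by rfl)) ?_
      (by simpa using hr) (by simpa using hm) (by simpa using hu) ?_⟩
    · simp [Test.Holds, hc.vertex, hc.n]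
    · rw [State.tick_reg, State.tick_reg, hdel, I.sup_degree hpos]
    · have : I.n % 4 * (30 + 50 * I.maxDeg) ≤ 4 * (30 + 50 * I.maxDeg) :=
        Nat.mul_le_mul_right _ (Nat.mod_lt _ (by omega)).le
      rw [State.tick_gap, State.tick_gap]
      omega

/-! ### Simulation of a program, one instruction at a time -/

/-- The register that stands for register `r` of a simulated program. The parameter `δ`
distinguishes two simulated programs, whose registers are kept apart. -/
def simReg (δ r : ℕ) : ℕ := 2 * r + 100 + δ

/-- The array that stands for array `a` of a simulated program. -/
def simArr (δ a : ℕ) : ℕ := 2 * a + 10 + δ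

@[simp] theorem simReg_inj {δ r r' : ℕ} : simReg δ r = simReg δ r' ↔ r = r' := by
  unfold simReg; omega

@[simp] theorem simArr_inj {δ a a' : ℕ} : simArr δ a = simArr δ a' ↔ a = a' := by
  unfold simArr; omega

theorem le_simReg (δ r : ℕ) : 100 ≤ simReg δ r := by unfold simReg; omega

theorem le_simArr (δ a : ℕ) : 10 ≤ simArr δ a := by unfold simArr; omega

/-- The memory cell that stands for a cell of a simulated program. -/
def simCell (δ : ℕ) (x : ℕ × BitVec W) : ℕ × BitVec W := (simArr δ x.1, x.2)

theorem simCell_injective (δ : ℕ) : Function.Injective (simCell (W := W) δ) := by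
  rintro ⟨a, x⟩ ⟨b, y⟩ h
  simpa [simCell] using h

theorem simCell_image_some (δ a : ℕ) (x : BitVec W) :
    simCell δ '' {y | some (a, x) = some y} = {(simArr δ a, x)} := by
  ext z
  simp [simCell, eq_comm]

/-- Appends the edge given by registers `u` and `v` to the list of tree edges, unless it joins one of
its ends to its mate. -/
def recordEdge (u v : ℕ) : Cmd :=
  .basic (.load 20 arrMate u) ⨾ .ite (.eq 20 v) .skip
    (.basic (.load 20 arrMate v) ⨾ .ite (.eq 20 u) .skip
      (.basic (.store arrU regCntT u) ⨾ .basic (.store arrV regCntT v) ⨾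
        .basic (.op .add regCntT regCntT regOne)))

/-- Simulates instruction number `k` of a program of length `L`; the program counter of the
simulated program is kept in `regPc`. If `tie` holds, ties between weights are broken, and the edges
output are recorded; otherwise they are ignored. -/
def simInstr (tie : Bool) (δ L k : ℕ) : Instr → Cmd
  | .const d x => .basic (.const (simReg δ d) x) ⨾ .basic (.const regPc (k + 1))
  | .op o d a b =>
      .basic (.op o (simReg δ d) (simReg δ a) (simReg δ b)) ⨾ .basic (.const regPc (k + 1))
  | .load d arr a =>
      .basic (.load (simReg δ d) (simArr δ arr) (simReg δ a)) ⨾ .basic (.const regPc (k + 1))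
  | .store arr a b =>
      .basic (.store (simArr δ arr) (simReg δ a) (simReg δ b)) ⨾ .basic (.const regPc (k + 1))
  | .jumpLt a b l => .ite (.lt (simReg δ a) (simReg δ b)) (.basic (.const regPc (min l L)))
      (.basic (.const regPc (k + 1)))
  | .jumpEq a b l => .ite (.eq (simReg δ a) (simReg δ b)) (.basic (.const regPc (min l L)))
      (.basic (.const regPc (k + 1)))
  | .numVertices d => .basic (.numVertices (simReg δ d)) ⨾ .basic (.const regPc (k + 1))
  | .degree d v => .basic (.degree (simReg δ d) (simReg δ v)) ⨾ .basic (.const regPc (k + 1))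
  | .neighbor d v i =>
      .basic (.neighbor (simReg δ d) (simReg δ v) (simReg δ i)) ⨾ .basic (.const regPc (k + 1))
  | .jumpWeightLt u i v j l =>
      match tie with
      | false => .ite (.weightLt (simReg δ u) (simReg δ i) (simReg δ v) (simReg δ j))
          (.basic (.const regPc (min l L))) (.basic (.const regPc (k + 1)))
      | true => compareEntries (simReg δ u) (simReg δ i) (simReg δ v) (simReg δ j) ⨾
          .ite (.eq regFlag regOne) (.basic (.const regPc (min l L)))
            (.basic (.const regPc (k + 1)))
  | .emit u v =>
      match tie with
      | false => .basic (.const regPc (k + 1))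
      | true => recordEdge (simReg δ u) (simReg δ v) ⨾ .basic (.const regPc (k + 1))

/-- Simulates the instruction that `regPc` points to, where `k` is the number of the first
instruction of the list. -/
def dispatch (tie : Bool) (δ L : ℕ) : ℕ → List Instr → Cmd
  | _, [] => .skip
  | k, i :: P => .basic (.const 30 k) ⨾
      .ite (.eq regPc 30) (simInstr tie δ L k i) (dispatch tie δ L (k + 1) P)

/-- Simulates a program; every simulated instruction is followed by a `pulse`. -/
def simulate (tie : Bool) (δ : ℕ) (P : Program) : Cmd :=
  .basic (.const regPc 0) ⨾ .basic (.const regLen P.length) ⨾ .basic (.const regCtr 0) ⨾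
  .loop (.lt regPc regLen) (dispatch tie δ P.length 0 P ⨾ pulse)

/-- The registers and the memory of the simulated program are those of `c`. -/
structure Matches (δ : ℕ) (s : State W) (c : Config W) : Prop where
  reg : ∀ r, s.reg (simReg δ r) = c.reg r
  mem : ∀ a, s.mem (simArr δ a) = c.mem a

/-- The edge joins a vertex of the graph to its mate. -/
def IsMateEdge (I : Input) (m : ℕ → ℕ) (e : Sym2 ℕ) : Prop := ∃ x < I.n, e = mateEdge m x

open Classical in
/-- The edges of the list `es` that do not join a vertex to its mate have been recorded. -/
def Recorded (I : Input) (m : ℕ → ℕ) (es : List (Sym2 ℕ)) (s : State W) : Prop :=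
  ∃ M : List (ℕ × ℕ), M.map (fun x => s(x.1, x.2)) = es.filter (fun e => ¬ IsMateEdge I m e) ∧
    s.reg regCntT = BitVec.ofNat W M.length ∧ (∀ x ∈ M, x.1 < I.n ∧ x.2 < I.n) ∧
    ∀ k (h : k < M.length), s.mem arrU (BitVec.ofNat W k) = BitVec.ofNat W M[k].1 ∧
      s.mem arrV (BitVec.ofNat W k) = BitVec.ofNat W M[k].2

theorem Recorded.congr {m : ℕ → ℕ} {es : List (Sym2 ℕ)} {s s' : State W} (h : Recorded I m es s)
    (hr : s'.reg regCntT = s.reg regCntT) (h2 : s'.mem arrU = s.mem arrU)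
    (h3 : s'.mem arrV = s.mem arrV) : Recorded I m es s' := by
  unfold Recorded
  rw [hr, h2, h3]
  exact h

/-- What the simulation of program `δ` leaves alone. -/
structure SimFrame (δ : ℕ) (s s' : State W) : Prop where
  reg_own : ∀ r < 20, r ≠ regPc → r ≠ regCntT → s'.reg r = s.reg r
  reg_other : ∀ r, 100 ≤ r → (∀ x, r ≠ simReg δ x) → s'.reg r = s.reg r
  mate : s'.mem arrMate = s.mem arrMate
  buf : s'.mem arrBuf = s.mem arrBuf
  mem_other : ∀ a, 10 ≤ a → (∀ x, a ≠ simArr δ x) → s'.mem a = s.mem a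
  out : s'.out = s.out
  used : s.used ⊆ s'.used

theorem SimFrame.trans_left {δ : ℕ} {s s₁ s' : State W} (h : SameData s s₁)
    (h' : SimFrame δ s₁ s') : SimFrame δ s s' where
  reg_own r h1 h2 h3 := by rw [h'.reg_own r h1 h2 h3, h.reg r (by omega)]
  reg_other r h1 h2 := by rw [h'.reg_other r h1 h2, h.reg r (by omega)]
  mate := by rw [h'.mate, h.mem]
  buf := by rw [h'.buf, h.mem]
  mem_other a h1 h2 := by rw [h'.mem_other a h1 h2, h.mem]
  out := by rw [h'.out, h.out]
  used := by rw [← h.used]; exact h'.used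

/-- The effect of simulating the instruction `i` from configuration `c`, with edge weights `wt`;
`es` are the edges that had been output before. -/
structure SimStep (tie : Bool) (δ L : ℕ) (I : Input) (m : ℕ → ℕ) (wt : I.Weight)
    (es : List (Sym2 ℕ)) (c : Config W) (i : Instr) (cost : ℕ) (s s' : State W) : Prop where
  config : Matches δ s' (exec I wt c i)
  pc : s'.reg regPc = BitVec.ofNat W (min (exec I wt c i).pc L)
  frame : SimFrame δ s s'
  used : ownCells I W ∪ s'.used =
    ownCells I W ∪ s.used ∪ simCell δ '' {x | i.accesses c.reg = some x}
  recorded : tie = true → Recorded I m (es ++ (i.emits c.reg).toList) s'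
  gap : s'.gap ≤ s.gap + cost

theorem SimStep.trans_left {tie : Bool} {δ L : ℕ} {m : ℕ → ℕ} {wt : I.Weight}
    {es : List (Sym2 ℕ)} {c : Config W} {i : Instr} {cost k : ℕ} {s s₁ s' : State W}
    (h : SameData s s₁) (hg : s₁.gap ≤ s.gap + k)
    (h' : SimStep tie δ L I m wt es c i cost s₁ s') :
    SimStep tie δ L I m wt es c i (cost + k) s s' where
  config := h'.config
  pc := h'.pc
  frame := h'.frame.trans_left h
  used := by rw [h'.used, h.used]
  recorded := h'.recorded
  gap := by have := h'.gap; omega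

theorem Matches.congr {δ : ℕ} {s s' : State W} {c : Config W} (h : Matches δ s c)
    (hs : SameData s s') : Matches δ s' c where
  reg r := by rw [hs.reg _ (by have := le_simReg δ r; omega), h.reg]
  mem a := by rw [hs.mem, h.mem]

theorem isMateEdge_iff {m : ℕ → ℕ} {a b : ℕ} (ha : a < I.n) (hb : b < I.n) :
    IsMateEdge I m s(a, b) ↔ m a = b ∨ m b = a := by
  constructor
  · rintro ⟨x, hx, h⟩
    rw [mateEdge, Sym2.eq_iff] at h
    rcases h with ⟨rfl, rfl⟩ | ⟨rfl, rfl⟩ <;> simp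
  · rintro (h | h)
    · exact ⟨a, ha, by rw [mateEdge, h]⟩
    · exact ⟨b, hb, by rw [mateEdge, h, Sym2.eq_swap]⟩

theorem Env.wp_recordEdge (he : Env I w w' W) {Q : State W → Prop} {s : State W} {m : ℕ → ℕ}
    {D em u v a b δ : ℕ} {es : List (Sym2 ℕ)} (hc : Core I m D I.n em s)
    (hm : ∀ x < I.n, m x < I.n) (ha : a < I.n) (hb : b < I.n)
    (hu : s.reg (simReg δ u) = BitVec.ofNat W a) (hv : s.reg (simReg δ v) = BitVec.ofNat W b)
    (hes : es.length < I.n) (hrec : Recorded I m es s)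
    (h : ∀ s', Recorded I m (es ++ [s(a, b)]) s' →
      (∀ r, r ≠ regCntT → r ≠ 20 → s'.reg r = s.reg r) →
      (∀ x, x ≠ arrU → x ≠ arrV → s'.mem x = s.mem x) → s'.out = s.out →
      ownCells I W ∪ s'.used = ownCells I W ∪ s.used → s.used ⊆ s'.used →
      s'.gap ≤ s.gap + 20 → Q s') :
    Wp I w (recordEdge (simReg δ u) (simReg δ v)) Q s := by
  have hn := he.n_lt
  have hma := hm a ha
  have hmb := hm b hb
  have hta : (BitVec.ofNat W a).toNat = a := toNat_ofNat_of_lt (by omega)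
  have htb : (BitVec.ofNat W b).toNat = b := toNat_ofNat_of_lt (by omega)
  have hu20 : simReg δ u ≠ 20 := by have := le_simReg δ u; omega
  have hv20 : simReg δ v ≠ 20 := by have := le_simReg δ v; omega
  obtain ⟨M, hM, hcnt, hMn, hmem⟩ := hrec
  have hMl : M.length < I.n := by
    rw [← List.length_map (fun x : ℕ × ℕ => s(x.1, x.2)), hM]
    exact (List.length_filter_le _ _).trans_lt hes
  have hskip : m a = b ∨ m b = a → ∀ s' : State W, s'.reg 9 = s.reg 9 → s'.mem = s.mem →
      Recorded I m (es ++ [s(a, b)]) s' := by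
    intro hab s' hr hm
    have hF : IsMateEdge I m s(a, b) := (isMateEdge_iff ha hb).2 hab
    refine ⟨M, ?_, by rw [hr, hcnt], hMn, by rw [hm]; exact hmem⟩
    rw [List.filter_append, hM]
    simp [hF]
  refine .seq (.load (.ite (fun h1 => .skip ?_) fun h1 => .seq (.load (.ite
    (fun h2 => .skip ?_) fun h2 => .seq (.store (.seq (.store (.op ?_))))))))
  all_goals
    simp only [Test.Holds, ne_eq, hu20, hv20, not_false_eq_true, Function.update_of_ne,
      Function.update_self, hu, hv, State.tick_reg, State.tick_mem, hc.mate a ha, hc.mate b hb]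
      at h1
    rw [ofNat_inj_of_lt (by omega) (by omega)] at h1
  · refine h _ (hskip (.inl h1) _ (by simp) rfl) (fun r _ hr => by simp [hr]) (fun _ _ _ => rfl)
      rfl ?_ (fun y hy => .inr hy) (by simp)
    simp only [State.tick_used, hu]
    rw [ownCells_union_insert (by omega) (by omega)]
  all_goals
    simp only [Test.Holds, ne_eq, hu20, hv20, not_false_eq_true, Function.update_of_ne,
      Function.update_self, hu, hv, State.tick_reg, State.tick_mem, hc.mate a ha, hc.mate b hb]
      at h2
    rw [ofNat_inj_of_lt (by omega) (by omega)] at h2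
  · refine h _ (hskip (.inr h2) _ (by simp) rfl) (fun r _ hr => by simp [hr]) (fun _ _ _ => rfl)
      rfl ?_ (fun y hy => .inr (.inr hy)) (by simp)
    simp only [State.tick_used, hu, hv, ne_eq, hv20, not_false_eq_true, Function.update_of_ne,
      State.tick_reg]
    rw [ownCells_union_insert (by omega) (by omega), ownCells_union_insert (by omega) (by omega)]
  · refine h _ ⟨M ++ [(a, b)], ?_, ?_, ?_, ?_⟩ (fun r h1 h2 => by simp [h1, h2])
      (fun x h1 h2 => by simp [h1, h2]) rfl ?_ (fun y hy => .inr (.inr (.inr (.inr hy))))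
      (by simp)
    · have hF : ¬ IsMateEdge I m s(a, b) := by rw [isMateEdge_iff ha hb]; tauto
      rw [List.filter_append, List.map_append, hM]
      simp [hF]
    · simp [WordOp.eval, hcnt, hc.one, BitVec.ofNat_add]
    · intro x hx
      rcases List.mem_append.1 hx with hx | hx
      · exact hMn x hx
      · obtain rfl := List.mem_singleton.1 hx
        exact ⟨ha, hb⟩
    · intro k hk
      simp only [List.length_append, List.length_singleton] at hk
      rcases Nat.lt_succ_iff_lt_or_eq.1 hk with hk | rfl
      · have hne : BitVec.ofNat W k ≠ BitVec.ofNat W M.length := by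
          rw [ne_eq, ofNat_inj_of_lt (by omega) (by omega)]
          omega
        have := hmem k hk
        simp [hcnt, hne, this, List.getElem_append_left hk]
      · simp [hcnt, hu, hv, hu20, hv20]
    · simp only [State.tick_used, hu, hv, ne_eq, hv20, not_false_eq_true, Function.update_of_ne,
        State.tick_reg, Nat.reduceEqDiff, hcnt]
      have : (BitVec.ofNat W M.length).toNat = M.length := toNat_ofNat_of_lt (by omega)
      rw [ownCells_union_insert (by omega) (by omega), ownCells_union_insert (by omega) (by omega),
        ownCells_union_insert (by omega) (by omega), ownCells_union_insert (by omega) (by omega)]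

theorem Env.wp_simInstr (he : Env I w w' W) {Q : State W → Prop} {s : State W} {m : ℕ → ℕ}
    {tie : Bool} {D em δ L : ℕ} {es : List (Sym2 ℕ)} {c : Config W} {i : Instr}
    (hc : Core I m D I.n em s) (hm : ∀ x < I.n, m x < I.n) (hmat : Matches δ s c)
    (hpc : c.pc < L)
    (hrec : tie = true → Recorded I m es s ∧ ∀ e, i.emits c.reg = some e →
      es.length < I.n ∧ ∃ a < I.n, ∃ b < I.n, e = s(a, b))
    (h : ∀ s', SimStep tie δ L I m (if tie then w' else w) es c i 60 s s' → Q s') :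
    Wp I w (simInstr tie δ L c.pc i) Q s := by
  have hpc' : min (c.pc + 1) L = c.pc + 1 := by omega
  have hr8 : ∀ r, simReg δ r ≠ 8 := fun r => by have := le_simReg δ r; omega
  have hr9 : ∀ r, 9 ≠ simReg δ r := fun r => by have := le_simReg δ r; omega
  have hr20 : ∀ r, r < 20 → ∀ x, r ≠ simReg δ x := fun r _ x => by
    have := le_simReg δ x; omega
  have ha10 : ∀ a, a < 10 → ∀ x, a ≠ simArr δ x := fun r _ x => by
    have := le_simArr δ x; omega
  -- the effect of an instruction that writes a register
  have hset : ∀ d x s', (∀ wt, exec I wt c i = c.setReg d x) → i.emits c.reg = none →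
      s'.reg = Function.update (Function.update s.reg (simReg δ d) x) 8
        (BitVec.ofNat W (c.pc + 1)) → s'.mem = s.mem → s'.out = s.out →
      s'.used = s.used ∪ simCell δ '' {x | i.accesses c.reg = some x} →
      s'.gap ≤ s.gap + 60 → SimStep tie δ L I m (if tie then w' else w) es c i 60 s s' := by
    intro d x s' hex hem hr hmem hout hused hgap
    refine ⟨⟨fun r => ?_, fun a => ?_⟩, ?_, ⟨fun r h1 h2 h3 => ?_, fun r h1 h2 => ?_, ?_, ?_, ?_,
      hout, ?_⟩, ?_, fun ht => ?_, hgap⟩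
    · rw [hr, hex]
      simp [Config.setReg, Function.update_apply, hr8, hmat.reg]
    · rw [hmem, hex]
      exact hmat.mem a
    · rw [hr, hex]
      simp [Config.setReg, hpc']
    · rw [hr]
      simp [h2, hr20 r h1]
    · have : r ≠ 8 := by omega
      rw [hr]
      simp [h2, this]
    · rw [hmem]
    · rw [hmem]
    · rw [hmem]; intros; rfl
    · rw [hused]; exact Set.subset_union_left
    · rw [hused, Set.union_assoc]
    · rw [hem]
      refine (hrec ht).1.congr ?_ ?_ ?_ |> fun h => by simpa using h
      · rw [hr]; simp [hr9]
      · rw [hmem]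
      · rw [hmem]
  -- the effect of a jump, and of an output that is ignored
  have hjump : ∀ k s₁ s', SameData s s₁ → s₁.gap ≤ s.gap + 50 →
      exec I (if tie then w' else w) c i = { c with pc := k } → (i.emits c.reg = none ∨ tie = false)
      → i.accesses c.reg = none →
      s'.reg = Function.update s₁.reg 8 (BitVec.ofNat W (min k L)) → s'.mem = s₁.mem →
      s'.out = s₁.out → s'.used = s₁.used → s'.gap ≤ s₁.gap + 10 →
      SimStep tie δ L I m (if tie then w' else w) es c i 60 s s' := by
    intro k s₁ s' hs₁ hg₁ hex hem hacc hr hmem hout hused hgap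
    refine ⟨⟨fun r => ?_, fun a => ?_⟩, ?_, ⟨fun r h1 h2 h3 => ?_, fun r h1 h2 => ?_, ?_, ?_, ?_,
      ?_, ?_⟩, ?_, fun ht => ?_, by omega⟩
    · rw [hr, hex, Function.update_of_ne (hr8 r), hs₁.reg _ (by have := le_simReg δ r; omega),
        hmat.reg]
    · rw [hmem, hex, hs₁.mem]
      exact hmat.mem a
    · rw [hr, hex, Function.update_self]
    · rw [hr, Function.update_of_ne h2, hs₁.reg _ (by omega)]
    · rw [hr, Function.update_of_ne (by omega), hs₁.reg _ (by omega)]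
    · rw [hmem, hs₁.mem]
    · rw [hmem, hs₁.mem]
    · rw [hmem, hs₁.mem]; intros; rfl
    · rw [hout, hs₁.out]
    · rw [hused, hs₁.used]
    · rw [hused, hs₁.used, hacc]; simp
    · rcases hem with hem | hem
      · rw [hem]
        refine (hrec ht).1.congr ?_ ?_ ?_ |> fun h => by simpa using h
        · rw [hr, Function.update_of_ne (by omega), hs₁.reg _ (by omega)]
        · rw [hmem, hs₁.mem]
        · rw [hmem, hs₁.mem]
      · simp [hem] at ht
  have hsame : SameData s s.tick := ⟨fun _ _ => rfl, rfl, rfl, rfl⟩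
  cases i with
  | const d x =>
    exact .seq (.const (.const (h _ (hset d _ _ (fun _ => rfl) rfl rfl rfl rfl
      (by simp [Instr.accesses]) (by simp)))))
  | op o d a b =>
    refine .seq (.op (.const (h _ (hset d _ _ (fun _ => rfl) rfl ?_ rfl rfl
      (by simp [Instr.accesses]) (by simp)))))
    simp [hmat.reg]
  | load d arr a =>
    refine .seq (.load (.const (h _ (hset d _ _ (fun _ => rfl) rfl ?_ rfl rfl ?_ (by simp)))))
    · simp [hmat.reg, hmat.mem]
    · simp only [Instr.accesses, simCell_image_some, hmat.reg, Set.union_singleton]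
  | numVertices d =>
    exact .seq (.numVertices (.const (h _ (hset d _ _ (fun _ => rfl) rfl rfl rfl rfl
      (by simp [Instr.accesses]) (by simp)))))
  | degree d v =>
    refine .seq (.degree (.const (h _ (hset d _ _ (fun _ => rfl) rfl ?_ rfl rfl
      (by simp [Instr.accesses]) (by simp)))))
    simp [hmat.reg]
  | neighbor d v i =>
    refine .seq (.neighbor (.const (h _ (hset d _ _ (fun _ => rfl) rfl ?_ rfl rfl
      (by simp [Instr.accesses]) (by simp)))))
    simp [hmat.reg]
  | store arr a b =>
    refine .seq (.store (.const (h _ ⟨⟨fun r => ?_, fun x => ?_⟩, ?_, ⟨fun r h1 h2 h3 => ?_,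
      fun r h1 h2 => ?_, ?_, ?_, fun x h1 h2 => ?_, rfl, ?_⟩, ?_, fun ht => ?_, by simp⟩)))
    · simp [hr8, exec, Config.setMem, hmat.reg]
    · simp [exec, Config.setMem, hmat.reg, hmat.mem, Function.update_apply]
    · simp [exec, Config.setMem, hpc']
    · simp [h2]
    · have : r ≠ 8 := by omega
      simp [this]
    · simp [ha10 0]
    · simp [ha10 1]
    · simp [h2]
    · exact fun y hy => .inr hy
    · simp only [Instr.accesses, simCell_image_some, hmat.reg, Set.union_singleton,
        Set.union_insert]
    · refine (hrec ht).1.congr ?_ ?_ ?_ |> fun h => by simpa [Instr.emits] using h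
      · simp
      · simp [ha10 2]
      · simp [ha10 3]
  | jumpLt a b l =>
    refine .ite (fun h1 => .const (h _ (hjump l s.tick _ hsame (by simp) ?_ (.inl rfl) rfl rfl rfl
      rfl rfl (by simp)))) fun h1 => .const (h _ (hjump (c.pc + 1) s.tick _ hsame (by simp) ?_
      (.inl rfl) rfl (by rw [hpc']; rfl) rfl rfl rfl (by simp)))
    all_goals
      simp only [Test.Holds, hmat.reg] at h1
      simp [exec, Config.branch, h1]
  | jumpEq a b l =>
    refine .ite (fun h1 => .const (h _ (hjump l s.tick _ hsame (by simp) ?_ (.inl rfl) rfl rfl rfl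
      rfl rfl (by simp)))) fun h1 => .const (h _ (hjump (c.pc + 1) s.tick _ hsame (by simp) ?_
      (.inl rfl) rfl (by rw [hpc']; rfl) rfl rfl rfl (by simp)))
    all_goals
      simp only [Test.Holds, hmat.reg] at h1
      simp [exec, Config.branch, h1]
  | jumpWeightLt u i v j l =>
    cases tie with
    | false =>
      refine .ite (fun h1 => .const (h _ (hjump l s.tick _ hsame (by simp) ?_ (.inl rfl) rfl rfl
        rfl rfl rfl (by simp)))) fun h1 => .const (h _ (hjump (c.pc + 1) s.tick _ hsame (by simp)
        ?_ (.inl rfl) rfl (by rw [hpc']; rfl) rfl rfl rfl (by simp)))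
      all_goals
        simp only [Test.Holds, hmat.reg] at h1
        simp [exec, Config.branch, h1]
    | true =>
      have h40 : ∀ r, simReg δ r < 20 ∨ 40 ≤ simReg δ r := fun r => by
        have := le_simReg δ r; omega
      refine .seq (he.wp_compareEntries (h40 _) (h40 _) (h40 _) (h40 _) fun s1 hs1 hg1 hf =>
        .ite (fun h1 => .const (h _ (hjump l s1.tick _ ?_ ?_ ?_ (.inl rfl) rfl rfl
        rfl rfl rfl (by simp)))) fun h1 => .const (h _ (hjump (c.pc + 1) s1.tick _ ?_ ?_
        ?_ (.inl rfl) rfl (by rw [hpc']; rfl) rfl rfl rfl (by simp))))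
      all_goals try exact ⟨hs1.reg, hs1.mem, hs1.out, hs1.used⟩
      all_goals try (rw [State.tick_gap]; omega)
      all_goals
        simp only [Test.Holds] at h1
        rw [hs1.reg 1 (by omega), hc.one, hf] at h1
        simp only [hmat.reg] at h1
        simp [exec, Config.branch, h1]
  | emit u v =>
    cases tie with
    | false =>
      exact .const (h _ (hjump (c.pc + 1) s _ ⟨fun _ _ => rfl, rfl, rfl, rfl⟩ (by simp) rfl
        (.inr rfl) rfl (by rw [hpc']) rfl rfl rfl (by simp)))
    | true =>
      obtain ⟨hrec, hem⟩ := hrec rfl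
      obtain ⟨hes, a, ha, b, hb, hab⟩ := hem _ rfl
      have huv : (c.reg u).toNat < I.n ∧ (c.reg v).toNat < I.n := by
        rw [Sym2.eq_iff] at hab; omega
      refine .seq (he.wp_recordEdge hc hm huv.1 huv.2 (by simp [hmat.reg]) (by simp [hmat.reg])
        hes hrec fun s1 hrec1 hr1 hm1 ho1 hu1 hu1' hg1 => .const (h _ ⟨⟨fun r => ?_, fun x => ?_⟩,
        ?_, ⟨fun r h1 h2 h3 => ?_, fun r h1 h2 => ?_, ?_, ?_, fun x h1 h2 => ?_, ho1, hu1'⟩, ?_,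
        fun ht => ?_, by simp; omega⟩))
      · have := le_simReg δ r
        simp only [ne_eq, hr8, not_false_eq_true, Function.update_of_ne]
        rw [hr1 _ (by omega) (by omega)]
        exact hmat.reg r
      · have := le_simArr δ x
        simp only
        rw [hm1 _ (by omega) (by omega)]
        exact hmat.mem x
      · simp [exec, Config.next, hpc']
      · simp only [ne_eq, h2, not_false_eq_true, Function.update_of_ne]
        exact hr1 _ h3 (by omega)
      · have : r ≠ 8 := by omega
        simp only [ne_eq, this, not_false_eq_true, Function.update_of_ne]
        exact hr1 _ (by omega) (by omega)
      · exact hm1 _ (by omega) (by omega)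
      · exact hm1 _ (by omega) (by omega)
      · exact hm1 _ (by omega) (by omega)
      · simp [hu1, Instr.accesses]
      · exact hrec1.congr (by simp) rfl rfl

theorem SimStep.trans_right {tie : Bool} {δ L : ℕ} {m : ℕ → ℕ} {wt : I.Weight}
    {es : List (Sym2 ℕ)} {c : Config W} {i : Instr} {cost : ℕ} {s s' : State W}
    (h : SimStep tie δ L I m wt es c i cost s s') :
    SimStep tie δ L I m wt es c i (cost + 1) s s'.tick where
  config := ⟨h.config.reg, h.config.mem⟩
  pc := h.pc
  frame := ⟨h.frame.reg_own, h.frame.reg_other, h.frame.mate, h.frame.buf, h.frame.mem_other,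
    h.frame.out, h.frame.used⟩
  used := h.used
  recorded := h.recorded
  gap := by have := h.gap; rw [State.tick_gap]; omega

theorem Env.wp_dispatch (he : Env I w w' W) {m : ℕ → ℕ} {tie : Bool} {D em δ L : ℕ}
    {es : List (Sym2 ℕ)} {c : Config W} {i : Instr} (hm : ∀ x < I.n, m x < I.n) (hL : L < 2 ^ W)
    (P : List Instr) : ∀ {k : ℕ} {Q : State W → Prop} {s : State W},
    Core I m D I.n em s → Matches δ s c → s.reg regPc = BitVec.ofNat W c.pc →
    k + P.length ≤ L → k ≤ c.pc → P[c.pc - k]? = some i →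
    (tie = true → Recorded I m es s ∧ ∀ e, i.emits c.reg = some e →
      es.length < I.n ∧ ∃ a < I.n, ∃ b < I.n, e = s(a, b)) →
    (∀ s', SimStep tie δ L I m (if tie then w' else w) es c i (62 + 3 * P.length) s s' → Q s') →
    Wp I w (dispatch tie δ L k P) Q s := by
  induction P with
  | nil => intro k Q s _ _ _ _ _ hi; simp at hi
  | cons i' P ih =>
    intro k Q s hc hmat hpc hk hkc hi hrec h
    rw [List.length_cons] at hk h
    have hpcL : c.pc < L := by
      have := (List.getElem?_eq_some_iff.1 hi).1
      rw [List.length_cons] at this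
      omega
    let s₁ : State W :=
      { s with reg := Function.update s.reg 30 (BitVec.ofNat W k), gap := s.gap + 1 }
    have hs : SameData s s₁.tick :=
      ⟨fun r hr => by have : r ≠ 30 := by omega
                      simp [s₁, this], rfl, rfl, rfl⟩
    have hg : s₁.tick.gap ≤ s.gap + 2 := by simp [s₁]
    have hc₁ : Core I m D I.n em s₁.tick :=
      hc.congr (fun r hr => hs.reg r (by omega)) rfl rfl rfl (by rfl)
    have hrec₁ : tie = true → Recorded I m es s₁.tick ∧ ∀ e, i.emits c.reg = some e →
        es.length < I.n ∧ ∃ a < I.n, ∃ b < I.n, e = s(a, b) := fun ht =>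
      ⟨(hrec ht).1.congr (hs.reg _ (by omega)) rfl rfl, (hrec ht).2⟩
    have hpc₁ : s₁.tick.reg 8 = BitVec.ofNat W c.pc := by rw [hs.reg _ (by omega), hpc]
    have h30 : s₁.tick.reg 30 = BitVec.ofNat W k := by simp [s₁]
    refine .seq (.const (.ite (fun ht => ?_) fun ht => ?_))
    · change s₁.tick.reg 8 = s₁.tick.reg 30 at ht
      rw [hpc₁, h30, ofNat_inj_of_lt (by omega) (by omega)] at ht
      subst ht
      rw [Nat.sub_self, List.getElem?_cons_zero, Option.some_inj] at hi
      subst hi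
      refine he.wp_simInstr (s := s₁.tick) hc₁ hm (hmat.congr hs) hpcL hrec₁ fun s' hs' => h s' ?_
      have := hs'.trans_left hs hg
      exact { this with gap := by have := this.gap; omega }
    · change ¬ s₁.tick.reg 8 = s₁.tick.reg 30 at ht
      rw [hpc₁, h30, ofNat_inj_of_lt (by omega) (by omega)] at ht
      have hi' : P[c.pc - (k + 1)]? = some i := by
        rw [show c.pc - k = c.pc - (k + 1) + 1 by omega, List.getElem?_cons_succ] at hi
        exact hi
      refine ih (s := s₁.tick) hc₁ (hmat.congr hs) hpc₁ (by omega) (by omega) hi' hrec₁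
        fun s' hs' => h _ ?_
      have := (hs'.trans_left hs hg).trans_right
      exact { this with gap := by have := this.gap; omega }

/-- What a phase that simulates program `δ` and outputs edges leaves alone. -/
structure PhaseFrame (δ : ℕ) (s s' : State W) : Prop where
  reg_own : ∀ r < 20, r ≠ regEm → r ≠ regCtr → r ≠ regPc → r ≠ regCntT → r ≠ regLen →
    s'.reg r = s.reg r
  reg_other : ∀ r, 100 ≤ r → (∀ x, r ≠ simReg δ x) → s'.reg r = s.reg r
  mem_other : ∀ a, 10 ≤ a → (∀ x, a ≠ simArr δ x) → s'.mem a = s.mem a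
  used : s.used ⊆ s'.used

/-- A program that halts after exactly `N` steps is simulated, while an edge is output after every
`bud` simulated steps. -/
theorem Env.wp_simulate (he : Env I w w' W) {Q : State W → Prop} {s : State W} {m : ℕ → ℕ}
    {tie : Bool} {D em δ bud g N : ℕ} {P : Program} {c : Config W} {wt : I.Weight}
    (hwt : wt = if tie then w' else w) (hm : ∀ x < I.n, m x < I.n) (hL : P.length < 2 ^ W)
    (hc : Core I m D I.n em s) (hmat : Matches δ s c) (hpc : c.pc = 0)
    (hN : Halted P (run P I wt c N)) (hlt : ∀ j < N, ¬ Halted P (run P I wt c j))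
    (hbud : s.reg regBud = BitVec.ofNat W bud) (hb0 : 0 < bud) (hbW : bud < 2 ^ W)
    (hg : 10 ≤ g) (hgap : s.gap + 3 ≤ g) (hD : g + bud * (100 + 3 * P.length) ≤ D)
    (hem : em + N / bud ≤ (sources m I.n).length)
    (hrec : tie = true → Recorded I m [] s ∧ ∀ j < N, ∀ e, emission P (run P I wt c j) = some e →
      (outputs P I wt c j).length < I.n ∧ ∃ a < I.n, ∃ b < I.n, e = s(a, b))
    (h : ∀ s', Core I m D I.n (em + N / bud) s' → Matches δ s' (run P I wt c N) →
      PhaseFrame δ s s' →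
      ownCells I W ∪ s'.used = ownCells I W ∪ s.used ∪ simCell δ '' usedCells P I wt c →
      (tie = true → Recorded I m (outputs P I wt c N) s') →
      s'.gap ≤ g + bud * (100 + 3 * P.length) + 2 → Q s') :
    Wp I w (simulate tie δ P) Q s := by
  refine .seq (.const (.seq (.const (.seq (.const (.loop (fun j s' =>
    Paced I m D I.n em bud g (100 + 3 * P.length) j s' ∧ Matches δ s' (run P I wt c j) ∧
    s'.reg regPc = BitVec.ofNat W (min (run P I wt c j).pc P.length) ∧
    s'.reg regLen = BitVec.ofNat W P.length ∧ PhaseFrame δ s s' ∧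
    (ownCells I W ∪ s'.used = ownCells I W ∪ s.used ∪
      simCell δ '' {x | ∃ i < j, accessed P (run P I wt c i) = some x}) ∧
    (tie = true → Recorded I m (outputs P I wt c j) s')) N ?_ ?_ ?_))))))
  · have hr : ∀ r, r ≠ 8 → r ≠ 18 → r ≠ 6 → ∀ x y z, Function.update (Function.update
        (Function.update s.reg 8 x) 18 y) 6 z r = s.reg r := by
      intro r h1 h2 h3 x y z
      simp [*]
    refine ⟨⟨?_, ?_, ?_, ?_⟩, ⟨fun r => ?_, hmat.mem⟩, ?_, ?_, ⟨fun r h1 h2 h3 h4 h5 h6 => ?_,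
      fun r h1 h2 => ?_, fun _ _ _ => rfl, subset_rfl⟩, ?_, fun ht => ?_⟩
    · rw [Nat.zero_div, add_zero]
      exact hc.congr (fun r hr' => hr r (by omega) (by omega) (by omega) _ _ _) rfl rfl rfl (by rfl)
    · simp
    · simp [hbud]
    · simp only [Nat.zero_mod, zero_mul]; omega
    · have := le_simReg δ r
      exact (hr _ (by omega) (by omega) (by omega) _ _ _).trans (hmat.reg r)
    · simp [run, hpc]
    · simp
    · exact hr _ (by omega) (by omega) (by omega) _ _ _
    · exact hr _ (by omega) (by omega) (by omega) _ _ _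
    · simp
    · exact (hrec ht).1.congr (by simp) rfl rfl
  · rintro j hj s1 ⟨⟨hc1, hctr, hbud1, hg1⟩, hmat1, hpc1, hlen1, hf1, hu1, hrec1⟩
    have hnh := hlt j hj
    simp only [Halted, not_le] at hnh
    have hi := List.getElem?_eq_getElem hnh
    generalize P[(run P I wt c j).pc] = i at hi
    rw [min_eq_left hnh.le] at hpc1
    have hstep : run P I wt c (j + 1) = exec I wt (run P I wt c j) i := by
      rw [run_succ, step, hi]
    have hemis : emission P (run P I wt c j) = i.emits (run P I wt c j).reg := by
      rw [emission_eq, hi]; rfl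
    have hacc : accessed P (run P I wt c j) = i.accesses (run P I wt c j).reg := by
      rw [accessed_eq, hi]; rfl
    refine ⟨?_, .seq (he.wp_dispatch (s := s1.tick) (D := D) (em := em + j / bud) (m := m)
      (c := run P I wt c j) (δ := δ) (es := outputs P I wt c j) hm hL P
      (hc1.congr (by simp) rfl rfl rfl (by rfl)) ⟨hmat1.reg, hmat1.mem⟩ hpc1 (by omega) (by omega)
      (by simpa using hi) ?_ fun s2 hs2 => ?_)⟩
    · simp only [Test.Holds, hpc1, hlen1]
      rw [toNat_ofNat_of_lt (by omega), toNat_ofNat_of_lt (by omega)]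
      exact hnh
    · intro ht
      exact ⟨hrec1 ht, fun e he => (hrec ht).2 j hj e (by rw [hemis, he])⟩
    · rw [← hwt] at hs2
      have hfr := hs2.frame
      have hdiv : (j + 1) / bud ≤ N / bud := Nat.div_le_div_right hj
      refine he.wp_pulse (m := m) (D := D) (em := em) (j := j) (bud := bud) (v := I.n) (g := g)
        (cst := 100 + 3 * P.length)
        (hc1.congr (fun r hr => hfr.reg_own r (by omega) (by omega) (by omega)) hfr.mate hfr.buf
          hfr.out hfr.used) ?_ ?_ ?_ le_rfl hm (by omega) hg hD hb0 hbW
        fun s3 hp3 hr3 hm3 hu3 hu3' => ⟨hp3, ⟨fun r => ?_, fun a => ?_⟩, ?_, ?_,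
          ⟨fun r h1 h2 h3 h4 h5 h6 => ?_, fun r h1 h2 => ?_, fun a h1 h2 => ?_, ?_⟩, ?_,
          fun ht => ?_⟩
      · rw [hfr.reg_own _ (by omega) (by omega) (by omega), State.tick_reg, hctr]
      · rw [hfr.reg_own _ (by omega) (by omega) (by omega), State.tick_reg, hbud1]
      · have := hs2.gap
        rw [State.tick_gap] at this
        rw [add_mul]
        omega
      · have := le_simReg δ r
        rw [State.tick_reg, hr3 _ (by omega) (by omega) (by omega), hstep, hs2.config.reg]
      · rw [State.tick_mem, hm3, hstep, hs2.config.mem]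
      · rw [State.tick_reg, hr3 _ (by omega) (by omega) (by omega), hstep, hs2.pc]
      · rw [State.tick_reg, hr3 _ (by omega) (by omega) (by omega),
          hfr.reg_own _ (by omega) (by omega) (by omega), State.tick_reg, hlen1]
      · rw [State.tick_reg, hr3 _ (by omega) (by omega) (by omega),
          hfr.reg_own _ (by omega) (by omega) (by omega), State.tick_reg]
        exact hf1.reg_own r h1 h2 h3 h4 h5 h6
      · rw [State.tick_reg, hr3 _ (by omega) (by omega) (by omega), hfr.reg_other r h1 h2,
          State.tick_reg]
        exact hf1.reg_other r h1 h2
      · rw [State.tick_mem, hm3, hfr.mem_other a h1 h2, State.tick_mem]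
        exact hf1.mem_other a h1 h2
      · exact (hf1.used.trans hfr.used).trans hu3'
      · rw [State.tick_used, hu3, hs2.used, State.tick_used, hu1, Set.union_assoc, ← Set.image_union,
          ← hacc]
        congr 2
        ext x
        simp only [Set.mem_union, Set.mem_ofPred_eq, Nat.lt_succ_iff_lt_or_eq]
        constructor
        · rintro (⟨i, hi, h⟩ | h)
          exacts [⟨i, .inl hi, h⟩, ⟨j, .inr rfl, h⟩]
        · rintro ⟨i, hi | rfl, h⟩
          exacts [.inl ⟨i, hi, h⟩, .inr h]
      · rw [outputs_succ, hemis]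
        refine (hs2.recorded ht).congr ?_ ?_ ?_
        · rw [State.tick_reg, hr3 _ (by omega) (by omega) (by omega)]
        · rw [State.tick_mem, hm3]
        · rw [State.tick_mem, hm3]
  · rintro s1 ⟨⟨hc1, hctr, hbud1, hg1⟩, hmat1, hpc1, hlen1, hf1, hu1, hrec1⟩
    refine ⟨?_, h _ (hc1.congr (by simp) rfl rfl rfl (by rfl)) ⟨hmat1.reg, hmat1.mem⟩
      ⟨hf1.reg_own, hf1.reg_other, hf1.mem_other, hf1.used⟩ ?_ hrec1 ?_⟩
    · simp only [Test.Holds, hpc1, hlen1]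
      rw [min_eq_right hN]
      exact lt_irrefl _
    · rw [usedCells_eq_of_halted hN]
      exact hu1
    · have : N % bud * (100 + 3 * P.length) ≤ bud * (100 + 3 * P.length) :=
        Nat.mul_le_mul_right _ (Nat.mod_lt _ hb0).le
      rw [State.tick_gap, State.tick_gap]
      omega

/-! ### The enumeration program -/

/-- Outputs the remaining edges of the buffer. -/
def flush : Cmd := .loop (.lt regEm regCnt) emitNext

theorem Env.wp_flush (he : Env I w w' W) {Q : State W → Prop} {s : State W} {m : ℕ → ℕ}
    {D em : ℕ} (hc : Core I m D I.n em s) (hm : ∀ x < I.n, m x < I.n)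
    (hem : em ≤ (sources m I.n).length) (hgap : s.gap + 6 ≤ D)
    (h : ∀ s', Core I m D I.n (sources m I.n).length s' →
      s'.reg regCntT = s.reg regCntT → s'.mem = s.mem →
      ownCells I W ∪ s'.used = ownCells I W ∪ s.used → s.used ⊆ s'.used →
      s'.gap ≤ s.gap + 4 → Q s') :
    Wp I w flush Q s := by
  have hn := he.n_lt
  have hl := length_sources_le m I.n
  refine .loop (fun j s' => Core I m D I.n (em + j) s' ∧ s'.reg regCntT = s.reg regCntT ∧
    s'.mem = s.mem ∧ ownCells I W ∪ s'.used = ownCells I W ∪ s.used ∧ s.used ⊆ s'.used ∧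
    s'.gap ≤ s.gap + 2) ((sources m I.n).length - em) ⟨hc, rfl, rfl, rfl, subset_rfl, by omega⟩
    ?_ ?_
  · rintro j hj s1 ⟨hc1, hr1, hm1, hu1, hu1', hg1⟩
    refine ⟨?_, he.wp_emitNext (s := s1.tick) (m := m) (D := D) (v := I.n) (em := em + j)
      (hc1.congr (by simp) rfl rfl rfl (by rfl)) le_rfl hm (by omega)
      (by rw [State.tick_gap]; omega) fun s2 hc2 hr2 hm2 hu2 hu2' hg2 =>
      ⟨hc2.congr (by simp) rfl rfl rfl (by rfl), ?_, ?_, ?_, ?_, ?_⟩⟩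
    · simp only [Test.Holds, hc1.emitted, hc1.count]
      rw [toNat_ofNat_of_lt (by omega), toNat_ofNat_of_lt (by omega)]
      omega
    · rw [State.tick_reg, hr2 _ (by omega) (by omega), State.tick_reg, hr1]
    · rw [State.tick_mem, hm2, State.tick_mem, hm1]
    · rw [State.tick_used, hu2, State.tick_used, hu1]
    · exact hu1'.trans hu2'
    · rw [State.tick_gap]; omega
  · rintro s1 ⟨hc1, hr1, hm1, hu1, hu1', hg1⟩
    rw [Nat.add_sub_cancel' hem] at hc1
    refine ⟨?_, h _ (hc1.congr (by simp) rfl rfl rfl (by rfl)) hr1 hm1 hu1 hu1' ?_⟩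
    · simp [Test.Holds, hc1.emitted, hc1.count]
    · rw [State.tick_gap, State.tick_gap]; omega

/-- Outputs the recorded tree edges. -/
def emitTree : Cmd :=
  .basic (.const 17 0) ⨾
  .loop (.lt 17 regCntT)
    (.basic (.load 20 arrU 17) ⨾ .basic (.load 21 arrV 17) ⨾ .basic (.emit 20 21) ⨾
      .basic (.op .add 17 17 regOne))

theorem Env.wp_emitTree (he : Env I w w' W) {Q : State W → Prop} {s : State W} {D : ℕ}
    {M : List (ℕ × ℕ)} (hone : s.reg regOne = BitVec.ofNat W 1)
    (hcnt : s.reg regCntT = BitVec.ofNat W M.length) (hMn : ∀ x ∈ M, x.1 < I.n ∧ x.2 < I.n)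
    (hM : ∀ k (h : k < M.length), s.mem arrU (BitVec.ofNat W k) = BitVec.ofNat W M[k].1 ∧
      s.mem arrV (BitVec.ofNat W k) = BitVec.ofNat W M[k].2) (hMl : M.length ≤ I.n)
    (hgaps : ∀ x ∈ s.out, x.2 ≤ D) (hgap : s.gap + 10 ≤ D)
    (h : ∀ s', s'.out.map Prod.fst = s.out.map Prod.fst ++ M.map (fun x => s(x.1, x.2)) →
      (∀ x ∈ s'.out, x.2 ≤ D) → ownCells I W ∪ s'.used = ownCells I W ∪ s.used →
      s.used ⊆ s'.used → s'.gap ≤ s.gap + 5 → Q s') :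
    Wp I w emitTree Q s := by
  have hn := he.n_lt
  refine .seq (.const (.loop (fun j s' => s'.reg regOne = BitVec.ofNat W 1 ∧
    s'.reg regCntT = BitVec.ofNat W M.length ∧ s'.reg 17 = BitVec.ofNat W j ∧ s'.mem = s.mem ∧
    s'.out.map Prod.fst = s.out.map Prod.fst ++ (M.take j).map (fun x => s(x.1, x.2)) ∧
    (∀ x ∈ s'.out, x.2 ≤ D) ∧ ownCells I W ∪ s'.used = ownCells I W ∪ s.used ∧
    s.used ⊆ s'.used ∧ s'.gap ≤ s.gap + 2) M.length ?_ ?_ ?_))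
  · refine ⟨?_, ?_, ?_, rfl, ?_, hgaps, rfl, subset_rfl, ?_⟩ <;> simp [hone, hcnt]
  · rintro j hj s1 ⟨h1, h9, h17, hm1, ho1, hgs1, hu1, hu1', hg1⟩
    have hMj := hMn _ (List.getElem_mem hj)
    have hmem := hM j hj
    have htake : M.take (j + 1) = M.take j ++ [M[j]] := by simp [List.take_append_getElem]
    generalize M[j] = x at *
    have ht1 : (BitVec.ofNat W x.1).toNat = x.1 := toNat_ofNat_of_lt (by omega)
    have ht2 : (BitVec.ofNat W x.2).toNat = x.2 := toNat_ofNat_of_lt (by omega)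
    have htj : (BitVec.ofNat W j).toNat = j := toNat_ofNat_of_lt (by omega)
    refine ⟨?_, .seq (.load (.seq (.load (.seq (.emit (.op ⟨?_, ?_, ?_, hm1, ?_, ?_, ?_, ?_,
      ?_⟩))))))⟩
    · simp only [Test.Holds, h9, h17]
      rw [toNat_ofNat_of_lt (by omega), toNat_ofNat_of_lt (by omega)]
      exact hj
    · simp [h1]
    · simp [h9]
    · simp [WordOp.eval, h17, h1, BitVec.ofNat_add]
    · rw [htake]
      simp [ho1, h17, hm1, hmem, ht1, ht2, -BitVec.toNat_ofNat]
    · intro y hy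
      rcases List.mem_append.1 hy with hy | hy
      · exact hgs1 y hy
      · obtain rfl := List.mem_singleton.1 hy
        simp; omega
    · simp only [State.tick_used, State.tick_reg, h17, ne_eq, Nat.reduceEqDiff, not_false_eq_true,
        Function.update_of_ne]
      rw [ownCells_union_insert (by omega) (by omega), ownCells_union_insert (by omega) (by omega),
        hu1]
    · exact fun y hy => .inr (.inr (hu1' hy))
    · simp
  · rintro s1 ⟨h1, h9, h17, hm1, ho1, hgs1, hu1, hu1', hg1⟩
    refine ⟨?_, h _ ?_ hgs1 hu1 hu1' ?_⟩
    · simp [Test.Holds, h9, h17]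
    · simpa using ho1
    · rw [State.tick_gap, State.tick_gap]; omega

/-- `s'` differs from `s` at most in the registers in `S` and in the waiting time, which has grown by
at most `10`. -/
structure Agree (S : List ℕ) (s s' : State W) : Prop where
  reg : ∀ r, r ∉ S → s'.reg r = s.reg r
  mem : s'.mem = s.mem
  out : s'.out = s.out
  used : s'.used = s.used
  gap : s'.gap ≤ s.gap + 10

/-- From now on, lets `K * (Δ + 1)` rounds pass between two outputs. -/
def paceByDegree (K : ℕ) : Cmd :=
  .basic (.const 15 K) ⨾ .basic (.op .add 16 regDelta regOne) ⨾ .basic (.op .mul regBud 15 16)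

theorem wp_paceByDegree {Q : State W → Prop} {s : State W} {K Δ : ℕ}
    (hone : s.reg regOne = BitVec.ofNat W 1) (hΔ : s.reg regDelta = BitVec.ofNat W Δ)
    (h : ∀ s', Agree [7, 15, 16] s s' → s'.reg regBud = BitVec.ofNat W (K * (Δ + 1)) → Q s') :
    Wp I w (paceByDegree K) Q s := by
  refine .seq (.const (.seq (.op (.op (h _ ⟨fun r hr => ?_, rfl, rfl, rfl, by simp⟩ ?_)))))
  · simp only [List.mem_cons, List.not_mem_nil, or_false, not_or] at hr
    simp [hr]
  · simp [WordOp.eval, hone, hΔ, BitVec.ofNat_add, BitVec.ofNat_mul]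

/-- From now on, lets `K * (T / n + 1)` rounds pass between two outputs, where `T` stands in
register `r`. -/
def paceByTime (K r : ℕ) : Cmd :=
  .basic (.const 15 K) ⨾ .basic (.op .div 16 r regN) ⨾ .basic (.op .add 16 16 regOne) ⨾
  .basic (.op .mul regBud 15 16)

theorem wp_paceByTime {Q : State W → Prop} {s : State W} {K T n r : ℕ} (hr : 20 ≤ r)
    (hone : s.reg regOne = BitVec.ofNat W 1) (hn : s.reg regN = BitVec.ofNat W n)
    (hT : s.reg r = BitVec.ofNat W T) (hnW : n < 2 ^ W) (hTW : T < 2 ^ W)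
    (h : ∀ s', Agree [7, 15, 16] s s' → s'.reg regBud = BitVec.ofNat W (K * (T / n + 1)) → Q s') :
    Wp I w (paceByTime K r) Q s := by
  have hr15 : r ≠ 15 := by omega
  have hdiv : BitVec.ofNat W T / BitVec.ofNat W n = BitVec.ofNat W (T / n) := by
    rw [eq_ofNat_iff ((Nat.div_le_self _ _).trans_lt hTW), BitVec.toNat_udiv,
      toNat_ofNat_of_lt hTW, toNat_ofNat_of_lt hnW]
  refine .seq (.const (.seq (.op (.seq (.op (.op
    (h _ ⟨fun r hr => ?_, rfl, rfl, rfl, by simp⟩ ?_)))))))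
  · simp only [List.mem_cons, List.not_mem_nil, or_false, not_or] at hr
    simp [hr]
  · simp [WordOp.eval, hone, hT, hn, hr15, hdiv, BitVec.ofNat_add, BitVec.ofNat_mul]

theorem wp_setConst {Q : State W → Prop} {s : State W} {d k : ℕ}
    (h : ∀ s', Agree [d] s s' → s'.reg d = BitVec.ofNat W k → Q s') :
    Wp I w (.basic (.const d k)) Q s :=
  .const (h _ ⟨fun r hr => by simp_all, rfl, rfl, rfl, by simp⟩ (by simp))

/-- The enumeration program: `A` is an MST algorithm, `B` computes a bound on its running time, and
`K` determines how many simulated steps pass between two outputs. The first simulation of `A` serves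
only to use as much space as `A` does: on weights without ties, and on the memory contents that
the first simulation leaves behind, `A` may use less. -/
def enumeration (A B : Program) (K : ℕ) : Cmd :=
  firstPhase ⨾ paceByDegree K ⨾ simulate false 1 B ⨾ paceByTime K (simReg 1 0) ⨾
  simulate false 0 A ⨾ .basic (.const regCntT 0) ⨾ simulate true 0 A ⨾ flush ⨾ emitTree

theorem exists_halting_time {P : Program} {I : Input} {wt : I.Weight} {c : Config W} {t : ℕ}
    (h : Halted P (run P I wt c t)) :
    ∃ N ≤ t, Halted P (run P I wt c N) ∧ ∀ j < N, ¬ Halted P (run P I wt c j) := by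
  classical
  have hex : ∃ N, Halted P (run P I wt c N) := ⟨t, h⟩
  exact ⟨Nat.find hex, Nat.find_min' hex h, Nat.find_spec hex, fun j hj => Nat.find_min hex hj⟩

theorem emission_mem_outputs {P : Program} {I : Input} {wt : I.Weight} {c : Config W} {t i : ℕ}
    {e : Sym2 ℕ} (hi : i < t) (he : emission P (run P I wt c i) = some e) :
    e ∈ outputs P I wt c t :=
  List.mem_filterMap.2 ⟨i, List.mem_range.2 hi, he⟩

theorem length_outputs_lt {P : Program} {I : Input} {wt : I.Weight} {c : Config W} {t i : ℕ}
    {e : Sym2 ℕ} (hi : i < t) (he : emission P (run P I wt c i) = some e) :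
    (outputs P I wt c i).length < (outputs P I wt c t).length := by
  have h1 : (outputs P I wt c i).length < (outputs P I wt c (i + 1)).length := by
    rw [outputs_succ, he]; simp
  refine h1.trans_le ?_
  have h2 : i + 1 ≤ t := hi
  clear h1 hi
  induction t, h2 using Nat.le_induction with
  | base => rfl
  | succ k _ ih =>
    refine ih.trans ?_
    rw [outputs_succ P I wt c k, List.length_append]
    exact Nat.le_add_right _ _

theorem div_le_twelfth {N b n : ℕ} (h : 12 * N ≤ b * n) (hb : 0 < b) : N / b ≤ n / 12 := by
  rw [Nat.le_div_iff_mul_le (by omega)]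
  have := Nat.div_mul_le_self N b
  have : N / b * 12 * b ≤ n * b := by nlinarith
  exact Nat.le_of_mul_le_mul_right this hb

/-- The configuration of simulated program `δ` at the start. -/
def simConfig (δ : ℕ) (s : State W) : Config W :=
  ⟨0, fun r => s.reg (simReg δ r), fun a => s.mem (simArr δ a)⟩

/-- The bound on the delay; `t` is the quotient of the running time by the number of vertices. -/
def delayBound (A B : Program) (K Δ t : ℕ) : ℕ :=
  200 + 4 * (30 + 50 * Δ) + K * (Δ + 1) * (100 + 3 * B.length) +
    2 * (K * (t + 1) * (100 + 3 * A.length))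

open Classical in
theorem Env.wp_enumeration (he : Env I w w' W) {Q : State W → Prop} {s : State W}
    {A B : Program} {c T : ℕ}
    (hA : ∀ wt : I.Weight, ∀ cfg : Config W, cfg.pc = 0 → OutputsMST A I wt cfg (c * T))
    (hB : ∀ cfg : Config W, cfg.pc = 0 → Halted B (run B I w cfg (c * (I.maxDeg * I.n + 1))) ∧
      ((run B I w cfg (c * (I.maxDeg * I.n + 1))).reg 0).toNat = T)
    (hAW : A.length < 2 ^ W) (hBW : B.length < 2 ^ W) (hnW : 12 * (c + 1) * I.n < 2 ^ W)
    (hTW : 12 * (c + 1) * (T + 1) < 2 ^ W)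
    (hout : s.out = []) (hgap : s.gap = 0) (hused : s.used = ∅)
    (h : ∀ s' : State W, ∀ cA : Config W, cA.pc = 0 →
      s'.out.map Prod.fst = (sources (mate I w') I.n).map (mateEdge (mate I w')) ++
        (outputs A I w' cA (c * T)).filter (fun e => ¬ IsMateEdge I (mate I w') e) →
      (∀ x ∈ s'.out, x.2 ≤ delayBound A B (12 * (c + 1)) I.maxDeg (T / I.n)) →
      s'.gap + 1 ≤ delayBound A B (12 * (c + 1)) I.maxDeg (T / I.n) →
      (∀ x < I.n, (arrMate, BitVec.ofNat W x) ∈ s'.used) →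
      ownCells I W ∪ s'.used = ownCells I W ∪ simCell 1 '' usedCells B I w (simConfig 1 s) ∪
        simCell 0 '' usedCells A I w (simConfig 0 s) ∪ simCell 0 '' usedCells A I w' cA → Q s') :
    Wp I w (enumeration A B (12 * (c + 1))) Q s := by
  have hn := he.n_lt
  have hpos := he.pos
  have hΔ := I.maxDeg_lt hpos
  set K := 12 * (c + 1) with hK
  set m := mate I w'
  have hm : ∀ x < I.n, m x < I.n := fun x _ => mate_lt I w' hpos x
  have hsrc : I.n / 2 ≤ (sources m I.n).length :=
    div_le_length_sources (fun h x => he.mate_ne (w := w) h (x := x)) le_rfl le_rfl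
  set b₁ := K * (I.maxDeg + 1) with hb₁
  set b₂ := K * (T / I.n + 1) with hb₂
  have hTn : T / I.n ≤ T := Nat.div_le_self _ _
  have hb₁0 : 0 < b₁ := by positivity
  have hb₂0 : 0 < b₂ := by positivity
  have hb₁W : b₁ < 2 ^ W := lt_of_le_of_lt (Nat.mul_le_mul_left K (by omega)) hnW
  have hb₂W : b₂ < 2 ^ W := lt_of_le_of_lt (Nat.mul_le_mul_left K (by omega)) hTW
  have hT : T < 2 ^ W := by nlinarith
  set D := delayBound A B K I.maxDeg (T / I.n) with hD
  rw [delayBound, ← hb₁, ← hb₂] at hD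
  -- each of the three simulations is paced so that it outputs at most `n / 12` edges
  obtain ⟨NB, hNB, hhB, hltB⟩ := exists_halting_time (hB (simConfig 1 s) rfl).1
  have hNB12 : NB / b₁ ≤ I.n / 12 := by
    refine div_le_twelfth ?_ hb₁0
    calc 12 * NB ≤ 12 * (c * (I.maxDeg * I.n + 1)) := by omega
      _ ≤ 12 * ((c + 1) * (I.maxDeg * I.n + I.n)) := by gcongr <;> omega
      _ = b₁ * I.n := by rw [hb₁, hK]; ring
  have hNA12 : ∀ N ≤ c * T, N / b₂ ≤ I.n / 12 := by
    intro N hN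
    refine div_le_twelfth ?_ hb₂0
    have : T ≤ I.n * (T / I.n + 1) := (Nat.lt_mul_div_succ T hpos).le
    calc 12 * N ≤ 12 * (c * T) := by omega
      _ ≤ 12 * ((c + 1) * (I.n * (T / I.n + 1))) := by gcongr; omega
      _ = b₂ * I.n := by rw [hb₂, hK]; ring
  refine .seq (he.wp_firstPhase (D := D) hout hgap hused (by omega)
    fun s1 hc1 hdel1 hr1 hm1 hu1 hg1 => .seq (wp_paceByDegree hc1.one hdel1
    fun s2 hs2 hs2b => .seq ?_))
  have hg2 := hs2.gap
  refine he.wp_simulate (s := s2) (m := m) (D := D) (em := I.n / 4) (bud := b₁)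
    (g := 30 + 4 * (30 + 50 * I.maxDeg)) (N := NB) (c := simConfig 1 s) (wt := w) rfl hm hBW
    (hc1.congr (fun r hr => hs2.reg r (by simp; omega)) (by rw [hs2.mem]) (by rw [hs2.mem]) hs2.out
      hs2.used.ge)
    ⟨fun r => ?_, fun x => ?_⟩ rfl hhB hltB hs2b hb₁0 hb₁W (by omega) (by omega) (by omega)
    (by omega) (by simp) fun s3 hc3 hmat3 hf3 hu3 _ hg3 => .seq ?_
  · have := le_simReg 1 r
    rw [hs2.reg _ (by simp; omega), hr1 _ (by omega)]
    rfl
  · have := le_simArr 1 x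
    rw [hs2.mem]
    exact hm1 _ (by omega)
  -- the program `A` has not been touched so far
  have hA3r : ∀ r, s3.reg (simReg 0 r) = s.reg (simReg 0 r) := by
    intro r
    have := le_simReg 0 r
    rw [hf3.reg_other _ this (fun x => by unfold simReg; omega),
      hs2.reg _ (by simp; omega), hr1 _ (by omega)]
  have hA3m : ∀ x, s3.mem (simArr 0 x) = s.mem (simArr 0 x) := by
    intro x
    have := le_simArr 0 x
    rw [hf3.mem_other _ this (fun x => by unfold simArr; omega), hs2.mem]
    exact hm1 _ (by omega)
  have hT3 : s3.reg (simReg 1 0) = BitVec.ofNat W T := by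
    rw [hmat3.reg, eq_ofNat_iff hT, ← (hB (simConfig 1 s) rfl).2,
      run_eq_of_halted hhB hNB]
  refine wp_paceByTime (by have := le_simReg 1 0; omega) hc3.one hc3.n hT3 (by omega) hT
    fun s4 hs4 hs4b => .seq ?_
  have hg4 := hs4.gap
  obtain ⟨NA, hNA, hhA, hltA⟩ := exists_halting_time (hA w (simConfig 0 s) rfl).1
  have hNA' := hNA12 NA hNA
  refine he.wp_simulate (s := s4) (m := m) (D := D) (em := I.n / 4 + NB / b₁) (bud := b₂)
    (g := 50 + 4 * (30 + 50 * I.maxDeg) + b₁ * (100 + 3 * B.length)) (N := NA) (c := simConfig 0 s) (wt := w) rfl hm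
    hAW (hc3.congr (fun r hr => hs4.reg r (by simp; omega)) (by rw [hs4.mem]) (by rw [hs4.mem])
      hs4.out hs4.used.ge)
    ⟨fun r => ?_, fun x => ?_⟩ rfl hhA hltA hs4b hb₂0 hb₂W (by omega) (by omega) (by omega)
    (by omega) (by simp) fun s5 hc5 hmat5 hf5 hu5 _ hg5 => .seq (wp_setConst
    fun s6 hs6 hs6c => .seq ?_)
  · have := le_simReg 0 r
    rw [hs4.reg _ (by simp; omega), hA3r]
    rfl
  · rw [hs4.mem]
    exact hA3m x
  have hg6 := hs6.gap
  obtain ⟨hhalt', T', es, hmst, hnd, hmem, houts⟩ := hA w' (simConfig 0 s6) rfl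
  obtain ⟨NA', hNA', hhA', hltA'⟩ := exists_halting_time hhalt'
  have hNA'' := hNA12 NA' hNA'
  have hes := length_of_tree hmst.1.2 hnd hmem
  have houtN : outputs A I w' (simConfig 0 s6) (c * T) = outputs A I w' (simConfig 0 s6) NA' :=
    outputs_eq_of_halted hhA' hNA'
  rw [houtN] at houts
  refine he.wp_simulate (s := s6) (m := m) (D := D) (em := I.n / 4 + NB / b₁ + NA / b₂)
    (bud := b₂) (g := 70 + 4 * (30 + 50 * I.maxDeg) + b₁ * (100 + 3 * B.length) + b₂ * (100 + 3 * A.length)) (N := NA')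
    (c := simConfig 0 s6) (wt := w') rfl hm
    hAW (hc5.congr (fun r hr => hs6.reg r (by simp; omega)) (by rw [hs6.mem]) (by rw [hs6.mem])
      hs6.out hs6.used.ge)
    ⟨fun r => rfl, fun x => rfl⟩ rfl hhA' hltA' ?_ hb₂0 hb₂W (by omega) (by omega) (by omega)
    (by omega) (fun _ => ⟨⟨[], rfl, hs6c, by simp, by simp⟩, fun j hj e hje => ⟨?_, ?_⟩⟩)
    fun s7 hc7 hmat7 hf7 hu7 hrec7 hg7 => .seq ?_
  · rw [hs6.reg _ (by simp), hf5.reg_own _ (by omega) (by omega) (by omega) (by omega) (by omega)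
      (by omega), hs4b]
  · have := length_outputs_lt hj hje
    rw [houts, List.length_map] at this
    omega
  · have := emission_mem_outputs hj hje
    rw [houts, List.mem_map] at this
    obtain ⟨e', -, rfl⟩ := this
    induction e' with | _ x y
    exact ⟨x, x.2, y, y.2, rfl⟩
  refine he.wp_flush (D := D) hc7 hm (by omega) (by omega) fun s8 hc8 hr8 hm8 hu8 hu8' hg8 => ?_
  obtain ⟨M, hM, hcnt, hMn, hMmem⟩ := hrec7 rfl
  have hMl : M.length ≤ I.n := by
    rw [← List.length_map (fun x : ℕ × ℕ => s(x.1, x.2)), hM]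
    refine (List.length_filter_le _ _).trans ?_
    rw [houts, List.length_map]
    exact hes.le
  refine he.wp_emitTree (D := D) hc8.one (by rw [hr8, hcnt]) hMn (by rw [hm8]; exact hMmem) hMl
    hc8.gaps (by omega) fun s9 ho9 hgs9 hu9 hu9' hg9 => h s9 (simConfig 0 s6) rfl ?_ hgs9
    (by omega) (fun x hx => hu9' (hc8.used x hx)) ?_
  · rw [ho9, hc8.out, List.take_length, hM, houtN]
  · rw [hu9, hu8, hu7, hs6.used, hu5, hs4.used, hu3, hs2.used, hu1]

/-! ### The edges that are output -/

theorem Env.injective (he : Env I w w' W) : Function.Injective w' := by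
  intro e f h
  have h1 := (he.tieBreak e f).not.1 h.not_lt
  have h2 := (he.tieBreak f e).not.1 h.symm.not_lt
  push Not at h1 h2
  exact symKey_injective (le_antisymm (h2.2 h1.1) (h1.2 h2.1))

open Classical in
/-- The edges of the first Borůvka round, followed by the other edges of the tree, are a list of the
edges of the tree. -/
theorem exists_list_of_mateEdges (hI : I.graph.Connected) (hw : Function.Injective w)
    {T : SimpleGraph (Fin I.n)} (hT : IsMST I.graph w T) {es : List (Sym2 (Fin I.n))}
    (hnd : es.Nodup) (hmem : ∀ e, e ∈ es ↔ e ∈ T.edgeSet) :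
    ∃ es' : List (Sym2 (Fin I.n)), es'.Nodup ∧ (∀ e, e ∈ es' ↔ e ∈ T.edgeSet) ∧
      (sources (mate I w) I.n).map (mateEdge (mate I w)) ++
        (es.map (Sym2.map Fin.val)).filter (fun e => ¬ IsMateEdge I (mate I w) e) =
      es'.map (Sym2.map Fin.val) := by
  set m := mate I w
  set L := (sources m I.n).map (mateEdge m) ++
    (es.map (Sym2.map Fin.val)).filter (fun e => ¬ IsMateEdge I m e) with hL
  have hinj := map_val_sym2_injective I.n
  have hL1 : ∀ e ∈ L, ∃ f ∈ T.edgeSet, Sym2.map Fin.val f = e := by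
    intro e he
    rcases List.mem_append.1 he with he | he
    · obtain ⟨x, hx, rfl⟩ := List.mem_map.1 he
      rw [mem_sources] at hx
      have h2 : 2 ≤ I.n := by
        have h1 : m x < I.n := mate_lt I w (by omega) x
        have h2 : m (m x) < I.n := mate_lt I w (by omega) (m x)
        omega
      obtain ⟨_, _, h⟩ := adj_mate_of_isMST hw (I.degree_pos hI h2 hx.1) hT
      exact ⟨s(_, _), h, rfl⟩
    · obtain ⟨f, hf, rfl⟩ := List.mem_map.1 (List.mem_filter.1 he).1
      exact ⟨f, (hmem f).1 hf, rfl⟩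
  have hL2 : ∀ f ∈ T.edgeSet, Sym2.map Fin.val f ∈ L := by
    intro f hf
    rw [hL, List.mem_append]
    by_cases h : IsMateEdge I m (Sym2.map Fin.val f)
    · obtain ⟨x, hx, hfx⟩ := h
      have hne : m x ≠ x := by
        intro heq
        induction f with | _ a b
        have hab : a ≠ b := (show T.Adj a b from hf).ne
        rw [mateEdge, heq, Sym2.map_mk, Sym2.eq_iff] at hfx
        exact hab (Fin.ext (by omega))
      obtain ⟨y, hy, hyx⟩ := exists_source hx hne
      exact .inl (List.mem_map.2 ⟨y, hy, hyx.trans hfx.symm⟩)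
    · exact .inr (List.mem_filter.2 ⟨List.mem_map_of_mem ((hmem f).2 hf), by simpa using h⟩)
  have hLnd : L.Nodup := by
    refine List.Nodup.append (nodup_map_mateEdge m _) ((hnd.map hinj).filter _) ?_
    intro e h1 h2
    obtain ⟨x, hx, rfl⟩ := List.mem_map.1 h1
    have := (List.mem_filter.1 h2).2
    simp only [decide_not, Bool.not_eq_eq_eq_not, Bool.not_true, decide_eq_false_iff_not] at this
    exact this ⟨x, (mem_sources.1 hx).1, rfl⟩
  obtain ⟨es', hes'⟩ : ∃ es' : List (Sym2 (Fin I.n)), es'.map (Sym2.map Fin.val) = L := by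
    have : L ∈ Set.range (List.map (Sym2.map (Fin.val (n := I.n)))) := by
      rw [Set.range_list_map]
      exact fun e he => (hL1 e he).imp fun f hf => hf.2
    exact this
  refine ⟨es', ?_, fun e => ⟨fun he => ?_, fun he => ?_⟩, hes'.symm⟩
  · rw [← hes'] at hLnd
    exact hLnd.of_map _
  · obtain ⟨f, hf, hfe⟩ := hL1 (Sym2.map Fin.val e) (hes' ▸ List.mem_map_of_mem he)
    exact hinj hfe ▸ hf
  · have := hL2 e he
    rw [← hes', List.mem_map] at this
    obtain ⟨f, hf, hfe⟩ := this
    exact hinj hfe ▸ hf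

/-! ### The run of the compiled program -/

theorem Wp.exists_halting_run {c : Cmd} {Q : State W → Prop} {s : Config W} (hs : s.pc = 0)
    (h : Wp I w c Q (initState s)) :
    ∃ s', Q s' ∧ ∃ t, Halted (c.code 0) (run (c.code 0) I w s t) ∧
      outputs (c.code 0) I w s t = s'.out.map Prod.fst ∧ usedCells (c.code 0) I w s = s'.used ∧
      ∀ (D : ℕ) (d : ℝ), (D : ℝ) ≤ d → (∀ x ∈ s'.out, x.2 ≤ D) → s'.gap + 1 ≤ D →
        DelayAtMost (c.code 0) I w s d := by
  obtain ⟨s', hex, hQ⟩ := h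
  obtain ⟨t, ht⟩ := hex.reaches (P := c.code 0) (p := 0) fun i _ => by rw [zero_add]
  have ht : recRun (c.code 0) I w s t = (0 + c.size, s') := ht
  have hhalt : Halted (c.code 0) (run (c.code 0) I w s t) := by
    rw [← toConfig_recRun hs, ht, Halted, Cmd.length_code]
    simp [toConfig]
  refine ⟨s', hQ, t, hhalt, ?_, ?_, fun D d hD hout hgap =>
    delayAtMost_of_recRun hs hD hhalt (by rw [ht]; exact hout) (by rw [ht]; exact hgap)⟩
  · rw [outputs_eq_recRun hs, ht]
  · rw [usedCells_eq_of_halted hhalt, ← used_recRun hs, ht]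

/-- What is to be known about graph and word size in order to run the enumeration. -/
structure Fits (A B : Program) (c T : ℕ) (I : Input) (W : ℕ) : Prop where
  connected : I.graph.Connected
  mst : ∀ wt : I.Weight, ∀ s : Config W, s.pc = 0 → OutputsMST A I wt s (c * T)
  time : ∀ wt : I.Weight, ∀ s : Config W, s.pc = 0 →
    Halted B (run B I wt s (c * (I.maxDeg * I.n + 1))) ∧
      ((run B I wt s (c * (I.maxDeg * I.n + 1))).reg 0).toNat = T
  key_bound : 9 * (I.n * I.n * I.n) < 2 ^ W
  length_left : A.length < 2 ^ W
  length_right : B.length < 2 ^ W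
  degree_bound : 12 * (c + 1) * I.n < 2 ^ W
  time_bound : 12 * (c + 1) * (T + 1) < 2 ^ W

theorem Fits.of_wordSizeOK {A B : Program} {κ c : ℕ} {T : Input → ℕ}
    (hA : IsMSTAlgorithm A κ (fun I => c * T I))
    (hB : ComputesInTime B κ T (fun I => c * (I.maxDeg * I.n + 1)))
    (hI : I.graph.Connected)
    (hW : WordSizeOK (κ + 12 * (c + 1) + A.length + B.length + 7) I W) :
    Fits A B c (T I) I W := by
  unfold WordSizeOK at hW
  set ℓ := Nat.log 2 I.n + 1 with hℓ
  have hκ : WordSizeOK κ I W := by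
    refine le_trans ?_ hW
    rw [← hℓ]
    gcongr
    omega
  have hℓ1 : 1 ≤ ℓ := by omega
  have hn : I.n < 2 ^ ℓ := Nat.lt_pow_succ_log_self Nat.one_lt_two _
  have hpow : ∀ k, k ≤ κ + 12 * (c + 1) + A.length + B.length + 7 → 2 ^ (k * ℓ) ≤ 2 ^ W := by
    intro k hk
    refine Nat.pow_le_pow_right Nat.two_pos (le_trans ?_ hW)
    gcongr
  have hlt : ∀ k, k < 2 ^ (k * ℓ) := fun k =>
    Nat.lt_two_pow_self.trans_le (Nat.pow_le_pow_right Nat.two_pos (Nat.le_mul_of_pos_right k hℓ1))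
  have hT : T I < 2 ^ (κ * ℓ) := by
    have := (hB I hI (fun _ => 0) (κ * ℓ) le_rfl ⟨0, fun _ => 0, fun _ _ => 0⟩ rfl).2
    rw [← this]
    exact BitVec.isLt _
  refine ⟨hI, fun wt s hs => hA I hI wt W hκ s hs, fun wt s hs => hB I hI wt W hκ s hs, ?_,
    (hlt _).trans_le (hpow _ (by omega)), (hlt _).trans_le (hpow _ (by omega)), ?_, ?_⟩
  · refine lt_of_lt_of_le ?_ (hpow 7 (by omega))
    have h9 : 9 ≤ 2 ^ (4 * ℓ) := by
      calc 9 ≤ 2 ^ (4 * 1) := by norm_num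
        _ ≤ 2 ^ (4 * ℓ) := Nat.pow_le_pow_right Nat.two_pos (by omega)
    calc 9 * (I.n * I.n * I.n) < 9 * (2 ^ ℓ * 2 ^ ℓ * 2 ^ ℓ) := by gcongr
      _ ≤ 2 ^ (4 * ℓ) * (2 ^ ℓ * 2 ^ ℓ * 2 ^ ℓ) := by gcongr
      _ = 2 ^ (7 * ℓ) := by ring
  · refine lt_of_lt_of_le ?_ (hpow (12 * (c + 1) + 1) (by omega))
    calc 12 * (c + 1) * I.n < 2 ^ (12 * (c + 1) * ℓ) * 2 ^ ℓ :=
          Nat.mul_lt_mul_of_lt_of_le (hlt _) hn.le (by positivity)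
      _ = 2 ^ ((12 * (c + 1) + 1) * ℓ) := by rw [← pow_add]; ring
  · refine lt_of_lt_of_le ?_ (hpow (12 * (c + 1) + κ) (by omega))
    calc 12 * (c + 1) * (T I + 1) < 2 ^ (12 * (c + 1) * ℓ) * 2 ^ (κ * ℓ) :=
          Nat.mul_lt_mul_of_lt_of_le (hlt _) hT (by positivity)
      _ = 2 ^ ((12 * (c + 1) + κ) * ℓ) := by rw [← pow_add]; ring

/-- The run of the compiled enumeration program. -/
theorem Fits.exists_run {A B : Program} {c T : ℕ} (hF : Fits A B c T I W) (w : I.Weight)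
    {s : Config W} (hs : s.pc = 0) :
    (∃ t, OutputsMST ((enumeration A B (12 * (c + 1))).code 0) I w s t) ∧
    (∀ d : ℝ, (delayBound A B (12 * (c + 1)) I.maxDeg (T / I.n) : ℝ) ≤ d →
      DelayAtMost ((enumeration A B (12 * (c + 1))).code 0) I w s d) ∧
    (∀ x < I.n, (arrMate, BitVec.ofNat W x) ∈
      usedCells ((enumeration A B (12 * (c + 1))).code 0) I w s) ∧
    ∃ (w' : I.Weight) (cA : Config W), cA.pc = 0 ∧
      ownCells I W ∪ usedCells ((enumeration A B (12 * (c + 1))).code 0) I w s =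
        ownCells I W ∪ simCell 1 '' usedCells B I w (simConfig 1 (initState s)) ∪
          simCell 0 '' usedCells A I w (simConfig 0 (initState s)) ∪
          simCell 0 '' usedCells A I w' cA := by
  obtain ⟨w', htie, hmst⟩ := exists_tieBreak I.graph w
  have he : Env I w w' W := ⟨hF.connected, htie, hF.key_bound⟩
  obtain ⟨s', ⟨cA, hcA, hout, hgaps, hgap, hmate, hused⟩, t, hhalt, houts, hcells, hdelay⟩ :=
    Wp.exists_halting_run (Q := fun s' => ∃ cA : Config W, cA.pc = 0 ∧ _ ∧ _ ∧ _ ∧ _ ∧ _) hs (he.wp_enumeration (s := initState s) hF.mst (hF.time w)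
      hF.length_left hF.length_right hF.degree_bound hF.time_bound rfl rfl rfl
      fun s' cA h1 h2 h3 h4 h5 h6 => ⟨cA, h1, h2, h3, h4, h5, h6⟩)
  refine ⟨⟨t, hhalt, ?_⟩, fun d hd => hdelay _ d hd hgaps hgap, ?_, w', cA, hcA, ?_⟩
  · obtain ⟨-, T', es, hT', hnd, hmem, hes⟩ := hF.mst w' cA hcA
    obtain ⟨es', hnd', hmem', hes'⟩ := exists_list_of_mateEdges hF.connected he.injective hT' hnd hmem
    exact ⟨T', es', hmst T' hT', hnd', hmem', by rw [houts, hout, hes, hes']⟩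
  · rw [hcells]; exact hmate
  · rw [hcells, hused]

/-! ### Delay and space -/

theorem delayBound_le {A B : Program} {K Δ t : ℕ} {x : ℝ} (hΔ : (Δ : ℝ) + 1 ≤ 2 * x)
    (ht : (t : ℝ) + 1 ≤ 2 * x) :
    (delayBound A B K Δ t : ℝ) ≤
      ((800 + 2 * K * (100 + 3 * B.length) + 4 * K * (100 + 3 * A.length) : ℕ) : ℝ) * x := by
  have h1 : (K : ℝ) * (100 + 3 * B.length) * (Δ + 1) ≤ K * (100 + 3 * B.length) * (2 * x) := by
    gcongr
  have h2 : (K : ℝ) * (100 + 3 * A.length) * (t + 1) ≤ K * (100 + 3 * A.length) * (2 * x) := by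
    gcongr
  have h3 : (0 : ℝ) ≤ Δ := Nat.cast_nonneg _
  unfold delayBound
  push_cast
  nlinarith

theorem encard_ownCells_le (I : Input) (W : ℕ) : (ownCells I W).encard ≤ 4 * I.n := by
  have h : ownCells I W ⊆ (fun x : ℕ × ℕ => (x.1, BitVec.ofNat W x.2)) ''
      ((Finset.range 4 ×ˢ Finset.range I.n : Finset (ℕ × ℕ)) : Set (ℕ × ℕ)) := by
    rintro ⟨a, x⟩ ⟨ha, hx⟩
    exact ⟨(a, x.toNat), by simpa using ⟨ha, hx⟩, by simp⟩
  refine (Set.encard_le_encard h).trans ((Set.encard_image_le _ _).trans ?_)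
  rw [Set.encard_coe_eq_coe_finsetCard, Finset.card_product]
  simp

theorem encard_usedCells_le_space {P : Program} {s : Config W} (hs : s.pc = 0) :
    (usedCells P I w s).encard ≤ space P I W :=
  le_iSup_of_le w (le_iSup_of_le s (le_iSup_of_le hs le_rfl))

theorem Fits.space_le {A B : Program} {c T : ℕ} (hF : Fits A B c T I W)
    (hB : space B I W ≤ (c : ℕ∞) * (I.n + space A I W)) :
    space ((enumeration A B (12 * (c + 1))).code 0) I W ≤
      ((c + 4 : ℕ) : ℕ∞) * (I.n + space A I W) := by
  refine iSup_le fun w => iSup_le fun s => iSup_le fun hs => ?_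
  obtain ⟨-, -, -, w', cA, hcA, hused⟩ := hF.exists_run w hs
  have h1 : ∀ (δ : ℕ) (P : Program) (wt : I.Weight) (s : Config W), s.pc = 0 →
      (simCell δ '' usedCells P I wt s).encard ≤ space P I W := fun δ P wt s hs =>
    (Set.encard_image_le _ _).trans (encard_usedCells_le_space hs)
  refine (Set.encard_le_encard (Set.subset_union_right.trans hused.le)).trans ?_
  refine (Set.encard_union_le _ _).trans ((add_le_add ((Set.encard_union_le _ _).trans (add_le_add
    ((Set.encard_union_le _ _).trans (add_le_add (encard_ownCells_le I W)
      ((h1 1 B w _ rfl).trans hB))) (h1 0 A w _ rfl))) (h1 0 A w' cA hcA)).trans ?_)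
  calc 4 * (I.n : ℕ∞) + c * (I.n + space A I W) + space A I W + space A I W
      ≤ 4 * (I.n : ℕ∞) + c * (I.n + space A I W) + space A I W + space A I W +
        (space A I W + space A I W) := le_self_add
    _ = ((c + 4 : ℕ) : ℕ∞) * (I.n + space A I W) := by push_cast; ring

theorem Fits.n_le_space {A B : Program} {c T : ℕ} (hF : Fits A B c T I W) :
    (I.n : ℕ∞) ≤ space ((enumeration A B (12 * (c + 1))).code 0) I W := by
  obtain ⟨-, -, h, -⟩ := hF.exists_run (fun _ => 0) (s := ⟨0, fun _ => 0, fun _ _ => 0⟩) rfl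
  refine le_trans ?_ (encard_usedCells_le_space (w := fun _ => 0)
    (s := ⟨0, fun _ => 0, fun _ _ => 0⟩) rfl)
  have hn : I.n < 2 ^ W := by have := hF.degree_bound; nlinarith
  have hinj : Set.InjOn (fun x : ℕ => ((0 : ℕ), BitVec.ofNat W x)) (Finset.range I.n) := by
    intro x hx y hy hxy
    simp only [Finset.coe_range, Set.mem_Iio] at hx hy
    exact (ofNat_inj_of_lt (by omega) (by omega)).1 (Prod.ext_iff.1 hxy).2
  have h1 := hinj.encard_image
  rw [Set.encard_coe_eq_coe_finsetCard, Finset.card_range] at h1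
  rw [← h1]
  refine Set.encard_le_encard ?_
  rintro _ ⟨x, hx, rfl⟩
  exact h x (by simpa using hx)

theorem Fits.space_le_space {A B : Program} {c T : ℕ} (hF : Fits A B c T I W) :
    space A I W ≤ space ((enumeration A B (12 * (c + 1))).code 0) I W := by
  refine iSup_le fun w => iSup_le fun s => iSup_le fun hs => ?_
  -- start the enumeration with registers and memory such that the simulation of `A` starts in `s`
  let s₀ : Config W := ⟨0, fun r => s.reg ((r - 100) / 2), fun a => s.mem ((a - 10) / 2)⟩
  have hs₀ : simConfig 0 (initState s₀) = s := by
    have h1 : ∀ r, (simReg 0 r - 100) / 2 = r := fun r => by unfold simReg; omega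
    have h2 : ∀ a, (simArr 0 a - 10) / 2 = a := fun a => by unfold simArr; omega
    cases s
    simp_all [simConfig, initState, s₀]
  obtain ⟨-, -, -, w', cA, -, hused⟩ := hF.exists_run w (s := s₀) rfl
  refine le_trans ?_ (encard_usedCells_le_space (w := w) (s := s₀) rfl)
  rw [hs₀] at hused
  rw [← (simCell_injective 0).encard_image]
  refine Set.encard_le_encard fun x hx => ?_
  have hx' : x ∈ ownCells I W ∪ usedCells ((enumeration A B (12 * (c + 1))).code 0) I w s₀ := by
    rw [hused]
    exact .inl (.inr hx)
  refine hx'.resolve_left fun ⟨h4, _⟩ => ?_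
  obtain ⟨y, -, rfl⟩ := hx
  have := le_simArr 0 y.1
  simp only [simCell] at h4
  omega

end MSTEnum

theorem mainTheorem2 (T : MSTEnum.Input → ℕ) (A B : MSTEnum.Program) (κ c : ℕ)
    (hA : MSTEnum.IsMSTAlgorithm A κ (fun I => c * T I))
    (hB : MSTEnum.ComputesInTime B κ T (fun I => c * (I.maxDeg * I.n + 1)))
    (hBspace : ∀ I : MSTEnum.Input, I.graph.Connected → ∀ W : ℕ, MSTEnum.WordSizeOK κ I W →
      MSTEnum.space B I W ≤ (c : ℕ∞) * ((I.n : ℕ∞) + MSTEnum.space A I W)) :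
    ∃ (E : MSTEnum.Program) (κ' C : ℕ),
      MSTEnum.EnumeratesMST E κ'
        (fun I => (C : ℝ) * max (I.maxDeg : ℝ) ((T I : ℝ) / (I.n : ℝ))) ∧
      ∀ I : MSTEnum.Input, I.graph.Connected → ∀ W : ℕ, MSTEnum.WordSizeOK κ' I W →
        MSTEnum.space E I W ≤ (C : ℕ∞) * ((I.n : ℕ∞) + MSTEnum.space A I W) ∧
        (I.n : ℕ∞) + MSTEnum.space A I W ≤ (C : ℕ∞) * MSTEnum.space E I W := by
  set K := 12 * (c + 1)
  set C₀ := 800 + 2 * K * (100 + 3 * B.length) + 4 * K * (100 + 3 * A.length) with hC₀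
  refine ⟨(MSTEnum.enumeration A B K).code 0, κ + K + A.length + B.length + 7, c + C₀,
    fun I hI w W hW s hs => ?_, fun I hI W hW => ?_⟩
  · have hF := MSTEnum.Fits.of_wordSizeOK hA hB hI hW
    obtain ⟨h1, h2, -⟩ := hF.exists_run w hs
    refine ⟨h1, h2 _ ?_⟩
    set x := max (I.maxDeg : ℝ) ((T I : ℝ) / (I.n : ℝ))
    have hpos : 0 < I.n := Fin.pos_iff_nonempty.2 hI.nonempty
    -- on a single vertex, a positive number of steps is needed to halt
    have hx1 : 1 ≤ x := by
      rcases Nat.lt_or_ge I.n 2 with hn | hn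
      · have hn : I.n = 1 := by omega
        have hT : 0 < T I := Nat.pos_of_mul_pos_left (hA.pos I hI)
        refine le_max_of_le_right ?_
        rw [hn, Nat.cast_one, div_one]
        exact_mod_cast hT
      · have := I.degree_pos hI hn hpos
        have := I.degree_le_maxDeg 0
        refine le_max_of_le_left ?_
        exact_mod_cast (by omega : 1 ≤ I.maxDeg)
    have h3 : (I.maxDeg : ℝ) ≤ x := le_max_left _ _
    have h4 : ((T I / I.n : ℕ) : ℝ) ≤ x := Nat.cast_div_le.trans (le_max_right _ _)
    refine (MSTEnum.delayBound_le (x := x) (by linarith) (by linarith)).trans ?_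
    exact mul_le_mul_of_nonneg_right (Nat.cast_le.2 (Nat.le_add_left _ _)) (by linarith)
  · have hF := MSTEnum.Fits.of_wordSizeOK hA hB hI hW
    have hκ : MSTEnum.WordSizeOK κ I W := by
      refine le_trans ?_ hW
      exact Nat.mul_le_mul_right _ (by omega)
    refine ⟨(hF.space_le (hBspace I hI W hκ)).trans ?_, ?_⟩
    · gcongr
      omega
    · refine (add_le_add hF.n_le_space hF.space_le_space).trans ?_
      rw [← two_mul]
      gcongr
      exact_mod_cast (by omega : 2 ≤ c + C₀)
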